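/- **Notation.** Let $\Lambda^{\pm}=\mathbb C[p_i : i\in\mathbb Z]$ be the polynomial algebra in free generators $p_i$, and for $N\ge 0$ let $\varphi_N:\Lambda^{\pm}\to\mathbb C[z_1^{\pm1},\dots,z_N^{\pm1}]$ be the homomorphism $p_j\mapsto z_1^j+\dots+z_N^j$ (so $p_0\mapsto N$). For a pair of partitions $\lambda,\mu$ and $N\ge l(\lambda)+l(\mu)$ put $\chi=(\lambda_1,\dots,\lambda_r,0,\dots,0,-\mu_s,\dots,-\mu_1)\in\mathbb Z^N$, where $r=l(\lambda)$, $s=l(\mu)$, and let $m_\chi$ be the sum of $z^v$ over the distinct permutations $v$ of $\chi$. Let $m_{\lambda,\mu}\in\Lambda^{\pm}$ be the unique element with $\varphi_N(m_{\lambda,\mu})=m_\chi$ for all $N\ge l(\lambda)+l(\mu)$. For a complex number $p_0$, specialise the generator $p_0$ to this number; $\Lambda^{\pm}$ becomes $\mathbb C[p_i : i\ne 0]$, and $m_{\lambda,\mu}$ denotes also the image in it. If the number $p_0$ is $N$, then $\varphi_N$ is defined on the specialised algebra. Let $*$ be the involution $p_i^*=p_{-i}$. With $\partial_a=a\,\partial/\partial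 p_a$ (so $\partial_0=0$), the Laurent CMS operator with parameters $k,p_0\in\mathbb C$ is $$\mathcal L_{k,p_0}=\sum_{a,b\in\mathbb Z}p_{a+b}\partial_a\partial_b-k\Big[\sum_{a,b>0}p_ap_b\partial_{a+b}-\sum_{a,b<0}p_ap_b\partial_{a+b}\Big]-kp_0\Big[\sum_{a>0}p_a\partial_a-\sum_{a<0}p_a\partial_a\Big]+(1+k)\sum_{a\in\mathbb Z}a\,p_a\partial_a .$$ Write $(\tilde\lambda,\tilde\mu)\preccurlyeq(\lambda,\mu)$ if $|\tilde\lambda|-|\tilde\mu|=|\lambda|-|\mu|$ and, for all $n\ge1$, $\tilde\lambda_1+\dots+\tilde\lambda_n\le\lambda_1+\dots+\lambda_n$ and $\tilde\mu_1+\dots+\tilde\mu_n\le\mu_1+\dots+\mu_n$; write $\prec$ if moreover the pairs are different. Call $(k,p_0)\in\mathbb C^2$ generic if $a+bk+ckp_0\neq0$ for all integers $a,b,c$ with $a\ne0$. (For an integer $p_0$ this says that $k$ is $0$ or not rational.) For a partition $\nu$ with at most $N$ parts, the Jack polynomial $P_\nu(z_1,\dots,z_N;k)$ is the symmetric polynomial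 of the form $m_\nu+\sum_{\kappa<\nu}c_\kappa m_\kappa$ (dominance order on partitions of $|\nu|$ with at most $N$ parts) that is an eigenfunction of $$\mathcal L_k^{(N)}=\sum_{i=1}^N\Big(z_i\frac{\partial}{\partial z_i}\Big)^2-k\sum_{i<j}\frac{z_i+z_j}{z_i-z_j}\Big(z_i\frac{\partial}{\partial z_i}-z_j\frac{\partial}{\partial z_j}\Big).$$ **Theorem.** (i) If $(k,p_0)$ is generic, then for every pair of partitions $(\lambda,\mu)$ there is a unique element $P_{\lambda,\mu}=P_{\lambda,\mu}(k,p_0)$ of $\Lambda^{\pm}$ (with $p_0$ specialised) of the form $$P_{\lambda,\mu}=m_{\lambda,\mu}+\sum_{(\tilde\lambda,\tilde\mu)\prec(\lambda,\mu)}u^{\tilde\lambda\tilde\mu}_{\lambda\mu}\,m_{\tilde\lambda,\tilde\mu},\qquad u^{\tilde\lambda\tilde\mu}_{\lambda\mu}\in\mathbb C,$$ that is an eigenfunction of $\mathcal L_{k,p_0}$. (ii) Let $r=l(\lambda)$, $s=l(\mu)$, let $N>r+s$, and let $(k,N)$ be generic. Then for every integer $a\ge\mu_1$ (every $a\ge 0$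 if $\mu=\emptyset$) $$\varphi_N P_{\lambda,\mu}(k,N)=(z_1\cdots z_N)^{-a}P_\nu(z_1,\dots,z_N;k),\qquad \nu=(\lambda_1+a,\dots,\lambda_r+a,a,\dots,a,a-\mu_s,\dots,a-\mu_1)\in\mathbb Z^N .$$ (iii) If $(k,p_0)$ is generic, then $P_{\lambda,\mu}^*=P_{\mu,\lambda}$ for all $\lambda,\mu$. -/

import Mathlib

noncomputable section

namespace JackLaurent

/-! ### Laurent polynomials in `N` variables and the algebra of Laurent symmetric functions -/

/-- The algebra `ℂ[z₁^{±1}, …, z_N^{±1}]`; the monomial `z^v`, `v ∈ ℤ^N`, is `single v 1`. -/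
abbrev Laurent (N : ℕ) : Type := AddMonoidAlgebra ℂ (Fin N → ℤ)

/-- The power sum `z₁^j + ⋯ + z_N^j`, `j ∈ ℤ`. -/
def laurentPowerSum (N : ℕ) (j : ℤ) : Laurent N :=
  ∑ i : Fin N, AddMonoidAlgebra.single (Pi.single i j) 1

/-- `Λ^±`: the commutative algebra with free generators `p_i`, `i ∈ ℤ` (`p_i` is `X i`). -/
abbrev LambdaPM : Type := MvPolynomial ℤ ℂ

/-- `φ_N : Λ^± → ℂ[z₁^{±1}, …, z_N^{±1}]`, `p_j ↦ z₁^j + ⋯ + z_N^j`; in particular `p_0 ↦ N`. -/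
def phi (N : ℕ) : LambdaPM →ₐ[ℂ] Laurent N := MvPolynomial.aeval (laurentPowerSum N)

/-- `Λ^±` with `p_0` specialised to a complex number: the polynomial algebra in the `p_i`, `i ≠ 0`.
The number itself enters through `powerSum`. -/
abbrev LambdaAt : Type := MvPolynomial {i : ℤ // i ≠ 0} ℂ

/-- The element `p_a` of the specialised algebra, `a ∈ ℤ`; for `a = 0` it is the number `p0`. -/
def powerSum (p0 : ℂ) (a : ℤ) : LambdaAt :=
  if h : a = 0 then MvPolynomial.C p0 else MvPolynomial.X ⟨a, h⟩

/-- The specialisation homomorphism sending the generator `p_0` to the number `p0`. -/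
def specialize (p0 : ℂ) : LambdaPM →ₐ[ℂ] LambdaAt := MvPolynomial.aeval (powerSum p0)

/-- `φ_N` on the algebra specialised at `p_0 = N`. -/
def phiAt (N : ℕ) : LambdaAt →ₐ[ℂ] Laurent N :=
  MvPolynomial.aeval (fun i : {i : ℤ // i ≠ 0} => laurentPowerSum N i.1)

/-- The involution `*`, `p_i ↦ p_{-i}`, leaving the number `p_0` fixed. -/
def star : LambdaAt →ₐ[ℂ] LambdaAt :=
  MvPolynomial.rename (fun i : {i : ℤ // i ≠ 0} => ⟨-i.1, neg_ne_zero.mpr i.2⟩)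

/-! ### The CMS operator in infinite dimension -/

/-- `∂_a = a ∂/∂p_a`; in particular `∂_0 = 0`. -/
def del (a : ℤ) (f : LambdaAt) : LambdaAt :=
  if h : a = 0 then 0 else (a : ℂ) • MvPolynomial.pderiv ⟨a, h⟩ f

/-- The Laurent CMS operator with parameters `k`, `p_0`:
`∑_{a,b∈ℤ} p_{a+b} ∂_a ∂_b - k [∑_{a,b>0} p_a p_b ∂_{a+b} - ∑_{a,b<0} p_a p_b ∂_{a+b}]`
`- k p_0 [∑_{a>0} p_a ∂_a - ∑_{a<0} p_a ∂_a] + (1+k) ∑_{a∈ℤ} a p_a ∂_a`.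
On each `f` all the sums have finitely many nonzero terms, because `f` involves finitely many
of the `p_i`. -/
def cmsInfinite (k p0 : ℂ) (f : LambdaAt) : LambdaAt :=
  (∑ᶠ ab : ℤ × ℤ, powerSum p0 (ab.1 + ab.2) * del ab.1 (del ab.2 f))
  - k • ((∑ᶠ (ab : ℤ × ℤ) (_ : 0 < ab.1 ∧ 0 < ab.2),
            powerSum p0 ab.1 * powerSum p0 ab.2 * del (ab.1 + ab.2) f)
        - ∑ᶠ (ab : ℤ × ℤ) (_ : ab.1 < 0 ∧ ab.2 < 0),
            powerSum p0 ab.1 * powerSum p0 ab.2 * del (ab.1 + ab.2) f)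
  - (k * p0) • ((∑ᶠ (a : ℤ) (_ : 0 < a), powerSum p0 a * del a f)
        - ∑ᶠ (a : ℤ) (_ : a < 0), powerSum p0 a * del a f)
  + (1 + k) • ∑ᶠ a : ℤ, (a : ℂ) • (powerSum p0 a * del a f)

/-! ### Pairs of partitions and monomial functions

A partition `λ` is a Young diagram: `λ_i` is `rowLen (i-1)`, the length `l(λ)` is `colLen 0`, and
`|λ|` is `card`. -/

/-- The sequence `χ = (λ_1, …, λ_r, 0, …, 0, -μ_s, …, -μ_1) ∈ ℤ^N` (for `N ≥ l(λ) + l(μ)`). -/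
def chi (N : ℕ) (lam mu : YoungDiagram) : Fin N → ℤ :=
  fun i => (lam.rowLen i : ℤ) - (mu.rowLen i.rev : ℤ)

/-- `m_χ`: the sum of the `z^v` over the distinct permutations `v` of `χ ∈ ℤ^N`. -/
def laurentMonomial {N : ℕ} (c : Fin N → ℤ) : Laurent N :=
  ∑ v ∈ Finset.univ.image (fun s : Equiv.Perm (Fin N) => c ∘ s), AddMonoidAlgebra.single v 1

/-- `m_{λ,μ}`: the unique element of `Λ^±` with `φ_N(m_{λ,μ}) = m_χ` for all
`N ≥ l(λ) + l(μ)`. -/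
def mFun (lam mu : YoungDiagram) : LambdaPM :=
  Classical.epsilon fun m : LambdaPM =>
    ∀ N : ℕ, lam.colLen 0 + mu.colLen 0 ≤ N → phi N m = laurentMonomial (chi N lam mu)

/-- The dominance order on pairs of partitions: `PairLE lam' mu' lam mu` means
`(λ', μ') ≼ (λ, μ)`. -/
def PairLE (lam' mu' lam mu : YoungDiagram) : Prop :=
  (lam'.card : ℤ) - mu'.card = (lam.card : ℤ) - mu.card ∧
  (∀ n : ℕ, ∑ i ∈ Finset.range n, lam'.rowLen i ≤ ∑ i ∈ Finset.range n, lam.rowLen i) ∧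
  (∀ n : ℕ, ∑ i ∈ Finset.range n, mu'.rowLen i ≤ ∑ i ∈ Finset.range n, mu.rowLen i)

/-! ### Jack--Laurent symmetric functions -/

/-- Genericity of the parameters: `(k, p_0)` lies on none of the curves `a + b k + c k p_0 = 0`
with integers `a ≠ 0`, `b`, `c`. For an integer `p_0` this says that `k` is `0` or irrational. -/
def Generic (k p0 : ℂ) : Prop :=
  ∀ a b c : ℤ, a ≠ 0 → (a : ℂ) + b * k + c * (k * p0) ≠ 0

/-- `P` equals `m_{λ,μ}` plus a linear combination of the `m_{λ',μ'}` with `(λ',μ') ≼ (λ,μ)`,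
`(λ',μ') ≠ (λ,μ)`, and is an eigenfunction of the Laurent CMS operator. -/
def IsJackLaurent (k p0 : ℂ) (lam mu : YoungDiagram) (P : LambdaAt) : Prop :=
  P - specialize p0 (mFun lam mu) ∈ Submodule.span ℂ
      {m : LambdaAt | ∃ lam' mu' : YoungDiagram, PairLE lam' mu' lam mu ∧
        (lam', mu') ≠ (lam, mu) ∧ m = specialize p0 (mFun lam' mu')} ∧
  ∃ E : ℂ, cmsInfinite k p0 P = E • P

/-- The Jack--Laurent symmetric function `P_{λ,μ}(k, p_0)`. -/
def jackLaurent (k p0 : ℂ) (lam mu : YoungDiagram) : LambdaAt :=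
  Classical.epsilon (IsJackLaurent k p0 lam mu)

/-! ### The usual Jack polynomials in `N` variables

A partition with at most `N` parts is an antitone `ν : Fin N → ℕ`. -/

/-- `z_i ∂/∂z_i`. -/
def euler {N : ℕ} (i : Fin N) (f : MvPolynomial (Fin N) ℂ) : MvPolynomial (Fin N) ℂ :=
  MvPolynomial.X i * MvPolynomial.pderiv i f

/-- The CMS operator in `N` variables, with values in the field of rational functions:
`∑_i (z_i ∂_i)² - k ∑_{i<j} (z_i + z_j)/(z_i - z_j) (z_i ∂_i - z_j ∂_j)`. -/
def cmsFinite (N : ℕ) (k : ℂ) (f : MvPolynomial (Fin N) ℂ) :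
    FractionRing (MvPolynomial (Fin N) ℂ) :=
  let ι := algebraMap (MvPolynomial (Fin N) ℂ) (FractionRing (MvPolynomial (Fin N) ℂ))
  ∑ i : Fin N, ι (euler i (euler i f))
  - ι (MvPolynomial.C k) * ∑ i : Fin N, ∑ j ∈ Finset.Ioi i,
      ι (MvPolynomial.X i + MvPolynomial.X j) / ι (MvPolynomial.X i - MvPolynomial.X j)
        * ι (euler i f - euler j f)

/-- The monomial symmetric polynomial `m_ν(z_1, …, z_N)`. -/
def monomialPoly {N : ℕ} (nu : Fin N → ℕ) : MvPolynomial (Fin N) ℂ :=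
  ∑ v ∈ Finset.univ.image (fun s : Equiv.Perm (Fin N) => nu ∘ s),
    MvPolynomial.monomial (Finsupp.equivFunOnFinite.symm v) 1

/-- `J` is `m_ν` plus a linear combination of the `m_κ` with `κ < ν` in the dominance order on
partitions (with at most `N` parts) of the same number, and is an eigenfunction of the CMS
operator in `N` variables. -/
def IsJack {N : ℕ} (k : ℂ) (nu : Fin N → ℕ) (J : MvPolynomial (Fin N) ℂ) : Prop :=
  J - monomialPoly nu ∈ Submodule.span ℂ
      {m : MvPolynomial (Fin N) ℂ | ∃ kap : Fin N → ℕ, Antitone kap ∧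
        ∑ i, kap i = ∑ i, nu i ∧
        (∀ j : Fin N, ∑ i ∈ Finset.Iic j, kap i ≤ ∑ i ∈ Finset.Iic j, nu i) ∧
        kap ≠ nu ∧ m = monomialPoly kap} ∧
  ∃ E : ℂ, cmsFinite N k J =
    algebraMap (MvPolynomial (Fin N) ℂ) (FractionRing (MvPolynomial (Fin N) ℂ)) (E • J)

/-- The usual Jack polynomial `P_ν(z_1, …, z_N; k)` (Jack parameter `α = -1/k`). -/
def jack {N : ℕ} (k : ℂ) (nu : Fin N → ℕ) : MvPolynomial (Fin N) ℂ :=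
  Classical.epsilon (IsJack k nu)

/-- The inclusion of polynomials into Laurent polynomials. -/
def toLaurent (N : ℕ) : MvPolynomial (Fin N) ℂ →ₐ[ℂ] Laurent N :=
  MvPolynomial.aeval (fun i : Fin N => AddMonoidAlgebra.single (Pi.single i (1 : ℤ)) 1)

/-- `ν = (λ_1 + a, …, λ_r + a, a, …, a, a - μ_s, …, a - μ_1)`, for `N ≥ l(λ) + l(μ)` and
`a ≥ μ_1`. -/
def shifted (N : ℕ) (lam mu : YoungDiagram) (a : ℕ) : Fin N → ℕ :=
  fun i => lam.rowLen i + (a - mu.rowLen i.rev)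

end JackLaurent

end

/-!
# Jack--Laurent symmetric functions

The homomorphisms `φ_N` are jointly faithful: an element of `Λ^±` killed by `φ_N` for all large `N`
vanishes (`phi_eventually_injective`). They intertwine the Laurent CMS operator at `p_0 = N` with
the CMS operator in `N` variables (`phiAt_cmsInfinite`). On symmetric Laurent polynomials the
latter is the operator `lap`, in which the quotient `(z_p + z_q)/(z_p - z_q)` has been divided out:
the pair `(p, q)` replaces `z^v` by the sum of the monomials whose exponents arise from `v` by
moving units from the larger of `v_p`, `v_q` to the smaller (`squeeze`).

Sums over injective maps give augmented monomial functions `aug`, of which `m_{λ,μ}` is a multiple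
(`mFun_eq`). In `N` variables `lap` squeezes each pair of entries and each entry against a zero
(`lap_augL`). No coefficient depends on `N` except through the factor `p_0 - n` produced by a zero
entry, so the formula lifts to `Λ^±` and, after specialisation, holds for the operator
`L_{k,p_0}` for every `p_0` (`exists_universal_cms`, `cmsInfinite_aug`).

Squeezing decreases the pair of partitions in the order `≼`. Hence `L_{k,p_0}` is triangular in the
linearly independent family `m_{λ,μ}`, and its diagonal entry is
`q + b k + c k p_0`, where `q` is the sum of the squares of the parts and `2b`, `c` are integers
(`cmsInfinite_mFun_sub_mem`, `linearIndependent_mFun`). The number `q` strictly decreases along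
`≺` (`sqSum_lt`), so for generic parameters the diagonal entry at `(λ,μ)` differs from all those
below it. Only finitely many pairs lie below, and a triangular operator with this property has
exactly one eigenvector with the prescribed leading term (`existsUnique_eigenvector`).

Since `φ_N(m_{λ,μ})` is `m_χ` or `0`, the product of `φ_N(P_{λ,μ})` and `(z_1 ⋯ z_N)^a` is a
combination of the `m_κ` with `κ` at most `ν` in the dominance order. It is again an eigenfunction,
because `φ_N(P_{λ,μ})` is homogeneous and conjugating `lap` by `(z_1 ⋯ z_N)^a` only adds an Euler
operator and a constant (`lap_shift`). The same triangularity argument in `N` variables shows that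
it is the Jack polynomial `P_ν` (`IsJackLaurent.exists_isJack`, `IsJack.unique`). Finally `*`
commutes with `L_{k,p_0}` and exchanges `m_{λ,μ}` and `m_{μ,λ}`, so duality follows from
uniqueness.
-/

noncomputable section

namespace JackLaurent

/-! ### The CMS operator on Laurent polynomials -/

section Laurent

variable {N : ℕ}

/-- The linear operator on Laurent polynomials with prescribed values on the monomials. -/
def onMonomials (g : (Fin N → ℤ) → Laurent N) : Laurent N →ₗ[ℂ] Laurent N :=
  Finsupp.linearCombination ℂ g ∘ₗ (AddMonoidAlgebra.coeffLinearEquiv ℂ).toLinearMap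

@[simp]
lemma onMonomials_single (g : (Fin N → ℤ) → Laurent N) (v : Fin N → ℤ) (c : ℂ) :
    onMonomials g (AddMonoidAlgebra.single v c) = c • g v := by
  simp [onMonomials, AddMonoidAlgebra.coeffLinearEquiv]

/-- The monomial `z^v`. -/
abbrev zPow (v : Fin N → ℤ) : Laurent N := AddMonoidAlgebra.single v 1

lemma zPow_mul (v w : Fin N → ℤ) : zPow v * zPow w = zPow (v + w) := by
  simp [zPow, AddMonoidAlgebra.single_mul_single]

lemma linearMap_ext_zPow {V : Type*} [AddCommMonoid V] [Module ℂ V] {f g : Laurent N →ₗ[ℂ] V}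
    (h : ∀ v, f (zPow v) = g (zPow v)) : f = g := by
  apply AddMonoidAlgebra.lhom_ext'
  intro v
  ext
  simpa using h v

/-- The Euler operator `z_i ∂/∂z_i`. -/
def theta (i : Fin N) : Laurent N →ₗ[ℂ] Laurent N :=
  onMonomials fun v => (v i : ℂ) • zPow v

@[simp]
lemma theta_zPow (i : Fin N) (v : Fin N → ℤ) : theta i (zPow v) = (v i : ℂ) • zPow v := by
  simp [theta]

lemma theta_mul (i : Fin N) (f g : Laurent N) :
    theta i (f * g) = theta i f * g + f * theta i g := by
  have : (theta i) ∘ₗ LinearMap.mul' ℂ (Laurent N) =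
      LinearMap.mul' ℂ (Laurent N) ∘ₗ ((theta i).rTensor _ + (theta i).lTensor _) := by
    apply TensorProduct.ext
    refine linearMap_ext_zPow fun v => linearMap_ext_zPow fun w => ?_
    simp [-AddMonoidAlgebra.smul_single, add_smul]
  simpa using congr($this (f ⊗ₜ g))

end Laurent

/-- The vector obtained from `v` by moving `l` units from the larger to the smaller of the two
entries `v p`, `v q`. -/
def squeeze {ι : Type*} [DecidableEq ι] (v : ι → ℤ) (p q : ι) (l : ℕ) : ι → ℤ :=
  v - Pi.single p (Int.sign (v p - v q) * l) + Pi.single q (Int.sign (v p - v q) * l)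

lemma squeeze_comm {ι : Type*} [DecidableEq ι] (v : ι → ℤ) (p q : ι) (l : ℕ) :
    squeeze v p q l = squeeze v q p l := by
  have : Int.sign (v q - v p) = - Int.sign (v p - v q) := by rw [← Int.sign_neg]; congr 1; ring
  simp only [squeeze, this, neg_mul, Pi.single_neg]
  ring

lemma squeeze_zero {ι : Type*} [DecidableEq ι] (v : ι → ℤ) (p q : ι) : squeeze v p q 0 = v := by
  simp [squeeze]

lemma squeeze_neg {ι : Type*} [DecidableEq ι] (v : ι → ℤ) (p q : ι) (l : ℕ) :
    squeeze (-v) p q l = - squeeze v p q l := by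
  have : Int.sign (-v p - -v q) = - Int.sign (v p - v q) := by rw [← Int.sign_neg]; congr 1; ring
  simp only [squeeze, Pi.neg_apply, this, neg_mul, Pi.single_neg]
  ring

lemma squeeze_add_const {ι : Type*} [DecidableEq ι] (v : ι → ℤ) (c : ℤ) (p q : ι) (l : ℕ) :
    squeeze (v + fun _ => c) p q l = squeeze v p q l + fun _ => c := by
  simp only [squeeze, Pi.add_apply, add_sub_add_right_eq_sub]
  ring

section Laurent

variable {N : ℕ}

/-- The symmetric half of `(z_p + z_q)/(z_p - z_q) (z_p ∂_p - z_q ∂_q) z^v`, a polynomial: on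
the sum of `z^v` and its image under the transposition of `p` and `q` both agree. -/
def pairTerm (v : Fin N → ℤ) (p q : Fin N) : Laurent N :=
  ((v p - v q).natAbs : ℂ) • ∑ l ∈ Finset.range (v p - v q).natAbs, zPow (squeeze v p q l)

lemma pairTerm_comm (v : Fin N → ℤ) (p q : Fin N) : pairTerm v p q = pairTerm v q p := by
  have : (v p - v q).natAbs = (v q - v p).natAbs := by omega
  simp only [pairTerm, this, squeeze_comm v p q]

/-- The linear operator with value `pairTerm v p q` on `z^v`. -/
def pairOp (p q : Fin N) : Laurent N →ₗ[ℂ] Laurent N := onMonomials fun v => pairTerm v p q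

@[simp]
lemma pairOp_zPow (p q : Fin N) (v : Fin N → ℤ) : pairOp p q (zPow v) = pairTerm v p q := by
  simp [pairOp]

lemma pairOp_comm (p q : Fin N) : pairOp p q = pairOp q p := by
  simp only [pairOp, pairTerm_comm _ p q]

/-- The CMS operator on Laurent polynomials. It is the true one on symmetric Laurent
polynomials only: the non-symmetric part of each pair interaction has been dropped, so that no
denominators occur. -/
def lap (N : ℕ) (k : ℂ) : Laurent N →ₗ[ℂ] Laurent N :=
  ∑ i, theta i ∘ₗ theta i - (k / 2) • ∑ p, ∑ q, pairOp p q

lemma lap_zPow (k : ℂ) (v : Fin N → ℤ) :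
    lap N k (zPow v) = (∑ i, (v i : ℂ) ^ 2) • zPow v - (k / 2) • ∑ p, ∑ q, pairTerm v p q := by
  simp only [lap, LinearMap.sub_apply, LinearMap.smul_apply, LinearMap.sum_apply, pairOp_zPow,
    LinearMap.comp_apply, theta_zPow, map_smul, smul_smul, Finset.sum_smul, pow_two]

/-- The action of permutations of the variables. -/
def permAct (σ : Equiv.Perm (Fin N)) : Laurent N →ₐ[ℂ] Laurent N :=
  AddMonoidAlgebra.mapDomainAlgHom ℂ ℂ
    ({ toFun := fun v => v ∘ σ, map_zero' := rfl, map_add' := fun _ _ => rfl } :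
      (Fin N → ℤ) →+ (Fin N → ℤ))

@[simp]
lemma permAct_zPow (σ : Equiv.Perm (Fin N)) (v : Fin N → ℤ) :
    permAct σ (zPow v) = zPow (v ∘ σ) := by
  simp [permAct]

/-- Invariance under all permutations of the variables. -/
def IsSymm (f : Laurent N) : Prop := ∀ σ : Equiv.Perm (Fin N), permAct σ f = f

lemma IsSymm.mul {f g : Laurent N} (hf : IsSymm f) (hg : IsSymm g) : IsSymm (f * g) :=
  fun σ => by rw [map_mul, hf σ, hg σ]

lemma isSymm_powerSum (j : ℤ) : IsSymm (laurentPowerSum N j) := by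
  intro σ
  have : ∀ i : Fin N, (Pi.single i j : Fin N → ℤ) ∘ σ = Pi.single (σ.symm i) j := by
    intro i
    ext x
    simp [Pi.single_apply, Equiv.eq_symm_apply]
  simp only [laurentPowerSum, map_sum, permAct_zPow, this]
  exact Equiv.sum_comp σ.symm (fun i => (zPow (Pi.single i j : Fin N → ℤ)))

lemma isSymm_phi (f : LambdaPM) : IsSymm (phi N f) := by
  intro σ
  have : (permAct σ).comp (phi N) = phi N := by
    refine MvPolynomial.algHom_ext fun i => ?_
    simpa [phi] using isSymm_powerSum i σ
  exact congr($this f)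

/-- The variable `z_p`. -/
abbrev zVar (p : Fin N) : Laurent N := zPow (Pi.single p 1)

lemma zVar_ne {p q : Fin N} (h : p ≠ q) : zVar p - zVar q ≠ 0 := by
  rw [sub_ne_zero]
  intro h'
  rw [AddMonoidAlgebra.single_left_inj one_ne_zero] at h'
  have := congr_fun h' p
  simp [h] at this

lemma telescope_pairTerm (v : Fin N → ℤ) (p q : Fin N) (h : p ≠ q) (hd : v q ≤ v p) :
    (zVar p - zVar q) * (pairTerm v p q + pairTerm (v ∘ Equiv.swap p q) p q) =
      (zVar p + zVar q) * (((v p - v q : ℤ) : ℂ) • (zPow v - zPow (v ∘ Equiv.swap p q))) := by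
  obtain ⟨d, hd⟩ : ∃ d : ℕ, v p - v q = d := ⟨(v p - v q).toNat, by omega⟩
  -- the string of monomials between `z^v` and its transposed
  set w : ℕ → Laurent N := fun l => zPow (v - Pi.single p (l : ℤ) + Pi.single q (l : ℤ)) with hw
  rcases Nat.eq_zero_or_pos d with rfl | hpos
  · have h1 : v q - v p = 0 := by simp at hd; omega
    simp [pairTerm, hd, h1]
  have e0 : zPow v = w 0 := by simp [hw]
  have ed : zPow (v ∘ Equiv.swap p q) = w d := by
    simp only [hw]
    congr 1
    ext i
    rcases eq_or_ne i p with rfl | hp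
    · simp [h]; omega
    rcases eq_or_ne i q with rfl | hq
    · simp [h.symm]; omega
    simp [hp, hq, Equiv.swap_apply_of_ne_of_ne hp hq]
  have h1 : pairTerm v p q = (d : ℂ) • ∑ l ∈ Finset.range d, w l := by
    have hs : Int.sign (v p - v q) = 1 := Int.sign_eq_one_of_pos (by omega)
    simp [pairTerm, hd, squeeze, hw, Int.sign_eq_one_of_pos (show (0 : ℤ) < d by omega)]
  have h2 : pairTerm (v ∘ Equiv.swap p q) p q = (d : ℂ) • ∑ l ∈ Finset.range d, w (l + 1) := by
    have hd' : v q - v p = -d := by omega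
    rw [← Finset.sum_range_reflect]
    simp only [pairTerm, Function.comp_apply, Equiv.swap_apply_left, Equiv.swap_apply_right, hd',
      Int.natAbs_neg, Int.natAbs_natCast]
    congr 1
    refine Finset.sum_congr rfl fun l hl => ?_
    rw [Finset.mem_range] at hl
    simp only [hw]
    congr 1
    have hs : Int.sign (-(d : ℤ)) = -1 := Int.sign_eq_neg_one_of_neg (by omega)
    have hc : ((d - 1 - l + 1 : ℕ) : ℤ) = d - l := by omega
    ext i
    rcases eq_or_ne i p with rfl | hp
    · simp [squeeze, h, hc, hd', hs]; omega
    rcases eq_or_ne i q with rfl | hq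
    · simp [squeeze, h.symm, hc, hd', hs]; omega
    simp [squeeze, hp, hq, Equiv.swap_apply_of_ne_of_ne hp hq]
  have hstep : ∀ l, zVar q * w l = zVar p * w (l + 1) := by
    intro l
    simp only [hw, zVar, zPow_mul]
    congr 1
    push_cast
    simp only [Pi.single_add]
    ring
  have hq : ∑ l ∈ Finset.range d, zVar q * w l = ∑ l ∈ Finset.range d, zVar p * w (l + 1) :=
    Finset.sum_congr rfl fun l _ => hstep l
  rw [← Finset.mul_sum, ← Finset.mul_sum] at hq
  have htel : ∑ l ∈ Finset.range d, w (l + 1) = ∑ l ∈ Finset.range d, w l + w d - w 0 := by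
    rw [← Finset.sum_range_succ, Finset.sum_range_succ']; ring
  rw [htel] at hq
  rw [h1, h2, e0, ed, hd, htel, ← smul_add, mul_smul_comm, mul_smul_comm]
  congr 1
  linear_combination (-2) * hq

lemma zVar_sub_mul_pairTerm (v : Fin N → ℤ) (p q : Fin N) (h : p ≠ q) :
    (zVar p - zVar q) * (pairTerm v p q + pairTerm (v ∘ Equiv.swap p q) p q) =
      (zVar p + zVar q) * (((v p - v q : ℤ) : ℂ) • (zPow v - zPow (v ∘ Equiv.swap p q))) := by
  rcases le_total (v q) (v p) with hd | hd
  · exact telescope_pairTerm v p q h hd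
  · have := telescope_pairTerm v q p h.symm hd
    rw [pairTerm_comm v q p, pairTerm_comm _ q p, Equiv.swap_comm q p,
      show ((v q - v p : ℤ) : ℂ) = -((v p - v q : ℤ) : ℂ) by push_cast; ring, neg_smul] at this
    linear_combination -this

/-- On symmetric Laurent polynomials `pairOp p q` is the operator
`(z_p + z_q)/(z_p - z_q) (z_p ∂_p - z_q ∂_q)`. -/
lemma zVar_sub_mul_pairOp {f : Laurent N} (hf : IsSymm f) {p q : Fin N} (h : p ≠ q) :
    (zVar p - zVar q) * pairOp p q f = (zVar p + zVar q) * (theta p f - theta q f) := by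
  have key : LinearMap.mulLeft ℂ (zVar p - zVar q) ∘ₗ
        (pairOp p q + pairOp p q ∘ₗ (permAct (Equiv.swap p q)).toLinearMap) =
      LinearMap.mulLeft ℂ (zVar p + zVar q) ∘ₗ ((theta p - theta q) +
        (theta p - theta q) ∘ₗ (permAct (Equiv.swap p q)).toLinearMap) := by
    refine linearMap_ext_zPow fun v => ?_
    simp only [LinearMap.comp_apply, LinearMap.add_apply, LinearMap.sub_apply, pairOp_zPow,
      AlgHom.toLinearMap_apply, permAct_zPow, LinearMap.mulLeft_apply, theta_zPow,
      zVar_sub_mul_pairTerm v p q h, Function.comp_apply, Equiv.swap_apply_left,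
      Equiv.swap_apply_right]
    congr 1
    push_cast
    simp only [sub_smul, smul_sub]
    abel
  have := congr($key f)
  simp only [LinearMap.comp_apply, LinearMap.add_apply, LinearMap.sub_apply,
      AlgHom.toLinearMap_apply, LinearMap.mulLeft_apply, hf (Equiv.swap p q), ← two_smul ℂ,
      mul_smul_comm] at this
  exact smul_right_injective _ (two_ne_zero (α := ℂ)) this

lemma pairOp_self (p : Fin N) : pairOp p p = 0 := by
  refine linearMap_ext_zPow fun v => ?_
  simp [pairTerm]

lemma pairOp_mul {f g : Laurent N} (hf : IsSymm f) (hg : IsSymm g) (p q : Fin N) :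
    pairOp p q (f * g) = pairOp p q f * g + f * pairOp p q g := by
  rcases eq_or_ne p q with rfl | h
  · simp [pairOp_self]
  apply mul_left_cancel₀ (zVar_ne h)
  have h1 := zVar_sub_mul_pairOp hf h
  have h2 := zVar_sub_mul_pairOp hg h
  have h3 := zVar_sub_mul_pairOp (hf.mul hg) h
  rw [theta_mul, theta_mul] at h3
  linear_combination h3 - g * h1 - f * h2

/-- The CMS operator is a second order differential operator on symmetric Laurent
polynomials. -/
lemma lap_mul (k : ℂ) {f g : Laurent N} (hf : IsSymm f) (hg : IsSymm g) :
    lap N k (f * g) = lap N k f * g + f * lap N k g + 2 * ∑ i, theta i f * theta i g := by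
  simp only [lap, LinearMap.sub_apply, LinearMap.smul_apply, LinearMap.sum_apply,
    LinearMap.comp_apply, theta_mul, map_add, pairOp_mul hf hg, Finset.sum_add_distrib, smul_add,
    sub_mul, mul_sub, Finset.sum_mul, Finset.mul_sum, smul_mul_assoc, mul_smul_comm, two_mul]
  abel

/-- The CMS operator depends on the differences of the exponents only, up to lower order
terms. -/
lemma lap_shift (k : ℂ) (a : ℤ) (f : Laurent N) :
    lap N k (zPow (fun _ => a) * f) =
      zPow (fun _ => a) * (lap N k f + (2 * a : ℂ) • ∑ i, theta i f + (N * a ^ 2 : ℂ) • f) := by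
  have : lap N k ∘ₗ LinearMap.mulLeft ℂ (zPow fun _ => a) = LinearMap.mulLeft ℂ (zPow fun _ => a) ∘ₗ
      (lap N k + (2 * a : ℂ) • ∑ i, theta i + (N * a ^ 2 : ℂ) • LinearMap.id) := by
    refine linearMap_ext_zPow fun v => ?_
    have hp : ∀ p q, pairTerm ((fun _ => a) + v) p q = zPow (fun _ => a) * pairTerm v p q := by
      intro p q
      rw [add_comm]
      simp only [pairTerm, Pi.add_apply, add_sub_add_right_eq_sub, squeeze_add_const,
        mul_smul_comm, Finset.mul_sum, zPow_mul]
      simp only [add_comm]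
    simp only [LinearMap.comp_apply, LinearMap.mulLeft_apply, zPow_mul, lap_zPow,
      LinearMap.add_apply, LinearMap.smul_apply, LinearMap.sum_apply, theta_zPow, mul_add, mul_sub,
      mul_smul_comm, Finset.mul_sum, hp, LinearMap.id_apply]
    have hsq : (∑ i, (((fun _ => a) + v : Fin N → ℤ) i : ℂ) ^ 2) =
        ∑ i, (v i : ℂ) ^ 2 + 2 * a * ∑ i, (v i : ℂ) + N * a ^ 2 := by
      simp only [Pi.add_apply, Int.cast_add, add_sq, Finset.sum_add_distrib, Finset.sum_const,
        Finset.card_univ, Fintype.card_fin, nsmul_eq_mul, Finset.mul_sum]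
      ring
    rw [hsq]
    simp only [← Finset.sum_smul, smul_smul, add_smul]
    abel
  simpa only [LinearMap.comp_apply, LinearMap.mulLeft_apply, LinearMap.add_apply,
    LinearMap.smul_apply, LinearMap.sum_apply, LinearMap.id_apply] using congr($this f)

/-- The substitution `z_i ↦ z_i⁻¹`. -/
def invAct (N : ℕ) : Laurent N →ₐ[ℂ] Laurent N :=
  AddMonoidAlgebra.mapDomainAlgHom ℂ ℂ (-AddMonoidHom.id (Fin N → ℤ))

@[simp]
lemma invAct_zPow (v : Fin N → ℤ) : invAct N (zPow v) = zPow (-v) := by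
  simp [invAct]

lemma lap_invAct (k : ℂ) (f : Laurent N) : lap N k (invAct N f) = invAct N (lap N k f) := by
  have : lap N k ∘ₗ (invAct N).toLinearMap = (invAct N).toLinearMap ∘ₗ lap N k := by
    refine linearMap_ext_zPow fun v => ?_
    have hp : ∀ p q, pairTerm (-v) p q = invAct N (pairTerm v p q) := by
      intro p q
      have : (-v p - -v q).natAbs = (v p - v q).natAbs := by omega
      simp only [pairTerm, Pi.neg_apply, this, squeeze_neg, map_smul, map_sum, invAct_zPow]
    simp only [LinearMap.comp_apply, AlgHom.toLinearMap_apply, invAct_zPow, lap_zPow, hp, map_sub,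
      map_smul, map_sum, Pi.neg_apply, Int.cast_neg, neg_sq]
  exact congr($this f)

end Laurent

/-! ### Augmented monomial functions -/

/-- The augmented monomial function in `N` variables: the sum of `z_{f(0)}^{a_0} ⋯ z_{f(n-1)}^{a_{n-1}}`
over the injective maps `f`. It vanishes for `N < n`. -/
def augL (N : ℕ) {n : ℕ} (a : Fin n → ℤ) : Laurent N :=
  ∑ f : Fin n ↪ Fin N, zPow (Function.extend f a 0)

/-- The augmented monomial function of the integers `a_0, …, a_{n-1}` as an element of `Λ^±`, by
the rule `p_b m_a = m_{(b,a)} + ∑_i m_{a + b e_i}`. Zero entries are allowed. -/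
def aug : (n : ℕ) → (Fin n → ℤ) → LambdaPM
  | 0, _ => 1
  | n + 1, a => MvPolynomial.X (a 0) * aug n (Fin.tail a)
      - ∑ i, aug n (Fin.tail a + Pi.single i (a 0))

lemma aug_cons {n : ℕ} (b : ℤ) (a : Fin n → ℤ) :
    aug (n + 1) (Fin.cons b a) =
      MvPolynomial.X b * aug n a - ∑ i, aug n (a + Pi.single i b) := by
  simp [aug]

lemma aug_cons_zero {n : ℕ} (a : Fin n → ℤ) :
    aug (n + 1) (Fin.cons 0 a) = (MvPolynomial.X 0 - (n : LambdaPM)) * aug n a := by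
  simp [aug_cons, sub_mul]

lemma sum_eq_sum_range_add {ι κ A : Type*} [Fintype ι] [Fintype κ] [AddCommMonoid A]
    (f : ι ↪ κ) [Fintype {j // j ∉ Set.range f}] (g : κ → A) :
    ∑ j, g j = ∑ i, g (f i) + ∑ j : {j // j ∉ Set.range f}, g j := by
  classical
  rw [← Fintype.sum_subtype_add_sum_subtype (· ∈ Set.range f)]
  congr 1
  · symm
    convert Fintype.sum_equiv (Equiv.ofInjective f f.injective) (fun i => g (f i))
      (fun j => g j.1) fun _ => rfl
  · convert rfl

lemma extend_add {ι κ : Type*} [DecidableEq ι] [DecidableEq κ] (f : ι ↪ κ) (a b : ι → ℤ) :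
    Function.extend f (a + b) 0 = Function.extend f a 0 + Function.extend f b 0 := by
  ext q
  by_cases h : ∃ i, f i = q
  · obtain ⟨i, rfl⟩ := h
    simp [f.injective.extend_apply]
  · simp [Function.extend_apply', h]

lemma extend_single {ι κ : Type*} [DecidableEq ι] [DecidableEq κ] (f : ι ↪ κ) (i : ι) (b : ℤ) :
    Function.extend f (Pi.single i b) 0 = Pi.single (f i) b := by
  ext q
  by_cases h : ∃ i, f i = q
  · obtain ⟨j, rfl⟩ := h
    simp [f.injective.extend_apply, Pi.single_apply]
  · rw [Function.extend_apply' _ _ _ h, Pi.single_eq_of_ne (fun h' => h ⟨i, h'.symm⟩)]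
    rfl

lemma extend_cons {n N : ℕ} (f : Fin n ↪ Fin N) (q : {q // q ∉ Set.range f}) (a : Fin n → ℤ)
    (b : ℤ) : Function.extend ((Equiv.embeddingFinSucc n (Fin N)).symm ⟨f, q⟩)
      (Fin.cons b a : Fin (n + 1) → ℤ) 0 = Pi.single q.1 b + Function.extend f a 0 := by
  set e := (Equiv.embeddingFinSucc n (Fin N)).symm ⟨f, q⟩ with he
  have hc : (e : Fin (n + 1) → Fin N) = Fin.cons q.1 f := by simp [he]
  ext j
  by_cases h : ∃ i, e i = j
  · obtain ⟨i, rfl⟩ := h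
    rw [e.injective.extend_apply, hc]
    induction i using Fin.cases with
    | zero =>
      have : ¬ ∃ i, f i = q.1 := q.2
      simp [Function.extend_apply' _ _ _ this]
    | succ i =>
      have : f i ≠ q.1 := fun h => q.2 ⟨i, h⟩
      simp [f.injective.extend_apply, this]
  · have h0 : j ≠ q.1 := fun h' => h ⟨0, by rw [hc]; simp [h']⟩
    have h1 : ¬ ∃ i, f i = j := fun ⟨i, hi⟩ => h ⟨i.succ, by rw [hc]; simpa using hi⟩
    simp [Function.extend_apply' _ _ _ h, Function.extend_apply' _ _ _ h1, h0]

lemma augL_succ (N : ℕ) {n : ℕ} (a : Fin (n + 1) → ℤ) :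
    augL N a = ∑ f : Fin n ↪ Fin N, ∑ q : {q // q ∉ Set.range f},
      zPow (Function.extend ((Equiv.embeddingFinSucc n (Fin N)).symm ⟨f, q⟩) a 0) := by
  classical
  rw [augL, ← Equiv.sum_comp (Equiv.embeddingFinSucc n (Fin N)).symm, Fintype.sum_sigma]

lemma powerSum_mul_augL (N : ℕ) {n : ℕ} (b : ℤ) (a : Fin n → ℤ) :
    laurentPowerSum N b * augL N a =
      augL N (Fin.cons b a : Fin (n + 1) → ℤ) + ∑ i, augL N (a + Pi.single i b) := by
  classical
  have hc : ∑ i, augL N (a + Pi.single i b) =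
      ∑ f : Fin n ↪ Fin N, ∑ i, zPow (Function.extend f (a + Pi.single i b) 0) := by
    simp only [augL]
    exact Finset.sum_comm
  rw [hc]
  simp only [augL_succ, extend_cons]
  simp only [augL, laurentPowerSum, Finset.mul_sum, Finset.sum_mul, zPow_mul]
  rw [← Finset.sum_add_distrib]
  refine Finset.sum_congr rfl fun f _ => ?_
  rw [sum_eq_sum_range_add f, add_comm]
  congr 1
  refine Finset.sum_congr rfl fun i _ => ?_
  rw [extend_add, extend_single, add_comm]

lemma phi_aug (N : ℕ) : ∀ (n : ℕ) (a : Fin n → ℤ), phi N (aug n a) = augL N a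
  | 0, a => by
    have : Subsingleton (Fin 0 ↪ Fin N) := ⟨fun f g => by ext i; exact i.elim0⟩
    have h0 : ∀ f : Fin 0 ↪ Fin N, Function.extend f a (0 : Fin N → ℤ) = 0 := by
      intro f
      ext i
      exact Function.extend_apply' _ _ _ (fun ⟨j, _⟩ => j.elim0)
    rw [augL, Fintype.sum_subsingleton _ (⟨Fin.elim0, fun i => i.elim0⟩ : Fin 0 ↪ Fin N), h0]
    rw [aug, map_one, AddMonoidAlgebra.one_def]
  | n + 1, a => by
    have h := powerSum_mul_augL N (a 0) (Fin.tail a)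
    rw [Fin.cons_self_tail] at h
    simp only [aug, map_sub, map_mul, map_sum, phi_aug N n]
    rw [sub_eq_iff_eq_add, ← h]
    simp [phi]

/-- The interaction of the entries `p`, `q` of `a`, for a function `F` of integer vectors. -/
def pairSum {ι A : Type*} [DecidableEq ι] [AddCommMonoid A] [Module ℂ A] (F : (ι → ℤ) → A)
    (a : ι → ℤ) (p q : ι) : A :=
  ((a p - a q).natAbs : ℂ) • ∑ l ∈ Finset.range (a p - a q).natAbs, F (squeeze a p q l)

lemma map_pairSum {ι A B : Type*} [DecidableEq ι] [AddCommMonoid A] [Module ℂ A]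
    [AddCommMonoid B] [Module ℂ B] (T : A →ₗ[ℂ] B) (F : (ι → ℤ) → A) (a : ι → ℤ) (p q : ι) :
    T (pairSum F a p q) = pairSum (T ∘ F) a p q := by
  simp [pairSum]

lemma pairSum_sum {ι A κ : Type*} [DecidableEq ι] [AddCommMonoid A] [Module ℂ A]
    (s : Finset κ) (F : κ → (ι → ℤ) → A) (a : ι → ℤ) (p q : ι) :
    pairSum (fun v => ∑ f ∈ s, F f v) a p q = ∑ f ∈ s, pairSum (F f) a p q := by
  simp only [pairSum, Finset.smul_sum]
  rw [Finset.sum_comm]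

lemma pairTerm_extend {n N : ℕ} (f : Fin n ↪ Fin N) (a : Fin n → ℤ) (i j : Fin n) :
    pairTerm (Function.extend f a 0) (f i) (f j) =
      pairSum (fun v => zPow (Function.extend f v (0 : Fin N → ℤ))) a i j := by
  simp only [pairTerm, pairSum, squeeze, f.injective.extend_apply, sub_eq_add_neg, extend_add,
    ← Pi.single_neg, extend_single]

/-- The action of the CMS operator on augmented monomial functions: each pair of entries is
squeezed, and so is each entry together with a new zero entry. -/
lemma lap_augL (N : ℕ) (k : ℂ) {n : ℕ} (a : Fin n → ℤ) :
    lap N k (augL N a) = (∑ i, (a i : ℂ) ^ 2) • augL N a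
      - (k / 2) • ∑ i, ∑ j, pairSum (augL N) a i j
      - k • ∑ i : Fin n, pairSum (augL N) (Fin.cons 0 a : Fin (n + 1) → ℤ) i.succ 0 := by
  classical
  have hsum : ∀ f : Fin n ↪ Fin N, lap N k (zPow (Function.extend f a 0)) =
      (∑ i, (a i : ℂ) ^ 2) • zPow (Function.extend f a 0)
      - (k / 2) • ∑ i, ∑ j, pairSum (fun v => zPow (Function.extend f v (0 : Fin N → ℤ))) a i j
      - k • ∑ i : Fin n, ∑ q : {q // q ∉ Set.range f},
          pairSum (fun v => zPow (Function.extend ((Equiv.embeddingFinSucc n (Fin N)).symm ⟨f, q⟩)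
            v (0 : Fin N → ℤ))) (Fin.cons 0 a : Fin (n + 1) → ℤ) i.succ 0 := by
    intro f
    set v := Function.extend f a (0 : Fin N → ℤ) with hv
    have hout : ∀ q : {q // q ∉ Set.range f}, v q = 0 := fun q =>
      Function.extend_apply' _ _ _ q.2
    have hnew : ∀ i (q : {q // q ∉ Set.range f}), pairTerm v (f i) q =
        pairSum (fun v => zPow (Function.extend ((Equiv.embeddingFinSucc n (Fin N)).symm ⟨f, q⟩)
            v (0 : Fin N → ℤ))) (Fin.cons 0 a : Fin (n + 1) → ℤ) i.succ 0 := by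
      intro i q
      rw [← pairTerm_extend, extend_cons]
      simp [hv]
    have hsq : ∑ p, (v p : ℂ) ^ 2 = ∑ i, (a i : ℂ) ^ 2 := by
      rw [sum_eq_sum_range_add f]
      simp only [hout]
      simp [hv, f.injective.extend_apply]
    have hpq : ∑ p, ∑ q, pairTerm v p q = ∑ i, ∑ j, pairTerm v (f i) (f j) +
        (2 : ℂ) • ∑ i, ∑ q : {q // q ∉ Set.range f}, pairTerm v (f i) q := by
      rw [sum_eq_sum_range_add f]
      simp only [sum_eq_sum_range_add f (fun q => pairTerm v _ q), Finset.sum_add_distrib]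
      have h1 : ∑ q : {q // q ∉ Set.range f}, ∑ q' : {q // q ∉ Set.range f},
          pairTerm v q q' = 0 :=
        Finset.sum_eq_zero fun q _ => Finset.sum_eq_zero fun q' _ => by simp [pairTerm, hout]
      rw [h1, Finset.sum_comm (f := fun (q : {q // q ∉ Set.range f}) i => pairTerm v q (f i))]
      simp only [pairTerm_comm v (Subtype.val _), two_smul]
      abel
    rw [lap_zPow, hsq, hpq, smul_add, smul_smul, div_mul_cancel₀ _ (two_ne_zero), ← sub_sub]
    simp only [hnew]
    simp only [hv, pairTerm_extend]
  have h1 : ∀ i j, pairSum (augL N) a i j = ∑ f : Fin n ↪ Fin N,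
      pairSum (fun v => zPow (Function.extend f v (0 : Fin N → ℤ))) a i j := fun i j =>
    pairSum_sum _ _ _ _ _
  have h2 : ∀ (b : Fin (n + 1) → ℤ) i j, pairSum (augL N) b i j =
      ∑ f : Fin n ↪ Fin N, ∑ q : {q // q ∉ Set.range f}, pairSum (fun v =>
        zPow (Function.extend ((Equiv.embeddingFinSucc n (Fin N)).symm ⟨f, q⟩) v 0)) b i j := by
    intro b i j
    simp only [← pairSum_sum]
    congr 1
    ext1 v
    exact augL_succ N v
  simp only [h1, h2]
  rw [augL, map_sum]
  simp only [hsum, Finset.sum_sub_distrib, Finset.smul_sum]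
  congr 1
  · congr 1
    rw [Finset.sum_comm]
    refine Finset.sum_congr rfl fun i _ => ?_
    rw [Finset.sum_comm]
  · rw [Finset.sum_comm]

/-- The value of the CMS operator on the augmented monomial function of `a`, as an element of
`Λ^±`. -/
def cmsAug (k : ℂ) {n : ℕ} (a : Fin n → ℤ) : LambdaPM :=
  (∑ i, (a i : ℂ) ^ 2) • aug n a - (k / 2) • ∑ i, ∑ j, pairSum (aug n) a i j
    - k • ∑ i : Fin n, pairSum (aug (n + 1)) (Fin.cons 0 a : Fin (n + 1) → ℤ) i.succ 0

lemma phi_cmsAug (N : ℕ) (k : ℂ) {n : ℕ} (a : Fin n → ℤ) :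
    phi N (cmsAug k a) = lap N k (phi N (aug n a)) := by
  have h : ∀ m (b : Fin m → ℤ) i j, phi N (pairSum (aug m) b i j) = pairSum (augL N) b i j := by
    intro m b i j
    have := map_pairSum (phi N).toLinearMap (aug m) b i j
    simp only [AlgHom.toLinearMap_apply] at this
    rw [this]
    congr 1
    ext1 v
    exact phi_aug N m v
  simp only [cmsAug, map_sub, map_smul, map_sum, h, phi_aug, lap_augL]

/-! ### Faithfulness of the specialisations to `N` variables -/

lemma exists_tuple {J : Type*} (t : J →₀ ℕ) :
    ∃ (n : ℕ) (b : Fin n → J), ∑ i, Finsupp.single (b i) 1 = t := by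
  classical
  induction t using Finsupp.induction_linear with
  | zero => exact ⟨0, Fin.elim0, by simp⟩
  | add f g hf hg =>
    obtain ⟨n, b, rfl⟩ := hf
    obtain ⟨m, c, rfl⟩ := hg
    exact ⟨n + m, Fin.append b c, by simp [Fin.sum_univ_add]⟩
  | single j m => exact ⟨m, fun _ => j, by simp⟩

lemma degree_sum_single {J : Type*} {n : ℕ} (b : Fin n → J) :
    (∑ i, Finsupp.single (b i) 1 : J →₀ ℕ).degree = n := by
  simp [map_sum]

lemma coeff_prod_powerSum {N n : ℕ} (b : Fin n → ℤ) (v : Fin N → ℤ) :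
    (∏ i, laurentPowerSum N (b i)).coeff v =
      ((Finset.univ.filter fun h : Fin n → Fin N => ∑ i, Pi.single (h i) (b i) = v).card : ℂ) := by
  classical
  simp only [laurentPowerSum]
  rw [Finset.prod_univ_sum]
  simp only [AddMonoidAlgebra.prod_single, AddMonoidAlgebra.coeff_sum, Finset.prod_const_one,
    AddMonoidAlgebra.coeff_single, Finsupp.coe_finsetSum, Finset.sum_apply, Finsupp.single_apply,
    Fintype.piFinset_univ, Finset.sum_boole]

/-- A product of at most `n` power sums contains a monomial in `n` distinct variables only if
its exponents are the degrees of the power sums. -/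
lemma sum_single_eq_of_powerSum {N n m : ℕ} (b : Fin n → {i : ℤ // i ≠ 0})
    (c : Fin m → {i : ℤ // i ≠ 0}) (e : Fin n ↪ Fin N) (hm : m ≤ n) (h : Fin m → Fin N)
    (hh : ∑ i, Pi.single (h i) (c i).1 = Function.extend e (fun i => (b i).1) (0 : Fin N → ℤ)) :
    (∑ i, Finsupp.single (c i) 1 : {i : ℤ // i ≠ 0} →₀ ℕ) = ∑ i, Finsupp.single (b i) 1 := by
  classical
  have hex : ∀ j, ∃ i, h i = e j := by
    intro j
    by_contra! hne
    have := congr_fun hh (e j)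
    rw [e.injective.extend_apply, Finset.sum_apply] at this
    refine (b j).2 (this.symm.trans (Finset.sum_eq_zero fun i _ => ?_))
    exact Pi.single_eq_of_ne (hne i).symm _
  choose τ hτ using hex
  have hτi : Function.Injective τ := fun i j hij => e.injective (by rw [← hτ i, ← hτ j, hij])
  have hmn : m = n := le_antisymm hm (by simpa using Fintype.card_le_of_injective τ hτi)
  subst hmn
  have hτb : Function.Bijective τ := Finite.injective_iff_bijective.mp hτi
  have hhi : Function.Injective h := by
    intro i j hij
    obtain ⟨i, rfl⟩ := hτb.2 i
    obtain ⟨j, rfl⟩ := hτb.2 j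
    rw [hτ, hτ] at hij
    rw [e.injective hij]
  have hcb : ∀ j, c (τ j) = b j := by
    intro j
    have := congr_fun hh (e j)
    rw [e.injective.extend_apply, Finset.sum_apply, Finset.sum_eq_single (τ j)] at this
    · rw [hτ] at this
      simpa [Subtype.ext_iff] using this
    · intro i _ hi
      exact Pi.single_eq_of_ne (fun h' => hi (hhi (by rw [← h', hτ]))) _
    · simp
  rw [← Equiv.sum_comp (Equiv.ofBijective τ hτb)]
  simp [hcb]

/-- In `N` variables there is no relation of degree at most `N` between the power sums. -/
lemma phiAt_eq_zero {N : ℕ} {g : LambdaAt} (hdeg : g.totalDegree ≤ N) (hg : phiAt N g = 0) :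
    g = 0 := by
  classical
  by_contra hne
  obtain ⟨t, ht, hmax⟩ := Finset.exists_max_image g.support Finsupp.degree
    (MvPolynomial.support_nonempty.mpr hne)
  obtain ⟨n, b, rfl⟩ := exists_tuple t
  have hn : n ≤ N := by
    refine le_trans ?_ hdeg
    have : Finsupp.degree _ ≤ _ := MvPolynomial.le_totalDegree ht
    rwa [degree_sum_single] at this
  let e : Fin n ↪ Fin N := Fin.castLEEmb hn
  let v : Fin N → ℤ := Function.extend e (fun i => (b i).1) 0
  have hmon : ∀ (m : ℕ) (c : Fin m → {i : ℤ // i ≠ 0}) (r : ℂ),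
      phiAt N (MvPolynomial.monomial (∑ i, Finsupp.single (c i) 1) r) =
        r • ∏ i, laurentPowerSum N (c i).1 := by
    intro m c r
    rw [MvPolynomial.monomial_sum_index, map_mul, map_prod]
    change phiAt N (algebraMap ℂ _ r) * ∏ i, phiAt N (MvPolynomial.X (c i)) = _
    rw [AlgHom.commutes, ← Algebra.smul_def]
    simp [phiAt]
  have hcoef : ((phiAt N g).coeff v) = g.coeff (∑ i, Finsupp.single (b i) 1) *
      (∏ i, laurentPowerSum N (b i).1).coeff v := by
    conv_lhs => rw [MvPolynomial.as_sum g, map_sum, AddMonoidAlgebra.coeff_sum,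
      Finsupp.coe_finsetSum, Finset.sum_apply]
    rw [Finset.sum_eq_single_of_mem _ ht]
    · rw [hmon]; simp
    · intro t' ht' hne'
      obtain ⟨m, c, rfl⟩ := exists_tuple t'
      have hmn := hmax _ ht'
      rw [degree_sum_single, degree_sum_single] at hmn
      rw [hmon, AddMonoidAlgebra.coeff_smul_apply, coeff_prod_powerSum, Finset.filter_eq_empty_iff.mpr]
      · simp
      · intro h _ hh
        exact hne' (sum_single_eq_of_powerSum b c e hmn h hh)
  rw [hg, coeff_prod_powerSum] at hcoef
  have h1 := MvPolynomial.mem_support_iff.mp ht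
  have h2 : (Finset.univ.filter fun h : Fin n → Fin N =>
      ∑ i, Pi.single (h i) (b i).1 = v).card ≠ 0 := by
    rw [Finset.card_ne_zero]
    refine ⟨e, by
      simp only [Finset.mem_filter, Finset.mem_univ, true_and, v]
      ext q
      rw [Finset.sum_apply]
      by_cases hq : ∃ i, e i = q
      · obtain ⟨i, rfl⟩ := hq
        rw [e.injective.extend_apply, Finset.sum_eq_single i]
        · simp
        · intro j _ hj
          exact Pi.single_eq_of_ne (fun h => hj (e.injective h.symm)) _
        · simp
      · rw [Function.extend_apply' _ _ _ hq]
        exact Finset.sum_eq_zero fun i _ => Pi.single_eq_of_ne (fun h => hq ⟨i, h.symm⟩) _⟩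
  exact mul_ne_zero h1 (Nat.cast_ne_zero.mpr h2) (by simpa using hcoef.symm)

lemma exists_totalDegree_specialize_le (f : LambdaPM) :
    ∃ D : ℕ, ∀ p0 : ℂ, (specialize p0 f).totalDegree ≤ D := by
  induction f using MvPolynomial.induction_on with
  | C c => exact ⟨0, fun p0 => by simp [specialize]⟩
  | add f g hf hg =>
    obtain ⟨D, hD⟩ := hf
    obtain ⟨D', hD'⟩ := hg
    refine ⟨max D D', fun p0 => ?_⟩
    rw [map_add]
    exact (MvPolynomial.totalDegree_add _ _).trans (max_le_max (hD p0) (hD' p0))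
  | mul_X f i hf =>
    obtain ⟨D, hD⟩ := hf
    refine ⟨D + 1, fun p0 => ?_⟩
    rw [map_mul]
    refine (MvPolynomial.totalDegree_mul _ _).trans (add_le_add (hD p0) ?_)
    simp only [specialize, MvPolynomial.aeval_X, powerSum]
    split_ifs <;> simp

lemma phiAt_powerSum (N : ℕ) (i : ℤ) : phiAt N (powerSum N i) = laurentPowerSum N i := by
  rw [powerSum]
  split_ifs with h
  · subst h
    simp [laurentPowerSum, ← AddMonoidAlgebra.one_def]
  · simp [phiAt]

lemma phiAt_specialize (N : ℕ) (f : LambdaPM) : phiAt N (specialize N f) = phi N f := by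
  have : (phiAt N).comp (specialize N) = phi N := by
    refine MvPolynomial.algHom_ext fun i => ?_
    simp [phi, specialize, phiAt_powerSum]
  exact congr($this f)

lemma eval_eq_eval_specialize (x : ℤ → ℂ) (f : LambdaPM) : MvPolynomial.eval x f =
    MvPolynomial.eval (fun i : {i : ℤ // i ≠ 0} => x i.1) (specialize (x 0) f) := by
  induction f using MvPolynomial.induction_on with
  | C c => simp [specialize]
  | add f g hf hg => simp [hf, hg]
  | mul_X f i hf =>
    rw [map_mul, map_mul, map_mul, hf]
    simp only [specialize, MvPolynomial.aeval_X, MvPolynomial.eval_X, powerSum]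
    split_ifs with h <;> simp [h]

/-- An element of `Λ^±` is determined by its images in large numbers of variables. -/
lemma phi_eventually_injective (N₀ : ℕ) {f : LambdaPM} (hf : ∀ N ≥ N₀, phi N f = 0) : f = 0 := by
  obtain ⟨D, hD⟩ := exists_totalDegree_specialize_le f
  have hs : ∀ N : ℕ, max N₀ D ≤ N → specialize N f = 0 := fun N hN =>
    phiAt_eq_zero ((hD N).trans ((le_max_right _ _).trans hN))
      (by rw [phiAt_specialize, hf N ((le_max_left _ _).trans hN)])
  refine MvPolynomial.funext_set
    (fun i => if i = 0 then (fun N : ℕ => (N : ℂ)) '' Set.Ici (max N₀ D) else Set.univ) ?_ ?_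
  · intro i
    split_ifs
    · exact (Set.Ici_infinite _).image Nat.cast_injective.injOn
    · exact Set.infinite_univ
  · intro x hx
    obtain ⟨N, hN, hx0⟩ : ∃ N : ℕ, max N₀ D ≤ N ∧ (N : ℂ) = x 0 := by
      simpa using hx 0 (Set.mem_univ _)
    rw [eval_eq_eval_specialize, ← hx0, hs N hN]
    simp

/-! ### The Laurent CMS operator on the specialised algebra -/

/-- `∂_a` as a derivation. -/
def delD (a : ℤ) : Derivation ℂ LambdaAt LambdaAt :=
  if h : a = 0 then 0 else (a : ℂ) • MvPolynomial.pderiv ⟨a, h⟩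

lemma del_eq_delD (a : ℤ) (f : LambdaAt) : del a f = delD a f := by
  rw [del, delD]
  split_ifs <;> simp

lemma X_eq_powerSum (p0 : ℂ) (i : {i : ℤ // i ≠ 0}) :
    (MvPolynomial.X i : LambdaAt) = powerSum p0 i := by
  simp [powerSum, i.2]

lemma delD_powerSum (p0 : ℂ) (a b : ℤ) :
    delD a (powerSum p0 b) = if a = b then MvPolynomial.C (b : ℂ) else 0 := by
  rw [delD, powerSum]
  split_ifs with h1 h2 h3 h4 h5 <;> simp_all [MvPolynomial.pderiv_X]
  rw [MvPolynomial.smul_eq_C_mul, mul_one, map_intCast]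

lemma derivation_sum_apply {ι : Type*} (s : Finset ι) (D : ι → Derivation ℂ LambdaAt LambdaAt)
    (f : LambdaAt) : (∑ i ∈ s, D i) f = ∑ i ∈ s, D i f := by
  classical
  induction s using Finset.induction_on with
  | empty => simp
  | insert i s hi ih => rw [Finset.sum_insert hi, Finset.sum_insert hi, Derivation.add_apply, ih]

lemma delD_comm (a b : ℤ) (f : LambdaAt) : delD a (delD b f) = delD b (delD a f) := by
  have : ⁅delD a, delD b⁆ = 0 := by
    refine MvPolynomial.derivation_ext fun i => ?_
    rw [Derivation.commutator_apply, X_eq_powerSum 0, delD_powerSum, delD_powerSum]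
    split_ifs <;> simp [← MvPolynomial.algebraMap_eq]
  rw [← sub_eq_zero, ← Derivation.commutator_apply, this, Derivation.zero_apply]

/-- The subalgebra generated by the `p_i` with `|i| ≤ n`. -/
def bounded (n : ℕ) : Subalgebra ℂ LambdaAt :=
  MvPolynomial.supported ℂ {i : {i : ℤ // i ≠ 0} | i.1.natAbs ≤ n}

lemma exists_mem_bounded (f : LambdaAt) : ∃ n₀, ∀ n ≥ n₀, f ∈ bounded n := by
  refine ⟨f.vars.sup fun i => i.1.natAbs, fun n hn => ?_⟩
  rw [bounded, MvPolynomial.mem_supported]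
  intro i hi
  exact (Finset.le_sup (f := fun i : {i : ℤ // i ≠ 0} => i.1.natAbs) hi).trans hn

lemma derivation_eq_of_bounded {D₁ D₂ : Derivation ℂ LambdaAt LambdaAt} {n : ℕ}
    (h : ∀ i : {i : ℤ // i ≠ 0}, i.1.natAbs ≤ n →
      D₁ (MvPolynomial.X i) = D₂ (MvPolynomial.X i))
    {f : LambdaAt} (hf : f ∈ bounded n) : D₁ f = D₂ f := by
  refine Derivation.eqOn_adjoin (s := MvPolynomial.X '' {i : {i : ℤ // i ≠ 0} | i.1.natAbs ≤ n})
    ?_ hf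
  rintro _ ⟨i, hi, rfl⟩
  exact h i hi

lemma delD_eq_zero {n : ℕ} {a : ℤ} (ha : n < a.natAbs) {f : LambdaAt} (hf : f ∈ bounded n) :
    delD a f = 0 := by
  rw [← Derivation.zero_apply (R := ℂ) (A := LambdaAt) (M := LambdaAt) f]
  refine derivation_eq_of_bounded (fun i hi => ?_) hf
  rw [X_eq_powerSum 0, delD_powerSum, if_neg (by rintro rfl; omega), Derivation.zero_apply]

/-- The integers of absolute value at most `n`. -/
def box (n : ℕ) : Finset ℤ := Finset.Icc (-n) n

lemma mem_box {n : ℕ} {a : ℤ} : a ∈ box n ↔ a.natAbs ≤ n := by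
  simp only [box, Finset.mem_Icc]
  omega

/-- The first order part of the Laurent CMS operator on the subalgebra `bounded n`. -/
def cmsDer (k p0 : ℂ) (n : ℕ) : Derivation ℂ LambdaAt LambdaAt :=
  (1 + k) • (∑ a ∈ box n, (a : ℂ) • powerSum p0 a • delD a)
  - k • ((∑ ab ∈ (box n ×ˢ box n) with 0 < ab.1 ∧ 0 < ab.2,
            (powerSum p0 ab.1 * powerSum p0 ab.2) • delD (ab.1 + ab.2))
        - ∑ ab ∈ (box n ×ˢ box n) with ab.1 < 0 ∧ ab.2 < 0,
            (powerSum p0 ab.1 * powerSum p0 ab.2) • delD (ab.1 + ab.2))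
  - (k * p0) • ((∑ a ∈ box n with 0 < a, powerSum p0 a • delD a)
        - ∑ a ∈ box n with a < 0, powerSum p0 a • delD a)

/-- The second order part of the Laurent CMS operator on the subalgebra `bounded n`. -/
def cmsSecond (p0 : ℂ) (n : ℕ) (f : LambdaAt) : LambdaAt :=
  ∑ a ∈ box n, ∑ b ∈ box n, powerSum p0 (a + b) * delD a (delD b f)

lemma cmsInfinite_eq (k p0 : ℂ) {n : ℕ} {f : LambdaAt} (hf : f ∈ bounded n) :
    cmsInfinite k p0 f = cmsSecond p0 n f + cmsDer k p0 n f := by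
  have h0 : ∀ a, a ∉ box n → delD a f = 0 := fun a ha =>
    delD_eq_zero (by rw [mem_box] at ha; omega) hf
  have h1 : ∑ᶠ ab : ℤ × ℤ, powerSum p0 (ab.1 + ab.2) * delD ab.1 (delD ab.2 f) =
      cmsSecond p0 n f := by
    rw [cmsSecond, ← Finset.sum_product' (f := fun a b => powerSum p0 (a + b) *
      delD a (delD b f)), finsum_eq_sum_of_support_subset]
    intro ab hab
    by_contra hn
    simp only [Finset.coe_product, Set.mem_prod, Finset.mem_coe, not_and_or] at hn
    refine hab ?_
    rcases hn with hn | hn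
    · simp only [delD_comm ab.1, h0 _ hn, map_zero, mul_zero]
    · simp only [h0 _ hn, map_zero, mul_zero]
  have h2 : ∀ P : ℤ × ℤ → Prop, ∀ [DecidablePred P],
      (∀ ab, P ab → ab ∉ box n ×ˢ box n → ab.1 + ab.2 ∉ box n) →
      ∑ᶠ (ab : ℤ × ℤ) (_ : P ab), powerSum p0 ab.1 * powerSum p0 ab.2 * delD (ab.1 + ab.2) f =
      ∑ ab ∈ (box n ×ˢ box n) with P ab,
        powerSum p0 ab.1 * powerSum p0 ab.2 * delD (ab.1 + ab.2) f := by
    intro P _ hP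
    simp only [finsum_eq_if]
    rw [Finset.sum_filter, finsum_eq_sum_of_support_subset]
    intro ab hab
    by_contra hn
    rw [Finset.mem_coe] at hn
    refine hab ?_
    simp only
    split_ifs with h
    · rw [h0 _ (hP ab h hn), mul_zero]
    · rfl
  have h3 : ∀ P : ℤ → Prop, ∀ [DecidablePred P],
      ∑ᶠ (a : ℤ) (_ : P a), powerSum p0 a * delD a f =
      ∑ a ∈ box n with P a, powerSum p0 a * delD a f := by
    intro P _
    simp only [finsum_eq_if]
    rw [Finset.sum_filter, finsum_eq_sum_of_support_subset]
    intro a ha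
    by_contra hn
    rw [Finset.mem_coe] at hn
    refine ha ?_
    simp [h0 _ hn]
  have h4 : ∑ᶠ a : ℤ, (a : ℂ) • (powerSum p0 a * delD a f) =
      ∑ a ∈ box n, (a : ℂ) • (powerSum p0 a * delD a f) := by
    rw [finsum_eq_sum_of_support_subset]
    intro a ha
    by_contra hn
    rw [Finset.mem_coe] at hn
    refine ha ?_
    simp [h0 _ hn]
  simp only [cmsInfinite, del_eq_delD]
  rw [h1, h2, h2, h3, h3, h4]
  · simp only [cmsDer, Derivation.sub_apply, Derivation.smul_apply, derivation_sum_apply,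
      smul_eq_mul]
    abel
  · simp only [Finset.mem_product, mem_box, Prod.forall]; intros; omega
  · simp only [Finset.mem_product, mem_box, Prod.forall]; intros; omega

lemma cmsInfinite_add (k p0 : ℂ) (f g : LambdaAt) :
    cmsInfinite k p0 (f + g) = cmsInfinite k p0 f + cmsInfinite k p0 g := by
  obtain ⟨n, hn⟩ := exists_mem_bounded f
  obtain ⟨m, hm⟩ := exists_mem_bounded g
  have hf := hn (max n m) (le_max_left _ _)
  have hg := hm (max n m) (le_max_right _ _)
  rw [cmsInfinite_eq k p0 hf, cmsInfinite_eq k p0 hg, cmsInfinite_eq k p0 (add_mem hf hg)]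
  simp only [cmsSecond, map_add, mul_add, Finset.sum_add_distrib]
  abel

lemma cmsInfinite_smul (k p0 c : ℂ) (f : LambdaAt) :
    cmsInfinite k p0 (c • f) = c • cmsInfinite k p0 f := by
  obtain ⟨n, hn⟩ := exists_mem_bounded f
  have hf := hn n le_rfl
  rw [cmsInfinite_eq k p0 hf, cmsInfinite_eq k p0 (Subalgebra.smul_mem _ hf c)]
  simp only [cmsSecond, Derivation.map_smul, mul_smul_comm, Finset.smul_sum, smul_add]

/-- The Laurent CMS operator as a linear map. -/
def cmsLin (k p0 : ℂ) : LambdaAt →ₗ[ℂ] LambdaAt where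
  toFun := cmsInfinite k p0
  map_add' := cmsInfinite_add k p0
  map_smul' := cmsInfinite_smul k p0

lemma cmsInfinite_C (k p0 c : ℂ) : cmsInfinite k p0 (MvPolynomial.C c) = 0 := by
  have hf : MvPolynomial.C c ∈ bounded 0 := (bounded 0).algebraMap_mem c
  rw [cmsInfinite_eq k p0 hf]
  simp [cmsSecond, ← MvPolynomial.algebraMap_eq]

/-- The derivation `p_c ↦ b c p_{b+c}`: the polarisation of the second order part of the CMS
operator at `p_b`, on the specialised algebra. -/
def gammaAt (p0 : ℂ) (b : ℤ) : Derivation ℂ LambdaAt LambdaAt :=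
  MvPolynomial.mkDerivation ℂ fun c => (b * c.1 : ℂ) • powerSum p0 (b + c.1)

/-- The derivation `p_c ↦ b c p_{b+c}` of `Λ^±`. -/
def gammaPM (b : ℤ) : Derivation ℂ LambdaPM LambdaPM :=
  MvPolynomial.mkDerivation ℂ fun c => (b * c : ℂ) • MvPolynomial.X (b + c)

/-- The value of the Laurent CMS operator on `p_b`, with the generator `p_0` in place of the
number. -/
def cmsX (k : ℂ) (b : ℤ) : LambdaPM :=
  ((1 + k) * (b : ℂ) ^ 2) • MvPolynomial.X b
  - (k * b) • (∑ a ∈ Finset.Ioo 0 b, MvPolynomial.X a * MvPolynomial.X (b - a)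
      - ∑ a ∈ Finset.Ioo b 0, MvPolynomial.X a * MvPolynomial.X (b - a))
  - (k * b.natAbs) • (MvPolynomial.X 0 * MvPolynomial.X b)

lemma powerSum_mem_bounded (p0 : ℂ) {b : ℤ} {n : ℕ} (hb : b.natAbs ≤ n) :
    powerSum p0 b ∈ bounded n := by
  rw [powerSum]
  split_ifs with h
  · exact (bounded n).algebraMap_mem p0
  · exact MvPolynomial.X_mem_supported.mpr hb

lemma cmsSecond_powerSum (p0 : ℂ) (n : ℕ) (b : ℤ) : cmsSecond p0 n (powerSum p0 b) = 0 := by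
  refine Finset.sum_eq_zero fun a _ => Finset.sum_eq_zero fun c _ => ?_
  rw [delD_powerSum]
  split_ifs <;> simp [← MvPolynomial.algebraMap_eq]

lemma cmsInfinite_powerSum (k p0 : ℂ) (b : ℤ) :
    cmsInfinite k p0 (powerSum p0 b) = specialize p0 (cmsX k b) := by
  rw [cmsInfinite_eq k p0 (powerSum_mem_bounded p0 le_rfl), cmsSecond_powerSum, zero_add]
  have hb : b ∈ box b.natAbs := mem_box.mpr le_rfl
  have hpair : ∀ (P : ℤ × ℤ → Prop) [DecidablePred P] (S : Finset ℤ),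
      (∀ a, a ∈ S ↔ P (a, b - a)) → (∀ a ∈ S, a.natAbs ≤ b.natAbs ∧ (b - a).natAbs ≤ b.natAbs) →
      ∑ ab ∈ box b.natAbs ×ˢ box b.natAbs with P ab,
        powerSum p0 ab.1 * powerSum p0 ab.2 * delD (ab.1 + ab.2) (powerSum p0 b) =
      (b : ℂ) • ∑ a ∈ S, powerSum p0 a * powerSum p0 (b - a) := by
    intro P _ S hS hbox
    rw [Finset.smul_sum]
    symm
    refine Finset.sum_of_injOn (fun a => (a, b - a)) ?_ ?_ ?_ ?_
    · intro a _ c _ h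
      simpa using congr_arg Prod.fst h
    · intro a ha
      rw [Finset.mem_coe] at ha ⊢
      rw [Finset.mem_filter, Finset.mem_product, mem_box, mem_box]
      exact ⟨hbox a ha, (hS a).mp ha⟩
    · rintro ⟨a, c⟩ hac hn
      rw [delD_powerSum, if_neg, mul_zero]
      rintro rfl
      refine hn ⟨a, ?_, by simp⟩
      rw [Finset.mem_coe, hS]
      simpa using (Finset.mem_filter.mp hac).2
    · intro a _
      rw [delD_powerSum, if_pos (by simp), MvPolynomial.smul_eq_C_mul]
      ring
  have hp := hpair (fun ab => 0 < ab.1 ∧ 0 < ab.2) (Finset.Ioo 0 b)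
    (fun a => by rw [Finset.mem_Ioo]; omega) (fun a ha => by rw [Finset.mem_Ioo] at ha; omega)
  have hm := hpair (fun ab => ab.1 < 0 ∧ ab.2 < 0) (Finset.Ioo b 0)
    (fun a => by rw [Finset.mem_Ioo]; omega) (fun a ha => by rw [Finset.mem_Ioo] at ha; omega)
  have hone : ∀ (P : ℤ → Prop) [DecidablePred P],
      ∑ a ∈ box b.natAbs with P a, powerSum p0 a * delD a (powerSum p0 b) =
      (if P b then (b : ℂ) else 0) • powerSum p0 b := by
    intro P _
    simp only [delD_powerSum, mul_ite, mul_zero, Finset.sum_ite_eq', Finset.mem_filter, hb,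
      true_and, MvPolynomial.smul_eq_C_mul]
    split_ifs <;> simp [mul_comm]
  have hs : ∑ a ∈ box b.natAbs, (a : ℂ) • (powerSum p0 a * delD a (powerSum p0 b)) =
      ((b : ℂ) ^ 2) • powerSum p0 b := by
    simp only [delD_powerSum, mul_ite, mul_zero, smul_ite, smul_zero, Finset.sum_ite_eq', hb,
      if_true, MvPolynomial.smul_eq_C_mul, map_pow]
    ring
  simp only [cmsDer, Derivation.sub_apply, Derivation.smul_apply, derivation_sum_apply,
      smul_eq_mul, hp, hm, hone, hs]
  have hX : ∀ a, specialize p0 (MvPolynomial.X a) = powerSum p0 a := by simp [specialize]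
  have h0 : powerSum p0 0 = MvPolynomial.C p0 := by simp [powerSum]
  have hn : (k * p0) • ((if 0 < b then (b : ℂ) else 0) • powerSum p0 b -
      (if b < 0 then (b : ℂ) else 0) • powerSum p0 b) =
      (k * b.natAbs) • (MvPolynomial.C p0 * powerSum p0 b) := by
    rw [← MvPolynomial.smul_eq_C_mul, ← sub_smul, smul_smul, smul_smul, Nat.cast_natAbs]
    congr 1
    rcases lt_trichotomy b 0 with h | rfl | h
    · rw [if_neg (by omega), if_pos h, abs_of_neg h]; push_cast; ring
    · simp
    · rw [if_pos h, if_neg (by omega), abs_of_pos h]; ring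
  rw [hn]
  simp only [cmsX, map_sub, map_smul, map_sum, map_mul, hX, h0, ← smul_sub, smul_smul]

lemma cmsInfinite_powerSum_mul (k p0 : ℂ) (b : ℤ) (f : LambdaAt) :
    cmsInfinite k p0 (powerSum p0 b * f) = cmsInfinite k p0 (powerSum p0 b) * f +
      powerSum p0 b * cmsInfinite k p0 f + 2 * gammaAt p0 b f := by
  obtain ⟨m, hm⟩ := exists_mem_bounded f
  have hf := hm (max m b.natAbs) (le_max_left _ _)
  have hb : powerSum p0 b ∈ bounded (max m b.natAbs) :=
    powerSum_mem_bounded p0 (le_max_right _ _)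
  have hbox : b ∈ box (max m b.natAbs) := mem_box.mpr (le_max_right _ _)
  set n := max m b.natAbs
  have hgamma : gammaAt p0 b f = ∑ a ∈ box n, powerSum p0 (a + b) * (delD a f * MvPolynomial.C (b : ℂ)) := by
    have : gammaAt p0 b f =
        (∑ a ∈ box n, ((b : ℂ) • powerSum p0 (a + b)) • delD a) f := by
      refine derivation_eq_of_bounded (n := n) (fun i hi => ?_) hf
      rw [derivation_sum_apply, gammaAt, MvPolynomial.mkDerivation_X]
      simp only [Derivation.smul_apply, X_eq_powerSum p0, delD_powerSum, smul_eq_mul, mul_ite,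
        mul_zero, Finset.sum_ite_eq', mem_box.mpr hi, if_true]
      simp only [MvPolynomial.smul_eq_C_mul, map_mul, add_comm b]
      ring
    rw [this]
    simp only [derivation_sum_apply, Derivation.smul_apply, smul_eq_mul]
    refine Finset.sum_congr rfl fun a _ => ?_
    rw [MvPolynomial.smul_eq_C_mul]
    ring
  have hsec : cmsSecond p0 n (powerSum p0 b * f) = powerSum p0 b * cmsSecond p0 n f +
      2 * gammaAt p0 b f := by
    have hterm : ∀ a c, powerSum p0 (a + c) * delD a (delD c (powerSum p0 b * f)) =
        powerSum p0 b * (powerSum p0 (a + c) * delD a (delD c f)) +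
        (if a = b then powerSum p0 (a + c) * (delD c f * MvPolynomial.C (b : ℂ)) else 0) +
        (if c = b then powerSum p0 (a + c) * (delD a f * MvPolynomial.C (b : ℂ)) else 0) := by
      intro a c
      have hC : delD a (MvPolynomial.C (b : ℂ)) = 0 := (delD a).map_algebraMap _
      rw [Derivation.leibniz, map_add, smul_eq_mul, smul_eq_mul, Derivation.leibniz,
        Derivation.leibniz, delD_powerSum, delD_powerSum]
      simp only [smul_eq_mul]
      split_ifs <;> simp only [hC, map_zero] <;> ring
    simp only [cmsSecond, hterm, Finset.sum_add_distrib, Finset.sum_ite_eq', hbox, if_true,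
      Finset.mul_sum]
    rw [Finset.sum_comm (f := fun a c => if a = b then _ else _)]
    simp only [Finset.sum_ite_eq', hbox, if_true]
    rw [hgamma, two_mul, add_assoc]
    simp only [add_comm b]
  rw [cmsInfinite_eq k p0 hf, cmsInfinite_eq k p0 hb, cmsInfinite_eq k p0 (mul_mem hb hf), hsec,
    Derivation.leibniz, cmsSecond_powerSum, smul_eq_mul, smul_eq_mul]
  ring

/-! ### Comparison of the two CMS operators -/

lemma specialize_X (p0 : ℂ) (a : ℤ) : specialize p0 (MvPolynomial.X a) = powerSum p0 a := by
  simp [specialize]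

lemma phi_X (N : ℕ) (a : ℤ) : phi N (MvPolynomial.X a) = laurentPowerSum N a := by
  simp [phi]

lemma specialize_gammaPM (p0 : ℂ) (b : ℤ) (f : LambdaPM) :
    specialize p0 (gammaPM b f) = gammaAt p0 b (specialize p0 f) := by
  induction f using MvPolynomial.induction_on with
  | C c => simp [← MvPolynomial.algebraMap_eq]
  | add f g hf hg => simp [hf, hg]
  | mul_X f i hf =>
    have h : specialize p0 (gammaPM b (MvPolynomial.X i)) = gammaAt p0 b (powerSum p0 i) := by
      rw [gammaPM, MvPolynomial.mkDerivation_X, map_smul, specialize_X, powerSum]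
      by_cases hi : i = 0
      · subst hi
        simp [powerSum, ← MvPolynomial.algebraMap_eq]
      · simp only [hi, powerSum, dif_neg, not_false_eq_true, gammaAt, MvPolynomial.mkDerivation_X]
    rw [Derivation.leibniz, map_add, map_mul, Derivation.leibniz, specialize_X, smul_eq_mul,
      smul_eq_mul, map_mul, map_mul, h, hf, specialize_X, smul_eq_mul, smul_eq_mul]

lemma theta_powerSum {N : ℕ} (i : Fin N) (b : ℤ) :
    theta i (laurentPowerSum N b) = (b : ℂ) • zPow (Pi.single i b) := by
  rw [laurentPowerSum, map_sum, Finset.sum_eq_single i]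
  · simp
  · intro j _ hj
    rw [theta_zPow]
    simp [hj.symm]
  · simp

lemma theta_one {N : ℕ} (i : Fin N) : theta i (1 : Laurent N) = 0 := by
  rw [AddMonoidAlgebra.one_def, theta_zPow]
  simp

lemma phi_gammaPM (N : ℕ) (b : ℤ) (f : LambdaPM) :
    phi N (gammaPM b f) = ∑ i, theta i (laurentPowerSum N b) * theta i (phi N f) := by
  induction f using MvPolynomial.induction_on with
  | C c =>
    have : phi N (MvPolynomial.C c) = c • (1 : Laurent N) := by
      rw [← MvPolynomial.algebraMap_eq, AlgHom.commutes, Algebra.algebraMap_eq_smul_one]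
    rw [this]
    simp [← MvPolynomial.algebraMap_eq, theta_one]
  | add f g hf hg => simp only [map_add, hf, hg, mul_add, Finset.sum_add_distrib]
  | mul_X f i hf =>
    have h : phi N (gammaPM b (MvPolynomial.X i)) =
        ∑ j, theta j (laurentPowerSum N b) * theta j (laurentPowerSum N i) := by
      rw [gammaPM, MvPolynomial.mkDerivation_X, map_smul, phi_X, laurentPowerSum, Finset.smul_sum]
      refine Finset.sum_congr rfl fun j _ => ?_
      rw [theta_powerSum, theta_powerSum, smul_mul_smul_comm, zPow_mul, ← Pi.single_add]
    rw [Derivation.leibniz, map_add, map_mul, phi_X, smul_eq_mul, smul_eq_mul, map_mul, map_mul,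
      h, hf, phi_X, Finset.mul_sum, Finset.mul_sum, ← Finset.sum_add_distrib]
    refine Finset.sum_congr rfl fun j _ => ?_
    rw [theta_mul]
    ring

/-- The first squeeze of the entry `b` with a zero entry produces the factor `p_0 - 1`, the
others are the products `p_a p_{b-a}`. -/
lemma cmsAug_singleton (k : ℂ) (b : ℤ) : cmsAug k (fun _ : Fin 1 => b) = cmsX k b := by
  have h1 : ∀ c : ℤ, aug 1 (fun _ => c) = MvPolynomial.X c := by
    intro c
    simp [aug]
  have h1' : ∀ v : Fin 1 → ℤ, aug 1 v = MvPolynomial.X (v 0) := by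
    intro c
    simp [aug]
  have h2 : ∀ v : Fin 2 → ℤ, aug 2 v =
      MvPolynomial.X (v 0) * MvPolynomial.X (v 1) - MvPolynomial.X (v 0 + v 1) := by
    intro v
    rw [aug]
    simp [h1', Fin.tail, add_comm]
  have hs : ∀ l, aug 2 (squeeze (Fin.cons 0 (fun _ : Fin 1 => b) : Fin 2 → ℤ) (Fin.succ 0) 0 l) =
      MvPolynomial.X (b.sign * l) * MvPolynomial.X (b - b.sign * l) - MvPolynomial.X b := by
    intro l
    rw [h2]
    simp [squeeze]
  have hp : pairSum (aug 2) (Fin.cons 0 (fun _ : Fin 1 => b) : Fin 2 → ℤ) (Fin.succ 0) 0 =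
      (b.natAbs : ℂ) • ((MvPolynomial.X 0 * MvPolynomial.X b
        + ∑ l ∈ Finset.Ico 1 b.natAbs, MvPolynomial.X (b.sign * l) * MvPolynomial.X (b - b.sign * l))
        - (b.natAbs : ℂ) • MvPolynomial.X b) := by
    simp only [pairSum, hs]
    simp only [Fin.cons_succ, Fin.cons_zero, sub_zero]
    rcases Nat.eq_zero_or_pos b.natAbs with h0 | hpos
    · simp [h0]
    rw [Finset.sum_sub_distrib, Finset.range_eq_Ico, Finset.sum_eq_sum_Ico_succ_bot hpos]
    simp [MvPolynomial.smul_eq_C_mul]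
  have hI : (b.natAbs : ℂ) • ∑ l ∈ Finset.Ico 1 b.natAbs,
      (MvPolynomial.X (b.sign * l) * MvPolynomial.X (b - b.sign * l) : LambdaPM) =
      (b : ℂ) • (∑ a ∈ Finset.Ioo 0 b, MvPolynomial.X a * MvPolynomial.X (b - a)
      - ∑ a ∈ Finset.Ioo b 0, MvPolynomial.X a * MvPolynomial.X (b - a)) := by
    rcases lt_trichotomy b 0 with h | rfl | h
    · rw [Finset.Ioo_eq_empty (by omega : ¬ 0 < b), Finset.sum_empty, zero_sub, smul_neg,
        ← neg_smul, Int.sign_eq_neg_one_of_neg h, Nat.cast_natAbs, abs_of_neg h, Int.cast_neg]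
      congr 1
      refine Finset.sum_bij' (fun l _ => -(l : ℤ)) (fun a _ => a.natAbs) ?_ ?_ ?_ ?_ ?_ <;>
        simp only [Finset.mem_Ico, Finset.mem_Ioo] <;> intros <;> try omega
      simp
    · simp
    · rw [Finset.Ioo_eq_empty (by omega : ¬ b < 0), Finset.sum_empty, sub_zero,
        Int.sign_eq_one_of_pos h, Nat.cast_natAbs, abs_of_pos h]
      congr 1
      refine Finset.sum_bij' (fun l _ => (l : ℤ)) (fun a _ => a.natAbs) ?_ ?_ ?_ ?_ ?_ <;>
        simp only [Finset.mem_Ico, Finset.mem_Ioo] <;> intros <;> try omega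
      simp
  have hsq : ((b.natAbs : ℂ)) * b.natAbs = (b : ℂ) ^ 2 := by
    rw [← pow_two, ← Int.cast_natCast, ← Int.cast_pow, Int.natAbs_sq, Int.cast_pow]
  simp only [cmsAug, Finset.univ_unique, Finset.sum_singleton, hp, h1, cmsX,
    Fin.default_eq_zero]
  rw [smul_sub, smul_add, smul_smul, hI, hsq]
  simp only [pairSum, sub_self]
  simp only [Int.natAbs_zero, Nat.cast_zero, zero_smul, smul_zero, sub_zero, smul_add, smul_sub,
    smul_smul, add_mul, one_mul, add_smul]
  abel

lemma phi_cmsX (N : ℕ) (k : ℂ) (b : ℤ) :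
    phi N (cmsX k b) = lap N k (laurentPowerSum N b) := by
  rw [← cmsAug_singleton, phi_cmsAug]
  simp [aug, phi_X]

/-- Every element of `Λ^±` has an image under "the CMS operator with indeterminate `p_0`", which
specialises to the Laurent CMS operators for all values of `p_0` and to the CMS operators in all
finite numbers of variables. -/
lemma exists_universal_cms (k : ℂ) (f : LambdaPM) : ∃ g : LambdaPM,
    (∀ p0, specialize p0 g = cmsInfinite k p0 (specialize p0 f)) ∧
      ∀ N, phi N g = lap N k (phi N f) := by
  induction f using MvPolynomial.induction_on with
  | C c =>
    refine ⟨0, fun p0 => ?_, fun N => ?_⟩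
    · have : specialize p0 (MvPolynomial.C c) = MvPolynomial.C c := by simp [specialize]
      rw [this, cmsInfinite_C, map_zero]
    · have : phi N (MvPolynomial.C c) = c • (zPow 0 : Laurent N) := by
        rw [← MvPolynomial.algebraMap_eq, AlgHom.commutes, Algebra.algebraMap_eq_smul_one]
        rfl
      rw [this, map_smul, lap_zPow]
      simp [pairTerm]
  | add f g hf hg =>
    obtain ⟨f', hf1, hf2⟩ := hf
    obtain ⟨g', hg1, hg2⟩ := hg
    refine ⟨f' + g', fun p0 => ?_, fun N => ?_⟩
    · rw [map_add, map_add, cmsInfinite_add, hf1, hg1]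
    · rw [map_add, map_add, map_add, hf2, hg2]
  | mul_X f b hf =>
    obtain ⟨f', hf1, hf2⟩ := hf
    refine ⟨cmsX k b * f + MvPolynomial.X b * f' + 2 * gammaPM b f, fun p0 => ?_, fun N => ?_⟩
    · rw [mul_comm f, map_mul, specialize_X, cmsInfinite_powerSum_mul, cmsInfinite_powerSum, ← hf1,
        ← specialize_gammaPM]
      simp only [map_add, map_mul, specialize_X, map_ofNat]
    · rw [mul_comm f, map_mul, phi_X, lap_mul k (isSymm_powerSum b) (isSymm_phi f), ← phi_cmsX,
        ← hf2, ← phi_gammaPM]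
      simp only [map_add, map_mul, phi_X, map_ofNat]

lemma cmsInfinite_specialize (k p0 : ℂ) {f g : LambdaPM} (h : ∀ N, phi N g = lap N k (phi N f)) :
    cmsInfinite k p0 (specialize p0 f) = specialize p0 g := by
  obtain ⟨g', hg1, hg2⟩ := exists_universal_cms k f
  have : g - g' = 0 := phi_eventually_injective 0 fun N _ => by rw [map_sub, h, hg2, sub_self]
  rw [← hg1, sub_eq_zero.mp this]

lemma cmsInfinite_aug (k p0 : ℂ) {n : ℕ} (a : Fin n → ℤ) :
    cmsInfinite k p0 (specialize p0 (aug n a)) = specialize p0 (cmsAug k a) :=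
  cmsInfinite_specialize k p0 fun N => phi_cmsAug N k a

lemma specialize_surjective (p0 : ℂ) : Function.Surjective (specialize p0) := by
  intro f
  refine ⟨MvPolynomial.rename Subtype.val f, ?_⟩
  rw [specialize, MvPolynomial.aeval_rename]
  have : (powerSum p0 ∘ Subtype.val : {i : ℤ // i ≠ 0} → LambdaAt) = MvPolynomial.X := by
    ext1 i
    exact (X_eq_powerSum p0 i).symm
  rw [this, MvPolynomial.aeval_X_left_apply]

/-- For `p_0 = N` the Laurent CMS operator is compatible with `φ_N`. -/
lemma phiAt_cmsInfinite (k : ℂ) (N : ℕ) (f : LambdaAt) :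
    phiAt N (cmsInfinite k N f) = lap N k (phiAt N f) := by
  obtain ⟨f, rfl⟩ := specialize_surjective N f
  obtain ⟨g, hg1, hg2⟩ := exists_universal_cms k f
  rw [← hg1, phiAt_specialize, phiAt_specialize, hg2]

/-- The involution `p_i ↦ p_{-i}` of `Λ^±`. -/
def starPM : LambdaPM →ₐ[ℂ] LambdaPM := MvPolynomial.rename Neg.neg

lemma phi_starPM (N : ℕ) (f : LambdaPM) : phi N (starPM f) = invAct N (phi N f) := by
  have : (phi N).comp starPM = (invAct N).comp (phi N) := by
    refine MvPolynomial.algHom_ext fun i => ?_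
    simp [starPM, phi, laurentPowerSum, ← Pi.single_neg]
  exact congr($this f)

lemma specialize_starPM (p0 : ℂ) (f : LambdaPM) :
    specialize p0 (starPM f) = star (specialize p0 f) := by
  have : (specialize p0).comp starPM = star.comp (specialize p0) := by
    refine MvPolynomial.algHom_ext fun i => ?_
    simp only [AlgHom.comp_apply, starPM, MvPolynomial.rename_X, specialize_X, powerSum, star]
    by_cases h : i = 0 <;> simp [h]
  exact congr($this f)

lemma cmsInfinite_star (k p0 : ℂ) (f : LambdaAt) :
    cmsInfinite k p0 (star f) = star (cmsInfinite k p0 f) := by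
  obtain ⟨f, rfl⟩ := specialize_surjective p0 f
  obtain ⟨g, hg1, hg2⟩ := exists_universal_cms k f
  rw [← hg1, ← specialize_starPM, ← specialize_starPM]
  refine cmsInfinite_specialize k p0 fun N => ?_
  rw [phi_starPM, phi_starPM, hg2, lap_invAct]

/-! ### The monomial functions `m_{λ,μ}` -/

lemma exists_perm_comp_eq {ι κ : Type*} [Fintype κ] (e f : ι ↪ κ) :
    ∃ τ : Equiv.Perm κ, ∀ i, τ (e i) = f i := by
  classical
  let E : {x // x ∈ Set.range e} ≃ {x // x ∈ Set.range f} :=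
    (Equiv.ofInjective e e.injective).symm.trans (Equiv.ofInjective f f.injective)
  refine ⟨E.extendSubtype, fun i => ?_⟩
  rw [Equiv.extendSubtype_apply_of_mem E (e i) ⟨i, rfl⟩]
  simp [E]

lemma extend_trans_perm {ι κ : Type*} (e : ι ↪ κ) (τ : Equiv.Perm κ) (a : ι → ℤ) :
    Function.extend (fun i => τ (e i)) a 0 = Function.extend e a 0 ∘ τ.symm := by
  ext q
  have hi : Function.Injective fun i => τ (e i) := τ.injective.comp e.injective
  by_cases h : ∃ i, τ (e i) = q
  · obtain ⟨i, rfl⟩ := h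
    rw [hi.extend_apply a 0 i]
    simp [e.injective.extend_apply]
  · have h' : ¬ ∃ i, e i = τ.symm q := fun ⟨i, hi⟩ => h ⟨i, by rw [hi]; simp⟩
    rw [Function.extend_apply' _ _ _ h, Function.comp_apply, Function.extend_apply' _ _ _ h']
    rfl

/-- The order of the stabiliser of `a` in the symmetric group. -/
def stabCard {n : ℕ} (a : Fin n → ℤ) : ℕ :=
  (Finset.univ.filter fun σ : Equiv.Perm (Fin n) => a ∘ σ = a).card

lemma stabCard_ne_zero {n : ℕ} (a : Fin n → ℤ) : (stabCard a : ℂ) ≠ 0 := by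
  rw [Nat.cast_ne_zero, stabCard, Finset.card_ne_zero]
  exact ⟨1, by simp⟩

lemma card_extend_eq {n N : ℕ} {a : Fin n → ℤ} (ha : (∀ i, a i ≠ 0) ∨ n = N) (e : Fin n ↪ Fin N) :
    (Finset.univ.filter fun f : Fin n ↪ Fin N =>
      Function.extend f a 0 = Function.extend e a (0 : Fin N → ℤ)).card = stabCard a := by
  symm
  have key : ∀ f : Fin n ↪ Fin N, ∀ σ : Equiv.Perm (Fin n), (∀ i, f i = e (σ i)) →
      (Function.extend f a 0 = Function.extend e a (0 : Fin N → ℤ) ↔ a ∘ σ = a) := by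
    intro f σ hf
    constructor
    · intro h
      ext i
      have := congr_fun h (f i)
      rw [f.injective.extend_apply, hf, e.injective.extend_apply] at this
      exact this.symm
    · intro h
      ext q
      by_cases hq : ∃ i, f i = q
      · obtain ⟨i, rfl⟩ := hq
        rw [f.injective.extend_apply, hf, e.injective.extend_apply]
        exact (congr_fun h i).symm
      · have hq' : ¬ ∃ i, e i = q := fun ⟨i, hi⟩ => hq ⟨σ.symm i, by rw [hf]; simpa using hi⟩
        rw [Function.extend_apply' _ _ _ hq, Function.extend_apply' _ _ _ hq']
  refine Finset.card_bij (fun σ _ => σ.toEmbedding.trans e) ?_ ?_ ?_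
  · intro σ hσ
    simp only [Finset.mem_filter, Finset.mem_univ, true_and] at hσ ⊢
    exact (key _ σ fun i => rfl).mpr hσ
  · intro σ _ τ _ h
    ext i
    have := DFunLike.congr_fun h i
    exact congr_arg _ (e.injective this)
  · intro f hf
    simp only [Finset.mem_filter, Finset.mem_univ, true_and] at hf
    have hex : ∀ i, ∃ j, e j = f i := by
      intro i
      rcases ha with ha | rfl
      swap
      · exact Finite.surjective_of_injective e.injective (f i)
      by_contra hne
      have := congr_fun hf (f i)
      rw [f.injective.extend_apply, Function.extend_apply' _ _ _ hne] at this
      exact ha i this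
    choose σ hσ using hex
    have hi : Function.Injective σ := fun i j hij => f.injective (by rw [← hσ, ← hσ, hij])
    refine ⟨Equiv.ofBijective σ (Finite.injective_iff_bijective.mp hi), ?_, ?_⟩
    · simp only [Finset.mem_filter, Finset.mem_univ, true_and]
      exact (key f _ fun i => (hσ i).symm).mp hf
    · ext i
      exact congr_arg _ (hσ i)

lemma augL_eq_smul_laurentMonomial {n N : ℕ} {a : Fin n → ℤ} (ha : (∀ i, a i ≠ 0) ∨ n = N)
    (e : Fin n ↪ Fin N) :
    augL N a = (stabCard a : ℂ) • laurentMonomial (Function.extend e a 0) := by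
  have himg : ∀ v : Fin N → ℤ, (v ∈ Finset.univ.image
      fun s : Equiv.Perm (Fin N) => Function.extend e a 0 ∘ s) ↔
      ∃ f : Fin n ↪ Fin N, Function.extend (f : Fin n → Fin N) a 0 = v := by
    intro v
    simp only [Finset.mem_image, Finset.mem_univ, true_and]
    constructor
    · rintro ⟨s, rfl⟩
      exact ⟨e.trans s.symm.toEmbedding, extend_trans_perm e s.symm a⟩
    · rintro ⟨f, rfl⟩
      obtain ⟨τ, hτ⟩ := exists_perm_comp_eq e f
      refine ⟨τ.symm, ?_⟩
      rw [← extend_trans_perm]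
      simp only [hτ]
  rw [augL, laurentMonomial, ← Finset.sum_fiberwise_of_maps_to
    (fun (f : Fin n ↪ Fin N) _ => (himg (Function.extend f a 0)).mpr ⟨f, rfl⟩), Finset.smul_sum]
  refine Finset.sum_congr rfl fun v hv => ?_
  obtain ⟨f, rfl⟩ := (himg v).mp hv
  rw [Finset.sum_congr rfl (g := fun _ => zPow (Function.extend f a (0 : Fin N → ℤ)))]
  · rw [Finset.sum_const, card_extend_eq ha f, Nat.cast_smul_eq_nsmul]
  · intro g hg
    rw [(Finset.mem_filter.mp hg).2]

/-- The nonzero integers `λ_1, …, λ_r, -μ_1, …, -μ_s` of a pair of partitions. -/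
def parts (lam mu : YoungDiagram) : Fin (lam.colLen 0 + mu.colLen 0) → ℤ :=
  Fin.append (fun i => (lam.rowLen i : ℤ)) fun j => -(mu.rowLen j : ℤ)

lemma rowLen_pos_iff (lam : YoungDiagram) (i : ℕ) : 0 < lam.rowLen i ↔ i < lam.colLen 0 := by
  rw [← YoungDiagram.mem_iff_lt_rowLen, YoungDiagram.mem_iff_lt_colLen]

lemma rowLen_eq_zero {lam : YoungDiagram} {i : ℕ} (h : lam.colLen 0 ≤ i) : lam.rowLen i = 0 := by
  have := rowLen_pos_iff lam i
  omega

lemma parts_ne_zero (lam mu : YoungDiagram) (i) : parts lam mu i ≠ 0 := by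
  induction i using Fin.addCases with
  | left i =>
    have := (rowLen_pos_iff lam i).mpr i.2
    simp only [parts, Fin.append_left]
    omega
  | right i =>
    have := (rowLen_pos_iff mu i).mpr i.2
    simp only [parts, Fin.append_right]
    omega

/-- The positions of the nonzero entries of `chi N lam mu`. -/
def chiEmb {lam mu : YoungDiagram} {N : ℕ} (h : lam.colLen 0 + mu.colLen 0 ≤ N) :
    Fin (lam.colLen 0 + mu.colLen 0) ↪ Fin N where
  toFun := Fin.append (fun i => ⟨i, by omega⟩) fun j => ⟨N - 1 - j, by omega⟩
  inj' := by
    intro i j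
    induction i using Fin.addCases <;> induction j using Fin.addCases <;>
      simp only [Fin.append_left, Fin.append_right, Fin.ext_iff, Fin.val_castAdd,
        Fin.val_natAdd] <;> omega

lemma val_chiEmb_left {lam mu : YoungDiagram} {N : ℕ} (h : lam.colLen 0 + mu.colLen 0 ≤ N)
    (i : Fin (lam.colLen 0)) : (chiEmb h (Fin.castAdd _ i) : ℕ) = i := by
  change (Fin.append _ _ (Fin.castAdd _ i) : Fin N).val = _
  rw [Fin.append_left]

lemma val_chiEmb_right {lam mu : YoungDiagram} {N : ℕ} (h : lam.colLen 0 + mu.colLen 0 ≤ N)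
    (i : Fin (mu.colLen 0)) : (chiEmb h (Fin.natAdd _ i) : ℕ) = N - 1 - i := by
  change (Fin.append _ _ (Fin.natAdd _ i) : Fin N).val = _
  rw [Fin.append_right]

lemma extend_chiEmb {lam mu : YoungDiagram} {N : ℕ} (h : lam.colLen 0 + mu.colLen 0 ≤ N) :
    Function.extend (chiEmb h) (parts lam mu) 0 = chi N lam mu := by
  ext p
  by_cases hp : ∃ i, chiEmb h i = p
  · obtain ⟨i, rfl⟩ := hp
    rw [(chiEmb h).injective.extend_apply]
    induction i using Fin.addCases with
    | left i =>
      have := i.2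
      have h0 : mu.rowLen (Fin.rev (chiEmb h (Fin.castAdd _ i))) = 0 :=
        rowLen_eq_zero (by rw [Fin.val_rev, val_chiEmb_left]; omega)
      rw [chi, h0, val_chiEmb_left]
      simp [parts]
    | right i =>
      have := i.2
      have h0 : lam.rowLen (chiEmb h (Fin.natAdd _ i)) = 0 :=
        rowLen_eq_zero (by rw [val_chiEmb_right]; omega)
      have h1 : ((chiEmb h (Fin.natAdd _ i)).rev : ℕ) = i := by
        rw [Fin.val_rev, val_chiEmb_right]; omega
      rw [chi, h0, h1]
      simp [parts]
  · rw [Function.extend_apply' _ _ _ hp, chi, rowLen_eq_zero, rowLen_eq_zero]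
    · simp
    · by_contra! hlt
      refine hp ⟨Fin.natAdd _ ⟨p.rev, hlt⟩, ?_⟩
      ext
      rw [val_chiEmb_right, Fin.val_rev]
      omega
    · by_contra! hlt
      exact hp ⟨Fin.castAdd _ ⟨p, hlt⟩, by ext; rw [val_chiEmb_left]⟩

lemma augL_eq_zero {n N : ℕ} (h : N < n) (a : Fin n → ℤ) : augL N a = 0 := by
  have : IsEmpty (Fin n ↪ Fin N) :=
    ⟨fun f => absurd (Fintype.card_le_of_embedding f) (by simpa using h)⟩
  simp [augL]

lemma phi_smul_aug_parts (lam mu : YoungDiagram) {N : ℕ}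
    (h : lam.colLen 0 + mu.colLen 0 ≤ N) :
    phi N ((stabCard (parts lam mu) : ℂ)⁻¹ • aug _ (parts lam mu)) =
      laurentMonomial (chi N lam mu) := by
  rw [map_smul, phi_aug, augL_eq_smul_laurentMonomial (.inl (parts_ne_zero lam mu))
    (chiEmb h),
    extend_chiEmb, smul_smul, inv_mul_cancel₀ (stabCard_ne_zero _), one_smul]

lemma phi_mFun (lam mu : YoungDiagram) {N : ℕ} (h : lam.colLen 0 + mu.colLen 0 ≤ N) :
    phi N (mFun lam mu) = laurentMonomial (chi N lam mu) :=
  Classical.epsilon_spec (p := fun m : LambdaPM => ∀ N : ℕ, lam.colLen 0 + mu.colLen 0 ≤ N →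
    phi N m = laurentMonomial (chi N lam mu)) ⟨_, fun _ => phi_smul_aug_parts lam mu⟩ N h

lemma eq_mFun {lam mu : YoungDiagram} {f : LambdaPM}
    (hf : ∀ N : ℕ, lam.colLen 0 + mu.colLen 0 ≤ N → phi N f = laurentMonomial (chi N lam mu)) :
    f = mFun lam mu := by
  rw [← sub_eq_zero]
  refine phi_eventually_injective (lam.colLen 0 + mu.colLen 0) fun N hN => ?_
  rw [map_sub, hf N hN, phi_mFun lam mu hN, sub_self]

lemma mFun_eq (lam mu : YoungDiagram) :
    mFun lam mu = (stabCard (parts lam mu) : ℂ)⁻¹ • aug _ (parts lam mu) :=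
  (eq_mFun fun _ => phi_smul_aug_parts lam mu).symm

lemma phi_mFun_eq_zero (lam mu : YoungDiagram) {N : ℕ} (h : N < lam.colLen 0 + mu.colLen 0) :
    phi N (mFun lam mu) = 0 := by
  rw [mFun_eq, map_smul, phi_aug, augL_eq_zero h, smul_zero]

lemma laurentMonomial_comp_perm {N : ℕ} (c : Fin N → ℤ) (τ : Equiv.Perm (Fin N)) :
    laurentMonomial (c ∘ τ) = laurentMonomial c := by
  have : Finset.univ.image (fun s : Equiv.Perm (Fin N) => (c ∘ τ) ∘ s) =
      Finset.univ.image (fun s : Equiv.Perm (Fin N) => c ∘ s) := by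
    ext v
    simp only [Finset.mem_image, Finset.mem_univ, true_and]
    constructor
    · rintro ⟨s, rfl⟩
      exact ⟨s.trans τ, rfl⟩
    · rintro ⟨s, rfl⟩
      exact ⟨s.trans τ.symm, by ext i; simp⟩
  rw [laurentMonomial, this, laurentMonomial]

lemma map_laurentMonomial {N M : ℕ} (T : Laurent N →ₗ[ℂ] Laurent M)
    (t : (Fin N → ℤ) → (Fin M → ℤ)) (ht : Function.Injective t)
    (hT : ∀ v, T (zPow v) = zPow (t v)) (c : Fin N → ℤ) (d : Fin M → ℤ)
    (hc : (Finset.univ.image fun s : Equiv.Perm (Fin N) => c ∘ s).image t =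
      Finset.univ.image fun s : Equiv.Perm (Fin M) => d ∘ s) :
    T (laurentMonomial c) = laurentMonomial d := by
  rw [laurentMonomial, laurentMonomial, ← hc, Finset.sum_image (fun _ _ _ _ h => ht h), map_sum]
  exact Finset.sum_congr rfl fun v _ => hT v

lemma invAct_laurentMonomial {N : ℕ} (c : Fin N → ℤ) :
    invAct N (laurentMonomial c) = laurentMonomial (-c) := by
  refine map_laurentMonomial (invAct N).toLinearMap (fun v => -v) neg_injective
    (fun v => invAct_zPow v) c (-c) ?_
  rw [Finset.image_image]
  rfl

lemma starPM_mFun (lam mu : YoungDiagram) : starPM (mFun lam mu) = mFun mu lam := by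
  refine eq_mFun fun N hN => ?_
  rw [phi_starPM, phi_mFun _ _ (by omega), invAct_laurentMonomial,
    ← laurentMonomial_comp_perm _ Fin.revPerm]
  congr 1
  ext i
  simp [chi]

lemma aug_comp_equiv {n m : ℕ} (a : Fin n → ℤ) (e : Fin m ≃ Fin n) : aug m (a ∘ e) = aug n a := by
  rw [← sub_eq_zero]
  refine phi_eventually_injective 0 fun N _ => ?_
  rw [map_sub, phi_aug, phi_aug, sub_eq_zero, augL, augL,
    ← Equiv.sum_comp (e.embeddingCongr (Equiv.refl (Fin N)))]
  refine Finset.sum_congr rfl fun f _ => ?_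
  congr 1
  ext q
  by_cases hq : ∃ i, f i = q
  · obtain ⟨i, rfl⟩ := hq
    have : f i = (e.embeddingCongr (Equiv.refl (Fin N)) f) (e i) := by simp
    rw [f.injective.extend_apply]
    conv_rhs => rw [this, (Function.Embedding.injective _).extend_apply]
    rfl
  · have hq' : ¬ ∃ i, e.embeddingCongr (Equiv.refl (Fin N)) f i = q := by
      rintro ⟨i, hi⟩
      exact hq ⟨e.symm i, by simpa using hi⟩
    rw [Function.extend_apply' _ _ _ hq, Function.extend_apply' _ _ _ hq']

lemma univ_val_map_parts (lam mu : YoungDiagram) :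
    Finset.univ.val.map (parts lam mu) =
      (lam.rowLens : Multiset ℕ).map (fun x : ℕ => (x : ℤ)) +
        (mu.rowLens : Multiset ℕ).map (fun x : ℕ => -(x : ℤ)) := by
  rw [Fin.univ_val_map, parts, List.ofFn_fin_append, ← Multiset.coe_add]
  have h : ∀ (nu : YoungDiagram) (g : ℕ → ℤ),
      List.ofFn (fun i : Fin (nu.colLen 0) => g (nu.rowLen i)) = nu.rowLens.map g := by
    intro nu g
    apply List.ext_getElem <;> simp [YoungDiagram.rowLens]
  rw [h lam (fun x : ℕ => (x : ℤ)), h mu (fun x : ℕ => -(x : ℤ))]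
  simp

lemma filter_pos_map_parts (lam mu : YoungDiagram) :
    ((Finset.univ.val.map (parts lam mu)).filter (0 < ·)).map Int.toNat = lam.rowLens ∧
    ((Finset.univ.val.map (parts lam mu)).filter (¬ 0 < ·)).map (fun x => (-x).toNat) =
      mu.rowLens := by
  have h1 := lam.pos_of_mem_rowLens
  have h2 := mu.pos_of_mem_rowLens
  rw [univ_val_map_parts]
  have a1 : ((lam.rowLens : Multiset ℕ).map (fun x : ℕ => (x : ℤ))).filter (0 < ·) =
      (lam.rowLens : Multiset ℕ).map (fun x : ℕ => (x : ℤ)) :=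
    Multiset.filter_eq_self.mpr (by simpa using h1)
  have a2 : ((lam.rowLens : Multiset ℕ).map (fun x : ℕ => (x : ℤ))).filter (¬ 0 < ·) = 0 :=
    Multiset.filter_eq_nil.mpr (by simpa using h1)
  have a3 : ((mu.rowLens : Multiset ℕ).map (fun x : ℕ => -(x : ℤ))).filter (0 < ·) = 0 :=
    Multiset.filter_eq_nil.mpr (by simp)
  have a4 : ((mu.rowLens : Multiset ℕ).map (fun x : ℕ => -(x : ℤ))).filter (¬ 0 < ·) =
      (mu.rowLens : Multiset ℕ).map (fun x : ℕ => -(x : ℤ)) :=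
    Multiset.filter_eq_self.mpr (by simp)
  rw [Multiset.filter_add, Multiset.filter_add, a1, a2, a3, a4]
  simp [Function.comp_def]

lemma rowLens_injective {lam mu : YoungDiagram}
    (h : (lam.rowLens : Multiset ℕ) = mu.rowLens) : lam = mu := by
  have := (Multiset.coe_eq_coe.mp h).eq_of_sortedGE lam.rowLens_sorted mu.rowLens_sorted
  apply YoungDiagram.equivListRowLens.injective
  ext1
  exact this

lemma parts_multiset_injective {lam mu lam' mu' : YoungDiagram}
    (h : Finset.univ.val.map (parts lam mu) = Finset.univ.val.map (parts lam' mu')) :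
    lam = lam' ∧ mu = mu' := by
  have h1 := filter_pos_map_parts lam mu
  rw [h, (filter_pos_map_parts lam' mu').1, (filter_pos_map_parts lam' mu').2] at h1
  exact ⟨(rowLens_injective h1.1).symm, (rowLens_injective h1.2).symm⟩

lemma exists_rowLens (S : Multiset ℕ) (hS : ∀ x ∈ S, 0 < x) :
    ∃ lam : YoungDiagram, (lam.rowLens : Multiset ℕ) = S := by
  refine ⟨YoungDiagram.ofRowLens (S.sort (· ≥ ·)) (S.pairwise_sort (· ≥ ·)).sortedGE, ?_⟩
  rw [YoungDiagram.rowLens_ofRowLens_eq_self]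
  · exact S.sort_eq _
  · intro x hx
    exact hS x (by simpa using hx)

lemma exists_equiv_of_map_eq {n m : ℕ} {a : Fin n → ℤ} {b : Fin m → ℤ}
    (h : Finset.univ.val.map a = Finset.univ.val.map b) : ∃ e : Fin n ≃ Fin m, b ∘ e = a := by
  have hcard : ∀ c, Fintype.card {i // a i = c} = Fintype.card {i // b i = c} := by
    intro c
    have := congr_arg (Multiset.count c) h
    rw [Multiset.count_map, Multiset.count_map] at this
    simp only [Fintype.card_subtype]
    simp only [eq_comm (a := c)] at this
    exact this
  refine ⟨Equiv.ofFiberEquiv fun c => Fintype.equivOfCardEq (hcard c), ?_⟩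
  ext i
  exact Equiv.ofFiberEquiv_map _ i

lemma exists_parts {n : ℕ} (a : Fin n → ℤ) (ha : ∀ i, a i ≠ 0) :
    ∃ (lam mu : YoungDiagram) (e : Fin n ≃ Fin (lam.colLen 0 + mu.colLen 0)),
      parts lam mu ∘ e = a := by
  set S := Finset.univ.val.map a with hS
  have hS0 : ∀ x ∈ S, x ≠ 0 := by simpa [hS] using ha
  obtain ⟨lam, hlam⟩ := exists_rowLens ((S.filter (0 < ·)).map Int.toNat) (by
    intro x hx
    obtain ⟨y, hy, rfl⟩ := Multiset.mem_map.mp hx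
    have := (Multiset.mem_filter.mp hy).2
    omega)
  obtain ⟨mu, hmu⟩ := exists_rowLens ((S.filter (¬ 0 < ·)).map fun x => (-x).toNat) (by
    intro x hx
    obtain ⟨y, hy, rfl⟩ := Multiset.mem_map.mp hx
    have := hS0 y (Multiset.mem_of_mem_filter hy)
    have := (Multiset.mem_filter.mp hy).2
    omega)
  refine ⟨lam, mu, exists_equiv_of_map_eq ?_⟩
  rw [univ_val_map_parts, hlam, hmu, ← hS, Multiset.map_map, Multiset.map_map]
  conv_lhs => rw [← Multiset.filter_add_not (0 < ·) S]
  congr 1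
  · refine (Multiset.map_id' _).symm.trans (Multiset.map_congr rfl fun x hx => ?_)
    have := (Multiset.mem_filter.mp hx).2
    simp only [Function.comp_apply]
    omega
  · refine (Multiset.map_id' _).symm.trans (Multiset.map_congr rfl fun x hx => ?_)
    have := (Multiset.mem_filter.mp hx).2
    simp only [Function.comp_apply]
    omega

/-- After specialisation of `p_0`, every augmented monomial function is proportional to an
`m_{λ,μ}`; zero entries contribute scalar factors. -/
lemma exists_specialize_aug {n : ℕ} (a : Fin n → ℤ) : ∃ lam mu : YoungDiagram,
    (∀ F : ℤ → ℤ, F 0 = 0 → ∑ i, F (a i) = ∑ i, F (parts lam mu i)) ∧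
    ∀ p0 : ℂ, ∃ c : ℂ, specialize p0 (aug n a) = c • specialize p0 (mFun lam mu) := by
  induction n with
  | zero =>
    obtain ⟨lam, mu, e, he⟩ := exists_parts a (fun i => i.elim0)
    refine ⟨lam, mu, fun F _ => ?_, fun p0 => ⟨stabCard (parts lam mu), ?_⟩⟩
    · rw [← Equiv.sum_comp e, ← he]; rfl
    · rw [← he, aug_comp_equiv, mFun_eq, map_smul, smul_smul,
        mul_inv_cancel₀ (stabCard_ne_zero _), one_smul]
  | succ n ih =>
    by_cases h : ∃ i, a i = 0
    · obtain ⟨i, hi⟩ := h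
      obtain ⟨lam, mu, hF, hc⟩ := ih (Fin.tail (a ∘ Equiv.swap 0 i))
      have hcons : a ∘ Equiv.swap 0 i = Fin.cons 0 (Fin.tail (a ∘ Equiv.swap 0 i)) := by
        conv_lhs => rw [← Fin.cons_self_tail (a ∘ Equiv.swap 0 i)]
        simp [hi]
      refine ⟨lam, mu, fun F F0 => ?_, fun p0 => ?_⟩
      · rw [← hF F F0, ← Equiv.sum_comp (Equiv.swap 0 i)]
        change ∑ j, F ((a ∘ Equiv.swap 0 i) j) = _
        rw [hcons, Fin.sum_univ_succ]
        simp [F0]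
      · obtain ⟨c, hc⟩ := hc p0
        refine ⟨(p0 - n) * c, ?_⟩
        rw [← aug_comp_equiv a (Equiv.swap 0 i), hcons, aug_cons_zero, map_mul, hc, mul_smul,
          map_sub, specialize_X, map_natCast, MvPolynomial.smul_eq_C_mul _ (p0 - n : ℂ),
          map_sub, map_natCast]
        simp [powerSum]
    · obtain ⟨lam, mu, e, he⟩ := exists_parts a (by simpa using h)
      refine ⟨lam, mu, fun F _ => ?_, fun p0 => ⟨stabCard (parts lam mu), ?_⟩⟩
      · rw [← Equiv.sum_comp e, ← he]; rfl
      · rw [← he, aug_comp_equiv, mFun_eq, map_smul, smul_smul,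
          mul_inv_cancel₀ (stabCard_ne_zero _), one_smul]

/-! ### Dominance and squeezing -/

lemma sum_range_eq_of_zero {A : Type*} [AddCommMonoid A] {f : ℕ → A} {n m : ℕ}
    (hn : ∀ i ≥ n, f i = 0) (hm : ∀ i ≥ m, f i = 0) :
    ∑ i ∈ Finset.range n, f i = ∑ i ∈ Finset.range m, f i := by
  wlog h : n ≤ m generalizing n m
  · exact (this hm hn (by omega)).symm
  · refine Finset.sum_subset (Finset.range_mono h) fun i _ hi => hn i ?_
    simpa using hi

lemma card_eq_sum_rowLen (lam : YoungDiagram) :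
    lam.card = ∑ i ∈ Finset.range (lam.colLen 0), lam.rowLen i := by
  rw [YoungDiagram.card, Finset.card_eq_sum_card_fiberwise (f := Prod.fst)
    (t := Finset.range (lam.colLen 0))]
  · refine Finset.sum_congr rfl fun i _ => ?_
    rw [YoungDiagram.rowLen_eq_card]
    rfl
  · rintro ⟨i, j⟩ hij
    simp only [Finset.coe_range, Set.mem_Iio]
    rw [← YoungDiagram.mem_iff_lt_colLen]
    exact lam.up_left_mem le_rfl (Nat.zero_le _) (YoungDiagram.mem_cells _ |>.mp hij)

lemma eq_of_rowLen_eq {lam mu : YoungDiagram} (h : ∀ i, lam.rowLen i = mu.rowLen i) :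
    lam = mu := by
  apply YoungDiagram.ext
  ext ⟨i, j⟩
  rw [YoungDiagram.mem_cells, YoungDiagram.mem_cells, YoungDiagram.mem_iff_lt_rowLen,
    YoungDiagram.mem_iff_lt_rowLen, h]

lemma sum_parts {A : Type*} [AddCommMonoid A] (lam mu : YoungDiagram) (F : ℤ → A) :
    ∑ i, F (parts lam mu i) = ∑ i ∈ Finset.range (lam.colLen 0), F (lam.rowLen i) +
      ∑ i ∈ Finset.range (mu.colLen 0), F (-(mu.rowLen i : ℤ)) := by
  rw [Fin.sum_univ_add, Finset.sum_range, Finset.sum_range]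
  simp [parts]

/-- Weak majorisation from the comparison of the convex functions `x ↦ (x - t)_+`: in degree `m`
take `t` to be the `m`-th row length of the larger partition. -/
lemma sum_rowLen_le_of_truncated {lam' lam : YoungDiagram}
    (h : ∀ t : ℕ, ∑ i ∈ Finset.range (lam'.colLen 0), (lam'.rowLen i - t) ≤
      ∑ i ∈ Finset.range (lam.colLen 0), (lam.rowLen i - t)) (m : ℕ) :
    ∑ i ∈ Finset.range m, lam'.rowLen i ≤ ∑ i ∈ Finset.range m, lam.rowLen i := by
  set t := lam.rowLen m with ht
  have h1 : ∑ i ∈ Finset.range (lam.colLen 0), (lam.rowLen i - t) =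
      ∑ i ∈ Finset.range m, (lam.rowLen i - t) := by
    refine sum_range_eq_of_zero (fun i hi => by rw [rowLen_eq_zero hi, zero_tsub]) fun i hi => ?_
    have := lam.rowLen_anti m i hi
    omega
  have h2 : ∑ i ∈ Finset.range m, lam.rowLen i =
      ∑ i ∈ Finset.range m, (lam.rowLen i - t) + ∑ i ∈ Finset.range m, t := by
    rw [← Finset.sum_add_distrib]
    refine Finset.sum_congr rfl fun i hi => ?_
    have := lam.rowLen_anti i m (Finset.mem_range.mp hi).le
    omega
  have h3 : ∑ i ∈ Finset.range m, lam'.rowLen i ≤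
      ∑ i ∈ Finset.range m, (lam'.rowLen i - t) + ∑ i ∈ Finset.range m, t := by
    rw [← Finset.sum_add_distrib]
    exact Finset.sum_le_sum fun i _ => by omega
  have h4 : ∑ i ∈ Finset.range m, (lam'.rowLen i - t) ≤
      ∑ i ∈ Finset.range (lam'.colLen 0), (lam'.rowLen i - t) := by
    rw [sum_range_eq_of_zero (n := lam'.colLen 0) (m := max m (lam'.colLen 0))
      (fun i hi => by rw [rowLen_eq_zero hi, zero_tsub])
      (fun i hi => by rw [rowLen_eq_zero (le_trans (le_max_right _ _) hi), zero_tsub])]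
    exact Finset.sum_le_sum_of_subset (Finset.range_mono (le_max_left _ _))
  have := h t
  omega

lemma pairLE_of_convex {lam' mu' lam mu : YoungDiagram}
    (hsum : ∑ i, parts lam' mu' i = ∑ i, parts lam mu i)
    (hpos : ∀ t : ℕ, ∑ i, (parts lam' mu' i - t).toNat ≤ ∑ i, (parts lam mu i - t).toNat)
    (hneg : ∀ t : ℕ, ∑ i, (-parts lam' mu' i - t).toNat ≤ ∑ i, (-parts lam mu i - t).toNat) :
    PairLE lam' mu' lam mu := by
  have hz : ∀ (nu : YoungDiagram) (t : ℕ),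
      ∑ i ∈ Finset.range (nu.colLen 0), (-(nu.rowLen i : ℤ) - t).toNat = 0 := fun nu t =>
    Finset.sum_eq_zero fun i _ => by omega
  have hn : ∀ (nu : YoungDiagram) (t : ℕ),
      ∑ i ∈ Finset.range (nu.colLen 0), ((nu.rowLen i : ℤ) - t).toNat =
        ∑ i ∈ Finset.range (nu.colLen 0), (nu.rowLen i - t) := fun nu t =>
    Finset.sum_congr rfl fun i _ => by omega
  refine ⟨?_, sum_rowLen_le_of_truncated fun t => ?_, sum_rowLen_le_of_truncated fun t => ?_⟩
  · rw [sum_parts _ _ (fun x => x), sum_parts _ _ (fun x => x)] at hsum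
    simp only [Finset.sum_neg_distrib] at hsum
    simp only [card_eq_sum_rowLen]
    push_cast
    linarith
  · have := hpos t
    rw [sum_parts _ _ (fun x => (x - t).toNat), sum_parts _ _ (fun x => (x - t).toNat), hz, hz,
      hn, hn] at this
    simpa using this
  · have := hneg t
    rw [sum_parts _ _ (fun x => (-x - t).toNat), sum_parts _ _ (fun x => (-x - t).toNat), hz, hz]
      at this
    simpa [hn] using this

lemma sum_squeeze {ι A : Type*} [Fintype ι] [DecidableEq ι] [AddCommMonoid A] (F : ℤ → A)
    (a : ι → ℤ) {i j : ι} (hij : i ≠ j) (l : ℕ) : ∃ R : A,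
      ∑ x, F (a x) = F (a i) + F (a j) + R ∧
      ∑ x, F (squeeze a i j l x) = F (a i - (a i - a j).sign * l) +
        F (a j + (a i - a j).sign * l) + R := by
  refine ⟨∑ x ∈ (Finset.univ.erase i).erase j, F (a x), ?_, ?_⟩
  · rw [add_assoc, Finset.add_sum_erase _ (fun x => F (a x)) (by simp [hij.symm]),
      Finset.add_sum_erase _ (fun x => F (a x)) (Finset.mem_univ i)]
  · have h : ∑ x ∈ (Finset.univ.erase i).erase j, F (a x) =
        ∑ x ∈ (Finset.univ.erase i).erase j, F (squeeze a i j l x) := by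
      refine Finset.sum_congr rfl fun x hx => ?_
      simp only [Finset.mem_erase, Finset.mem_univ, and_true] at hx
      simp [squeeze, hx.1, hx.2]
    have hi : a i - (a i - a j).sign * l = squeeze a i j l i := by simp [squeeze, hij]
    have hj : a j + (a i - a j).sign * l = squeeze a i j l j := by simp [squeeze, hij.symm]
    rw [h, hi, hj, add_assoc, Finset.add_sum_erase _ (fun x => F (squeeze a i j l x))
      (by simp [hij.symm]), Finset.add_sum_erase _ (fun x => F (squeeze a i j l x))
      (Finset.mem_univ i)]

lemma sum_squeeze_eq {ι : Type*} [Fintype ι] [DecidableEq ι] (a : ι → ℤ) {i j : ι}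
    (hij : i ≠ j) (l : ℕ) : ∑ x, squeeze a i j l x = ∑ x, a x := by
  obtain ⟨R, h1, h2⟩ := sum_squeeze (fun x => x) a hij l
  rw [h1, h2]
  ring

lemma squeeze_cases {ι : Type*} (a : ι → ℤ) (i j : ι) {l : ℕ}
    (hl : l ∈ Finset.Ico 1 (a i - a j).natAbs) :
    (a i - a j).sign = 1 ∧ a j + l < a i ∨ (a i - a j).sign = -1 ∧ a i + l < a j := by
  rw [Finset.mem_Ico] at hl
  rcases lt_trichotomy (a i) (a j) with h | h | h
  · right
    exact ⟨Int.sign_eq_neg_one_of_neg (by omega), by omega⟩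
  · omega
  · left
    exact ⟨Int.sign_eq_one_of_pos (by omega), by omega⟩

lemma sum_toNat_squeeze_le {ι : Type*} [Fintype ι] [DecidableEq ι] (a : ι → ℤ) {i j : ι}
    (hij : i ≠ j) {l : ℕ} (hl : l ∈ Finset.Ico 1 (a i - a j).natAbs) (t : ℕ) :
    ∑ x, (squeeze a i j l x - t).toNat ≤ ∑ x, (a x - t).toNat ∧
    ∑ x, (-squeeze a i j l x - t).toNat ≤ ∑ x, (-a x - t).toNat := by
  obtain ⟨R, h1, h2⟩ := sum_squeeze (fun x => (x - t).toNat) a hij l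
  obtain ⟨R', h3, h4⟩ := sum_squeeze (fun x => (-x - t).toNat) a hij l
  rw [h1, h2, h3, h4]
  rcases squeeze_cases a i j hl with ⟨hs, hlt⟩ | ⟨hs, hlt⟩ <;> rw [hs] <;>
    rw [Finset.mem_Ico] at hl <;> constructor <;> omega

lemma sum_sq_squeeze_lt {ι : Type*} [Fintype ι] [DecidableEq ι] (a : ι → ℤ) {i j : ι}
    (hij : i ≠ j) {l : ℕ} (hl : l ∈ Finset.Ico 1 (a i - a j).natAbs) :
    ∑ x, squeeze a i j l x ^ 2 < ∑ x, a x ^ 2 := by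
  obtain ⟨R, h1, h2⟩ := sum_squeeze (fun x => x ^ 2) a hij l
  rw [h1, h2]
  have hl1 : (1 : ℤ) ≤ l := by exact_mod_cast (Finset.mem_Ico.mp hl).1
  rcases squeeze_cases a i j hl with ⟨hs, hlt⟩ | ⟨hs, hlt⟩ <;> rw [hs] <;> nlinarith

/-- If `y` is a non-increasing non-negative sequence whose partial sums do not exceed those of
`x`, then `∑ y² + ∑ (x - y)² ≤ ∑ x²`. -/
lemma sum_sq_sub_le {x y : ℕ → ℤ} (hy : Antitone y) (hy0 : ∀ i, 0 ≤ y i)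
    (h : ∀ n, ∑ i ∈ Finset.range n, y i ≤ ∑ i ∈ Finset.range n, x i) (n : ℕ) :
    ∑ i ∈ Finset.range n, (x i - y i) ^ 2 ≤
      ∑ i ∈ Finset.range n, x i ^ 2 - ∑ i ∈ Finset.range n, y i ^ 2 := by
  have key : ∀ n, y n * ∑ i ∈ Finset.range n, (x i - y i) ≤
      ∑ i ∈ Finset.range n, y i * (x i - y i) := by
    intro n
    induction n with
    | zero => simp
    | succ n ih =>
      have h1 : 0 ≤ ∑ i ∈ Finset.range (n + 1), (x i - y i) := by
        rw [Finset.sum_sub_distrib]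
        linarith [h (n + 1)]
      have h2 := mul_le_mul_of_nonneg_right (hy (Nat.le_succ n)) h1
      rw [Finset.sum_range_succ, Finset.sum_range_succ] at *
      linarith
  have h0 : 0 ≤ ∑ i ∈ Finset.range n, y i * (x i - y i) := by
    refine le_trans (mul_nonneg (hy0 n) ?_) (key n)
    rw [Finset.sum_sub_distrib]
    linarith [h n]
  have : ∑ i ∈ Finset.range n, x i ^ 2 - ∑ i ∈ Finset.range n, y i ^ 2 =
      ∑ i ∈ Finset.range n, (x i - y i) ^ 2 + 2 * ∑ i ∈ Finset.range n, y i * (x i - y i) := by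
    rw [Finset.mul_sum, ← Finset.sum_add_distrib, ← Finset.sum_sub_distrib]
    exact Finset.sum_congr rfl fun i _ => by ring
  linarith

lemma sum_sq_rowLen_le {lam' lam : YoungDiagram}
    (h : ∀ n : ℕ, ∑ i ∈ Finset.range n, lam'.rowLen i ≤ ∑ i ∈ Finset.range n, lam.rowLen i) :
    ∑ i ∈ Finset.range (lam'.colLen 0), (lam'.rowLen i : ℤ) ^ 2 ≤
      ∑ i ∈ Finset.range (lam.colLen 0), (lam.rowLen i : ℤ) ^ 2 ∧
    (∑ i ∈ Finset.range (lam'.colLen 0), (lam'.rowLen i : ℤ) ^ 2 =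
      ∑ i ∈ Finset.range (lam.colLen 0), (lam.rowLen i : ℤ) ^ 2 → lam' = lam) := by
  set M := max (lam'.colLen 0) (lam.colLen 0) with hM
  rw [sum_range_eq_of_zero (n := lam'.colLen 0) (m := M)
      (fun i hi => by rw [rowLen_eq_zero hi]; rfl)
      (fun i hi => by rw [rowLen_eq_zero (le_trans (le_max_left _ _) hi)]; rfl),
    sum_range_eq_of_zero (n := lam.colLen 0) (m := M)
      (fun i hi => by rw [rowLen_eq_zero hi]; rfl)
      (fun i hi => by rw [rowLen_eq_zero (le_trans (le_max_right _ _) hi)]; rfl)]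
  have key := sum_sq_sub_le (x := fun i => (lam.rowLen i : ℤ)) (y := fun i => (lam'.rowLen i : ℤ))
    (fun i j hij => Nat.cast_le.mpr (lam'.rowLen_anti i j hij)) (fun i => by positivity)
    (fun n => by exact_mod_cast h n) M
  have hnn : ∀ i ∈ Finset.range M, 0 ≤ ((lam.rowLen i : ℤ) - lam'.rowLen i) ^ 2 := fun i _ =>
    sq_nonneg _
  have h0 := Finset.sum_nonneg hnn
  refine ⟨by linarith, fun heq => eq_of_rowLen_eq fun i => ?_⟩
  have hz := (Finset.sum_eq_zero_iff_of_nonneg hnn).mp (by linarith)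
  rcases lt_or_ge i M with hi | hi
  · have := hz i (Finset.mem_range.mpr hi)
    rw [sq_eq_zero_iff] at this
    omega
  · rw [rowLen_eq_zero (le_trans (le_max_left _ _) hi),
      rowLen_eq_zero (le_trans (le_max_right _ _) hi)]

/-- The sum of the squares of all parts. -/
def sqSum (lam mu : YoungDiagram) : ℤ := ∑ i, parts lam mu i ^ 2

lemma sqSum_lt {lam' mu' lam mu : YoungDiagram} (h : PairLE lam' mu' lam mu)
    (hne : (lam', mu') ≠ (lam, mu)) : sqSum lam' mu' < sqSum lam mu := by
  obtain ⟨h1, h1'⟩ := sum_sq_rowLen_le h.2.1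
  obtain ⟨h2, h2'⟩ := sum_sq_rowLen_le h.2.2
  rw [sqSum, sqSum, sum_parts _ _ (fun x => x ^ 2), sum_parts _ _ (fun x => x ^ 2)]
  simp only [neg_sq]
  by_contra! hle
  exact hne (by rw [h1' (by linarith), h2' (by linarith)])

lemma PairLE.trans {l₁ m₁ l₂ m₂ l₃ m₃ : YoungDiagram} (h : PairLE l₁ m₁ l₂ m₂)
    (h' : PairLE l₂ m₂ l₃ m₃) : PairLE l₁ m₁ l₃ m₃ :=
  ⟨h.1.trans h'.1, fun n => (h.2.1 n).trans (h'.2.1 n), fun n => (h.2.2 n).trans (h'.2.2 n)⟩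

lemma finite_dominated (lam : YoungDiagram) : {lam' : YoungDiagram | ∀ n : ℕ,
    ∑ i ∈ Finset.range n, lam'.rowLen i ≤ ∑ i ∈ Finset.range n, lam.rowLen i}.Finite := by
  refine Set.Finite.of_injOn (f := YoungDiagram.cells)
    (t := ↑((Finset.range lam.card ×ˢ Finset.range (lam.rowLen 0)).powerset)) ?_
    (fun _ _ _ _ h => YoungDiagram.ext h) (Finset.finite_toSet _)
  intro lam' h
  simp only [Finset.coe_powerset, Set.mem_preimage, Set.mem_powerset_iff, Finset.coe_subset]
  rintro ⟨i, j⟩ hij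
  rw [YoungDiagram.mem_cells] at hij
  have hj : j < lam'.rowLen 0 :=
    YoungDiagram.mem_iff_lt_rowLen.mp (lam'.up_left_mem (Nat.zero_le _) le_rfl hij)
  have hi : i < lam'.colLen 0 :=
    YoungDiagram.mem_iff_lt_colLen.mp (lam'.up_left_mem le_rfl (Nat.zero_le _) hij)
  have h1 := h 1
  have h2 := h (lam'.colLen 0)
  have h3 : ∑ i ∈ Finset.range (lam'.colLen 0), lam.rowLen i ≤ lam.card := by
    rw [card_eq_sum_rowLen, sum_range_eq_of_zero (n := lam.colLen 0)
      (m := max (lam'.colLen 0) (lam.colLen 0)) (fun i hi => rowLen_eq_zero hi)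
      (fun i hi => rowLen_eq_zero (le_trans (le_max_right _ _) hi))]
    exact Finset.sum_le_sum_of_subset (Finset.range_mono (le_max_left _ _))
  have h4 : lam'.colLen 0 ≤ ∑ i ∈ Finset.range (lam'.colLen 0), lam'.rowLen i := by
    have := Finset.card_nsmul_le_sum (Finset.range (lam'.colLen 0)) (fun i => lam'.rowLen i) 1
      (fun i hi => (rowLen_pos_iff lam' i).mpr (Finset.mem_range.mp hi))
    simpa using this
  simp only [Finset.sum_range_one] at h1
  simp only [Finset.mem_product, Finset.mem_range]
  omega

lemma finite_pairLE (lam mu : YoungDiagram) :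
    {y : YoungDiagram × YoungDiagram | PairLE y.1 y.2 lam mu}.Finite :=
  ((finite_dominated lam).prod (finite_dominated mu)).subset fun _ h => ⟨h.2.1, h.2.2⟩

/-! ### Triangularity of the Laurent CMS operator -/

/-- The eigenvalue of the Laurent CMS operator at `P_{λ,μ}`. -/
def eigenvalue (k p0 : ℂ) (lam mu : YoungDiagram) : ℂ :=
  ∑ i, (parts lam mu i : ℂ) ^ 2
    - k / 2 * ∑ i, ∑ j, ((parts lam mu i - parts lam mu j).natAbs : ℂ)
    - k * ∑ i, ((parts lam mu i).natAbs : ℂ) * (p0 - (lam.colLen 0 + mu.colLen 0 : ℕ))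

lemma eigenvalue_ne {k p0 : ℂ} (hg : Generic k p0) {lam' mu' lam mu : YoungDiagram}
    (h : sqSum lam' mu' ≠ sqSum lam mu) :
    eigenvalue k p0 lam' mu' ≠ eigenvalue k p0 lam mu := by
  intro heq
  let A := fun l m : YoungDiagram => ∑ i, ∑ j, ((parts l m i - parts l m j).natAbs : ℤ)
  let B := fun l m : YoungDiagram => ∑ i, ((parts l m i).natAbs : ℤ)
  let n := fun l m : YoungDiagram => ((l.colLen 0 + m.colLen 0 : ℕ) : ℤ)
  have hE : ∀ l m : YoungDiagram, 2 * eigenvalue k p0 l m =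
      2 * sqSum l m - A l m * k + 2 * B l m * n l m * k - 2 * B l m * (k * p0) := by
    intro l m
    simp only [eigenvalue, sqSum, A, B, n, ← Finset.sum_mul, Int.cast_sum, Int.cast_natCast,
      Int.cast_pow]
    ring
  refine hg (2 * (sqSum lam' mu' - sqSum lam mu))
    (-A lam' mu' + 2 * B lam' mu' * n lam' mu' + A lam mu - 2 * B lam mu * n lam mu)
    (-2 * B lam' mu' + 2 * B lam mu) (by omega) ?_
  have h1 := hE lam' mu'
  rw [heq, hE lam mu] at h1
  push_cast
  linear_combination -h1

/-- The span of the `m_{λ',μ'}` strictly below `(λ,μ)`. -/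
abbrev lowerSpan (p0 : ℂ) (lam mu : YoungDiagram) : Submodule ℂ LambdaAt :=
  Submodule.span ℂ {m : LambdaAt | ∃ lam' mu' : YoungDiagram, PairLE lam' mu' lam mu ∧
        (lam', mu') ≠ (lam, mu) ∧ m = specialize p0 (mFun lam' mu')}

/-- A vector with the same nonzero entries as the parts of `(λ,μ)` yields, when squeezed, an
augmented monomial function in the span of the smaller `m_{λ',μ'}`. -/
lemma specialize_aug_squeeze_mem (p0 : ℂ) {lam mu : YoungDiagram} {n : ℕ} {a : Fin n → ℤ}
    (ha : ∀ (A : Type) [AddCommMonoid A] (F : ℤ → A), F 0 = 0 →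
      ∑ i, F (a i) = ∑ i, F (parts lam mu i))
    {i j : Fin n} (hij : i ≠ j) {l : ℕ} (hl : l ∈ Finset.Ico 1 (a i - a j).natAbs) :
    specialize p0 (aug n (squeeze a i j l)) ∈ lowerSpan p0 lam mu := by
  obtain ⟨lam', mu', hF, hc⟩ := exists_specialize_aug (squeeze a i j l)
  obtain ⟨c, hc⟩ := hc p0
  rw [hc]
  refine Submodule.smul_mem _ _ (Submodule.subset_span ⟨lam', mu', ?_, ?_, rfl⟩)
  · refine pairLE_of_convex ?_ (fun t => ?_) fun t => ?_
    · rw [← hF (fun x => x) rfl, ← ha ℤ (fun x => x) rfl, sum_squeeze_eq a hij]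
    · have h1 := (sum_toNat_squeeze_le a hij hl t).1
      have h2 := hF (fun x => ((x - t).toNat : ℤ)) (by simp)
      rw [ha ℕ (fun x => (x - t).toNat) (by simp)] at h1
      push_cast [← Nat.cast_sum] at h2
      omega
    · have h1 := (sum_toNat_squeeze_le a hij hl t).2
      have h2 := hF (fun x => ((-x - t).toNat : ℤ)) (by simp)
      rw [ha ℕ (fun x => (-x - t).toNat) (by simp)] at h1
      push_cast [← Nat.cast_sum] at h2
      omega
  · intro heq
    have h1 := sum_sq_squeeze_lt a hij hl
    rw [hF (fun x => x ^ 2) (by simp), ha ℤ (fun x => x ^ 2) (by simp)] at h1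
    simp only [Prod.mk.injEq] at heq
    obtain ⟨rfl, rfl⟩ := heq
    exact lt_irrefl _ h1

lemma pairSum_sub_smul_mem {ι A : Type*} [DecidableEq ι] [AddCommGroup A] [Module ℂ A]
    (V : Submodule ℂ A) (F : (ι → ℤ) → A) (a : ι → ℤ) (i j : ι)
    (h : i ≠ j → ∀ l ∈ Finset.Ico 1 (a i - a j).natAbs, F (squeeze a i j l) ∈ V) :
    pairSum F a i j - ((a i - a j).natAbs : ℂ) • F a ∈ V := by
  rcases eq_or_ne i j with rfl | hij
  · simp [pairSum]
  rcases Nat.eq_zero_or_pos (a i - a j).natAbs with h0 | hpos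
  · simp [pairSum, h0]
  rw [pairSum, Finset.range_eq_Ico, Finset.sum_eq_sum_Ico_succ_bot hpos, squeeze_zero, smul_add,
    add_sub_cancel_left]
  exact V.smul_mem _ (V.sum_mem fun l hl => h hij l hl)

lemma specialize_pairSum_sub_mem (p0 : ℂ) {lam mu : YoungDiagram} {n : ℕ} {a : Fin n → ℤ}
    (ha : ∀ (A : Type) [AddCommMonoid A] (F : ℤ → A), F 0 = 0 →
      ∑ i, F (a i) = ∑ i, F (parts lam mu i)) (i j : Fin n) :
    specialize p0 (pairSum (aug n) a i j) -
      ((a i - a j).natAbs : ℂ) • specialize p0 (aug n a) ∈ lowerSpan p0 lam mu := by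
  have h := map_pairSum (specialize p0).toLinearMap (aug n) a i j
  rw [AlgHom.toLinearMap_apply] at h
  rw [h]
  exact pairSum_sub_smul_mem (lowerSpan p0 lam mu) _ a i j fun hij l hl =>
    specialize_aug_squeeze_mem p0 ha hij hl

lemma cmsInfinite_aug_sub_mem (k p0 : ℂ) {lam mu : YoungDiagram} {n : ℕ} {a : Fin n → ℤ}
    (ha : ∀ (A : Type) [AddCommMonoid A] (F : ℤ → A), F 0 = 0 →
      ∑ i, F (a i) = ∑ i, F (parts lam mu i)) :
    cmsInfinite k p0 (specialize p0 (aug n a)) -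
      (∑ i, (a i : ℂ) ^ 2 - k / 2 * ∑ i, ∑ j, ((a i - a j).natAbs : ℂ)
        - k * ∑ i, ((a i).natAbs : ℂ) * (p0 - n)) • specialize p0 (aug n a) ∈
      lowerSpan p0 lam mu := by
  have h2 : ∀ i : Fin n,
      specialize p0 (pairSum (aug (n + 1)) (Fin.cons 0 a : Fin (n + 1) → ℤ) i.succ 0) -
      ((a i).natAbs * (p0 - n) : ℂ) • specialize p0 (aug n a) ∈ lowerSpan p0 lam mu := by
    intro i
    have := specialize_pairSum_sub_mem p0 (lam := lam) (mu := mu)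
      (a := (Fin.cons 0 a : Fin (n + 1) → ℤ))
      (fun A _ F F0 => by simp [Fin.sum_univ_succ, F0, ha A F F0]) i.succ 0
    have hc : specialize p0 (aug (n + 1) (Fin.cons 0 a)) =
        (p0 - n : ℂ) • specialize p0 (aug n a) := by
      rw [aug_cons_zero, map_mul, map_sub, specialize_X, map_natCast,
        MvPolynomial.smul_eq_C_mul, map_sub, map_natCast]
      simp [powerSum]
    rw [hc, smul_smul] at this
    simpa only [Fin.cons_succ, Fin.cons_zero, sub_zero] using this
  have key : cmsInfinite k p0 (specialize p0 (aug n a)) -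
      (∑ i, (a i : ℂ) ^ 2 - k / 2 * ∑ i, ∑ j, ((a i - a j).natAbs : ℂ)
        - k * ∑ i, ((a i).natAbs : ℂ) * (p0 - n)) • specialize p0 (aug n a) =
      - (k / 2) • ∑ i, ∑ j, (specialize p0 (pairSum (aug n) a i j) -
        ((a i - a j).natAbs : ℂ) • specialize p0 (aug n a))
      - k • ∑ i : Fin n,
        (specialize p0 (pairSum (aug (n + 1)) (Fin.cons 0 a : Fin (n + 1) → ℤ) i.succ 0) -
        ((a i).natAbs * (p0 - n) : ℂ) • specialize p0 (aug n a)) := by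
    rw [cmsInfinite_aug, cmsAug]
    simp only [map_sub, map_smul, map_sum, Finset.sum_sub_distrib, ← Finset.sum_smul]
    simp only [sub_smul, smul_sub, smul_smul, neg_smul, neg_mul]
    abel
  rw [key]
  exact Submodule.sub_mem _
    (Submodule.smul_mem _ _ (Submodule.sum_mem _ fun i _ => Submodule.sum_mem _ fun j _ =>
      specialize_pairSum_sub_mem p0 ha i j))
    (Submodule.smul_mem _ _ (Submodule.sum_mem _ fun i _ => h2 i))

/-- The Laurent CMS operator is triangular in the basis `m_{λ,μ}`. -/
lemma cmsInfinite_mFun_sub_mem (k p0 : ℂ) (lam mu : YoungDiagram) :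
    cmsInfinite k p0 (specialize p0 (mFun lam mu)) -
      eigenvalue k p0 lam mu • specialize p0 (mFun lam mu) ∈ lowerSpan p0 lam mu := by
  rw [mFun_eq, map_smul, cmsInfinite_smul, smul_comm, ← smul_sub]
  exact Submodule.smul_mem _ _ (cmsInfinite_aug_sub_mem k p0 fun A _ F _ => rfl)

/-! ### Eigenvectors of triangular operators -/

/-- An operator triangular with respect to `lt` has exactly one eigenvector with leading term
`m x`, provided its diagonal entry at `x` differs from those below `x`. -/
lemma existsUnique_eigenvector {V ι : Type*} [AddCommGroup V] [Module ℂ V] (m : ι → V)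
    (L : V →ₗ[ℂ] V) (lt : ι → ι → Prop) (size : ι → ℕ) (E : ι → ℂ) (x : ι)
    (htrans : ∀ y z, lt y x → lt z y → lt z x) (hsize : ∀ y z, lt z y → size z < size y)
    (hL : ∀ y, L (m y) - E y • m y ∈ Submodule.span ℂ (m '' {z | lt z y}))
    (hE : ∀ y, lt y x → E y ≠ E x) (hfin : {y | lt y x}.Finite)
    (hx : m x ∉ Submodule.span ℂ (m '' {y | lt y x})) :
    ∃! P, P - m x ∈ Submodule.span ℂ (m '' {y | lt y x}) ∧ ∃ e : ℂ, L P = e • P := by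
  set W := Submodule.span ℂ (m '' {y | lt y x}) with hW
  set T : V →ₗ[ℂ] V := L - E x • LinearMap.id with hT
  have hTa : ∀ v, T v = L v - E x • v := fun v => rfl
  have hle : ∀ y, lt y x → Submodule.span ℂ (m '' {z | lt z y}) ≤ W := fun y hy =>
    Submodule.span_mono (Set.image_mono fun z hz => htrans y z hy hz)
  have hTW : ∀ v ∈ W, T v ∈ W := by
    intro v hv
    induction hv using Submodule.span_induction with
    | mem v hv =>
      obtain ⟨y, hy, rfl⟩ := hv
      have h1 := Submodule.add_mem _ (hle y hy (hL y)) (Submodule.smul_mem W (E y - E x)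
        (Submodule.subset_span ⟨y, hy, rfl⟩))
      convert h1 using 1
      rw [hTa, sub_smul]
      abel
    | zero => simp
    | add v w _ _ hv hw => rw [map_add]; exact W.add_mem hv hw
    | smul c v _ hv => rw [map_smul]; exact W.smul_mem c hv
  have hgen : ∀ n, ∀ y, lt y x → size y = n → m y ∈ W.map T := by
    intro n
    induction n using Nat.strong_induction_on with
    | _ n ih =>
      rintro y hy rfl
      have hlow : Submodule.span ℂ (m '' {z | lt z y}) ≤ W.map T := by
        rw [Submodule.span_le]
        rintro _ ⟨z, hz, rfl⟩
        exact ih _ (hsize y z hz) z (htrans y z hy hz) rfl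
      have h1 : T (m y) ∈ W.map T := ⟨m y, Submodule.subset_span ⟨y, hy, rfl⟩, rfl⟩
      have h2 := Submodule.smul_mem _ (E y - E x)⁻¹ (Submodule.sub_mem _ h1 (hlow (hL y)))
      have h3 : T (m y) - (L (m y) - E y • m y) = (E y - E x) • m y := by
        rw [hTa, sub_smul]
        abel
      rwa [h3, smul_smul, inv_mul_cancel₀ (sub_ne_zero.mpr (hE y hy)), one_smul] at h2
  have hsurj : W ≤ W.map T := by
    conv_lhs => rw [hW]
    rw [Submodule.span_le]
    rintro _ ⟨y, hy, rfl⟩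
    exact hgen _ y hy rfl
  have hinj : ∀ v ∈ W, T v = 0 → v = 0 := by
    have : FiniteDimensional ℂ W := FiniteDimensional.span_of_finite ℂ (hfin.image m)
    have hs : Function.Surjective (T.restrict hTW) := by
      rintro ⟨v, hv⟩
      obtain ⟨w, hw, rfl⟩ := hsurj hv
      exact ⟨⟨w, hw⟩, rfl⟩
    intro v hv h0
    have := LinearMap.injective_iff_surjective.mpr hs
    have h1 : (⟨v, hv⟩ : W) = 0 := this (by ext; simpa using h0)
    exact congr_arg Subtype.val h1
  obtain ⟨w, hw, hwx⟩ := hsurj (hL x)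
  have hker : ∀ P, P - m x ∈ W → (∃ e : ℂ, L P = e • P) → T P = 0 := by
    rintro P hP ⟨e, he⟩
    have h1 : T P ∈ W := by
      have := W.add_mem (hTW _ hP) (hL x)
      rwa [map_sub, hTa (m x), sub_add_cancel] at this
    have h2 : T P = (e - E x) • P := by rw [hTa, he, sub_smul]
    rcases eq_or_ne e (E x) with rfl | hne
    · rw [h2, sub_self, zero_smul]
    · refine absurd ?_ hx
      have h3 := W.smul_mem (e - E x)⁻¹ h1
      rw [h2, smul_smul, inv_mul_cancel₀ (sub_ne_zero.mpr hne), one_smul] at h3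
      have := W.sub_mem h3 hP
      rwa [sub_sub_cancel] at this
  have hP0 : L (m x - w) = E x • (m x - w) := by
    rw [← sub_eq_zero, ← hTa, map_sub, hwx, hTa, sub_self]
  have hW0 : m x - w - m x ∈ W := by
    rw [sub_sub_cancel_left]
    exact W.neg_mem hw
  refine ⟨m x - w, ⟨hW0, E x, hP0⟩, ?_⟩
  rintro P ⟨hP, he⟩
  rw [← sub_eq_zero]
  refine hinj _ ?_ ?_
  · have := W.sub_mem hP hW0
    rwa [sub_sub_sub_cancel_right] at this
  · rw [map_sub, hker P hP he, hker _ hW0 ⟨_, hP0⟩, sub_self]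

/-! ### Linear independence of the `m_{λ,μ}` -/

lemma totalDegree_powerSum_le (p0 : ℂ) (b : ℤ) : (powerSum p0 b).totalDegree ≤ 1 := by
  unfold powerSum
  split_ifs
  · simp
  · exact (MvPolynomial.totalDegree_X _).le

lemma totalDegree_specialize_aug_le (p0 : ℂ) : ∀ {n : ℕ} (a : Fin n → ℤ),
    (specialize p0 (aug n a)).totalDegree ≤ n
  | 0, a => by simp [aug]
  | n + 1, a => by
    rw [aug, map_sub, map_mul, map_sum, specialize_X]
    refine (MvPolynomial.totalDegree_sub _ _).trans (max_le ?_ ?_)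
    · refine (MvPolynomial.totalDegree_mul _ _).trans ?_
      have := totalDegree_powerSum_le p0 (a 0)
      have := totalDegree_specialize_aug_le p0 (Fin.tail a)
      omega
    · refine MvPolynomial.totalDegree_finsetSum_le fun i _ => ?_
      exact (totalDegree_specialize_aug_le p0 _).trans n.le_succ

lemma totalDegree_specialize_aug_sub_le (p0 : ℂ) : ∀ {n : ℕ} (a : Fin (n + 1) → ℤ),
    (specialize p0 (aug (n + 1) a) - ∏ i, powerSum p0 (a i)).totalDegree ≤ n
  | 0, a => by simp [aug, specialize_X]
  | n + 1, a => by
    rw [aug, map_sub, map_mul, map_sum, specialize_X, Fin.prod_univ_succ, sub_right_comm,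
      ← mul_sub]
    refine (MvPolynomial.totalDegree_sub _ _).trans (max_le ?_ ?_)
    · refine (MvPolynomial.totalDegree_mul _ _).trans ?_
      have := totalDegree_powerSum_le p0 (a 0)
      have h : (specialize p0 (aug (n + 1) (Fin.tail a)) -
        ∏ i : Fin (n + 1), powerSum p0 (a i.succ)).totalDegree ≤ n :=
        totalDegree_specialize_aug_sub_le p0 (Fin.tail a)
      omega
    · exact MvPolynomial.totalDegree_finsetSum_le fun i _ =>
        totalDegree_specialize_aug_le p0 _

/-- The top degree part of an augmented monomial function is a product of power sums. -/
lemma coeff_specialize_aug (p0 : ℂ) {n : ℕ} (a : Fin n → ℤ) {t : {i : ℤ // i ≠ 0} →₀ ℕ}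
    (ht : n ≤ t.degree) : (specialize p0 (aug n a)).coeff t =
      (∏ i, powerSum p0 (a i)).coeff t := by
  cases n with
  | zero => simp [aug]
  | succ n =>
    rw [← sub_eq_zero, ← MvPolynomial.coeff_sub]
    refine MvPolynomial.coeff_eq_zero_of_totalDegree_lt ?_
    exact lt_of_le_of_lt (totalDegree_specialize_aug_sub_le p0 a) ht

/-- The exponent of the monomial `∏ p_{λ_i} ∏ p_{-μ_j}`. -/
def partsExponent (lam mu : YoungDiagram) : {i : ℤ // i ≠ 0} →₀ ℕ :=
  ∑ i, Finsupp.single ⟨parts lam mu i, parts_ne_zero lam mu i⟩ 1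

lemma degree_partsExponent (lam mu : YoungDiagram) :
    (partsExponent lam mu).degree = lam.colLen 0 + mu.colLen 0 := by
  simp [partsExponent, Finsupp.degree_single]

lemma partsExponent_injective {lam mu lam' mu' : YoungDiagram}
    (h : partsExponent lam mu = partsExponent lam' mu') : lam = lam' ∧ mu = mu' := by
  have key : ∀ l m : YoungDiagram, (Finsupp.toMultiset (partsExponent l m)).map Subtype.val =
      Finset.univ.val.map (parts l m) := by
    intro l m
    rw [partsExponent, map_sum]
    simp only [Finsupp.toMultiset_single, one_smul]
    have hs := Multiset.sum_map_singleton (Finset.univ.val.map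
      fun i => (⟨parts l m i, parts_ne_zero l m i⟩ : {i : ℤ // i ≠ 0}))
    rw [Multiset.map_map] at hs
    rw [Finset.sum]
    refine (congr_arg (Multiset.map Subtype.val) hs).trans ?_
    rw [Multiset.map_map]
    rfl
  exact parts_multiset_injective (by rw [← key, ← key, h])

lemma prod_powerSum_parts (p0 : ℂ) (lam mu : YoungDiagram) :
    ∏ i, powerSum p0 (parts lam mu i) = MvPolynomial.monomial (partsExponent lam mu) 1 := by
  rw [partsExponent, MvPolynomial.monomial_sum_one]
  refine Finset.prod_congr rfl fun i _ => ?_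
  rw [powerSum, dif_neg (parts_ne_zero lam mu i)]
  rfl

lemma linearIndependent_mFun (p0 : ℂ) : LinearIndependent ℂ
    fun y : YoungDiagram × YoungDiagram => specialize p0 (mFun y.1 y.2) := by
  classical
  rw [linearIndependent_iff']
  intro s g hg
  by_contra! hne
  obtain ⟨x, hx, hmax⟩ := (s.filter (g · ≠ 0)).exists_max_image
    (fun y => y.1.colLen 0 + y.2.colLen 0) (by
      obtain ⟨i, hi, hi'⟩ := hne
      exact ⟨i, Finset.mem_filter.mpr ⟨hi, hi'⟩⟩)
  rw [Finset.mem_filter] at hx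
  have h := congr_arg (MvPolynomial.coeff (partsExponent x.1 x.2)) hg
  rw [MvPolynomial.coeff_sum, Finset.sum_eq_single x, MvPolynomial.coeff_smul, mFun_eq, map_smul,
    MvPolynomial.coeff_smul, coeff_specialize_aug _ _ (degree_partsExponent _ _).ge,
    prod_powerSum_parts, MvPolynomial.coeff_monomial, if_pos rfl] at h
  · have := stabCard_ne_zero (parts x.1 x.2)
    simp [hx.2, this] at h
  · intro y hy hyx
    rw [MvPolynomial.coeff_smul]
    by_cases h0 : g y = 0
    · rw [h0, zero_smul]
    · have := hmax y (Finset.mem_filter.mpr ⟨hy, h0⟩)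
      rw [mFun_eq, map_smul, MvPolynomial.coeff_smul, coeff_specialize_aug _ _
        (by rwa [degree_partsExponent]), prod_powerSum_parts, MvPolynomial.coeff_monomial,
        if_neg, smul_zero, smul_zero]
      intro heq
      have := partsExponent_injective heq
      exact hyx (Prod.ext this.1 this.2)
  · exact fun h' => absurd hx.1 h'

/-! ### Existence, uniqueness and duality of the Jack--Laurent functions -/

lemma lowerSpan_eq (p0 : ℂ) (lam mu : YoungDiagram) : lowerSpan p0 lam mu =
    Submodule.span ℂ ((fun y : YoungDiagram × YoungDiagram => specialize p0 (mFun y.1 y.2)) ''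
      {y | PairLE y.1 y.2 lam mu ∧ y ≠ (lam, mu)}) := by
  refine congr_arg (Submodule.span ℂ) (Set.ext fun m => ?_)
  constructor
  · rintro ⟨l, n, h, hne, rfl⟩
    exact ⟨(l, n), ⟨h, hne⟩, rfl⟩
  · rintro ⟨⟨l, n⟩, ⟨h, hne⟩, rfl⟩
    exact ⟨l, n, h, hne, rfl⟩

lemma sqSum_nonneg (lam mu : YoungDiagram) : 0 ≤ sqSum lam mu :=
  Finset.sum_nonneg fun _ _ => sq_nonneg _

theorem existsUnique_isJackLaurent {k p0 : ℂ} (hg : Generic k p0) (lam mu : YoungDiagram) :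
    ∃! P, IsJackLaurent k p0 lam mu P := by
  have := existsUnique_eigenvector
    (fun y : YoungDiagram × YoungDiagram => specialize p0 (mFun y.1 y.2)) (cmsLin k p0)
    (fun y x => PairLE y.1 y.2 x.1 x.2 ∧ y ≠ x) (fun y => (sqSum y.1 y.2).toNat)
    (fun y => eigenvalue k p0 y.1 y.2) (lam, mu)
    (fun y z hy hz => ⟨hz.1.trans hy.1, fun h => by
      have h1 := sqSum_lt hy.1 hy.2
      have h2 := sqSum_lt hz.1 hz.2
      rw [h] at h2
      exact lt_asymm h1 h2⟩)
    (fun y z hz => by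
      have h1 := sqSum_lt hz.1 hz.2
      have h2 := sqSum_nonneg z.1 z.2
      change (sqSum z.1 z.2).toNat < (sqSum y.1 y.2).toNat
      omega)
    (fun y => by
      have := cmsInfinite_mFun_sub_mem k p0 y.1 y.2
      rw [lowerSpan_eq] at this
      exact this)
    (fun y hy => eigenvalue_ne hg (sqSum_lt hy.1 hy.2).ne)
    ((finite_pairLE lam mu).subset fun y hy => hy.1)
    ((linearIndependent_mFun p0).notMem_span_image fun h => h.2 rfl)
  rw [← lowerSpan_eq] at this
  exact this

lemma isJackLaurent_jackLaurent {k p0 : ℂ} (hg : Generic k p0) (lam mu : YoungDiagram) :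
    IsJackLaurent k p0 lam mu (jackLaurent k p0 lam mu) :=
  Classical.epsilon_spec (existsUnique_isJackLaurent hg lam mu).exists

lemma PairLE.swap {l m l' m' : YoungDiagram} (h : PairLE l m l' m') : PairLE m l m' l' :=
  ⟨by have := h.1; omega, h.2.2, h.2.1⟩

lemma IsJackLaurent.star {k p0 : ℂ} {lam mu : YoungDiagram} {P : LambdaAt}
    (h : IsJackLaurent k p0 lam mu P) : IsJackLaurent k p0 mu lam (star P) := by
  have hm : ∀ l m : YoungDiagram, JackLaurent.star (specialize p0 (mFun l m)) =
      specialize p0 (mFun m l) := fun l m => by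
    rw [← specialize_starPM, starPM_mFun]
  constructor
  · rw [← hm, ← map_sub]
    have h1 := Submodule.mem_map_of_mem (f := JackLaurent.star.toLinearMap) h.1
    rw [Submodule.map_span] at h1
    refine Submodule.span_mono ?_ h1
    rintro _ ⟨_, ⟨l, m, hle, hne, rfl⟩, rfl⟩
    refine ⟨m, l, hle.swap, fun heq => hne ?_, hm l m⟩
    rw [Prod.mk.injEq] at heq ⊢
    exact ⟨heq.2, heq.1⟩
  · obtain ⟨E, hE⟩ := h.2
    exact ⟨E, by rw [cmsInfinite_star, hE, map_smul]⟩

theorem star_jackLaurent {k p0 : ℂ} (hg : Generic k p0) (lam mu : YoungDiagram) :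
    star (jackLaurent k p0 lam mu) = jackLaurent k p0 mu lam :=
  (existsUnique_isJackLaurent hg mu lam).unique (isJackLaurent_jackLaurent hg lam mu).star
    (isJackLaurent_jackLaurent hg mu lam)

/-! ### Triangularity in `N` variables -/

section FiniteTriangular

variable {N : ℕ}

lemma augL_eq_smul (c : Fin N → ℤ) : augL N c = (stabCard c : ℂ) • laurentMonomial c := by
  rw [augL_eq_smul_laurentMonomial (.inr rfl) (Function.Embedding.refl _)]
  congr 2
  ext i
  exact Function.injective_id.extend_apply c 0 i

lemma laurentMonomial_eq_smul (c : Fin N → ℤ) :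
    laurentMonomial c = (stabCard c : ℂ)⁻¹ • augL N c := by
  rw [augL_eq_smul, smul_smul, inv_mul_cancel₀ (stabCard_ne_zero _), one_smul]

/-- The span of the monomial symmetric Laurent polynomials with smaller sum of squares of the
exponents. -/
abbrev sqLowerSpan (c : Fin N → ℤ) : Submodule ℂ (Laurent N) :=
  Submodule.span ℂ (laurentMonomial '' {d | ∑ i, d i ^ 2 < ∑ i, c i ^ 2})

/-- The eigenvalue of the CMS operator in `N` variables with leading exponent `c`. -/
def finEigenvalue (k : ℂ) (c : Fin N → ℤ) : ℂ :=
  ∑ i, (c i : ℂ) ^ 2 - k / 2 * ∑ i, ∑ j, ((c i - c j).natAbs : ℂ)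

lemma lap_laurentMonomial_sub_mem (k : ℂ) (c : Fin N → ℤ) :
    lap N k (laurentMonomial c) - finEigenvalue k c • laurentMonomial c ∈ sqLowerSpan c := by
  have hp : ∀ i j, pairSum (augL N) c i j - ((c i - c j).natAbs : ℂ) • augL N c ∈
      sqLowerSpan c := fun i j =>
    pairSum_sub_smul_mem (sqLowerSpan c) _ c i j fun hij l hl => by
      rw [augL_eq_smul]
      exact Submodule.smul_mem _ _
        (Submodule.subset_span ⟨_, sum_sq_squeeze_lt c hij hl, rfl⟩)
  have hz : ∀ i : Fin N, pairSum (augL N) (Fin.cons 0 c : Fin (N + 1) → ℤ) i.succ 0 = 0 := by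
    intro i
    simp [pairSum, augL_eq_zero (Nat.lt_succ_self N)]
  have key : lap N k (augL N c) - finEigenvalue k c • augL N c = -(k / 2) • ∑ i, ∑ j,
      (pairSum (augL N) c i j - ((c i - c j).natAbs : ℂ) • augL N c) := by
    rw [lap_augL, finEigenvalue]
    simp only [hz, Finset.sum_const_zero, smul_zero, sub_zero, Finset.sum_sub_distrib,
      ← Finset.sum_smul]
    simp only [sub_smul, smul_sub, smul_smul, neg_smul, neg_mul]
    abel
  rw [laurentMonomial_eq_smul, map_smul, smul_comm, ← smul_sub, key]
  exact Submodule.smul_mem _ _ (Submodule.smul_mem _ _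
    (Submodule.sum_mem _ fun i _ => Submodule.sum_mem _ fun j _ => hp i j))

lemma sum_comp_perm_of_mem {A : Type*} [AddCommMonoid A] {c v : Fin N → ℤ}
    (hv : v ∈ Finset.univ.image fun s : Equiv.Perm (Fin N) => c ∘ s) (F : ℤ → A) :
    ∑ i, F (v i) = ∑ i, F (c i) := by
  obtain ⟨s, -, rfl⟩ := Finset.mem_image.mp hv
  exact Equiv.sum_comp s fun i => F (c i)

lemma laurentMonomial_notMem_sqLowerSpan (c : Fin N → ℤ) :
    laurentMonomial c ∉ sqLowerSpan c := by
  intro h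
  -- the sum of the coefficients of all `z^v` with the same sum of squares
  set T : Laurent N →ₗ[ℂ] Laurent N :=
    onMonomials fun v => if ∑ i, v i ^ 2 = ∑ i, c i ^ 2 then 1 else 0 with hT
  have h0 : ∀ d : Fin N → ℤ, T (laurentMonomial d) =
      ∑ v ∈ Finset.univ.image (fun s : Equiv.Perm (Fin N) => d ∘ s),
        if ∑ i, d i ^ 2 = ∑ i, c i ^ 2 then 1 else 0 := by
    intro d
    rw [laurentMonomial, map_sum]
    refine Finset.sum_congr rfl fun v hv => ?_
    rw [hT, onMonomials_single, one_smul, sum_comp_perm_of_mem hv (fun x => x ^ 2)]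
  have h1 : sqLowerSpan c ≤ LinearMap.ker T := by
    rw [Submodule.span_le]
    rintro _ ⟨d, hd, rfl⟩
    rw [SetLike.mem_coe, LinearMap.mem_ker, h0]
    have hd' : ∑ i, d i ^ 2 ≠ ∑ i, c i ^ 2 := ne_of_lt hd
    simp [hd']
  have h2 : T (laurentMonomial c) = 0 := h1 h
  rw [h0] at h2
  simp only [if_true, Finset.sum_const] at h2
  rw [← Nat.cast_smul_eq_nsmul ℂ, smul_eq_zero_iff_left one_ne_zero, Nat.cast_eq_zero,
    Finset.card_eq_zero] at h2
  have : c ∈ Finset.univ.image (fun s : Equiv.Perm (Fin N) => c ∘ s) :=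
    Finset.mem_image.mpr ⟨1, Finset.mem_univ _, rfl⟩
  rw [h2] at this
  simp at this

lemma finEigenvalue_ne {k p0 : ℂ} (hg : Generic k p0) {d c : Fin N → ℤ}
    (h : ∑ i, d i ^ 2 ≠ ∑ i, c i ^ 2) : finEigenvalue k d ≠ finEigenvalue k c := by
  intro heq
  have hE : ∀ b : Fin N → ℤ, 2 * finEigenvalue k b = 2 * (∑ i, b i ^ 2 : ℤ) -
      (∑ i, ∑ j, ((b i - b j).natAbs : ℤ) : ℤ) * k := by
    intro b
    simp only [finEigenvalue, Int.cast_sum, Int.cast_natCast, Int.cast_pow]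
    ring
  refine hg (2 * (∑ i, d i ^ 2 - ∑ i, c i ^ 2))
    (∑ i, ∑ j, ((c i - c j).natAbs : ℤ) - ∑ i, ∑ j, ((d i - d j).natAbs : ℤ)) 0 (by omega) ?_
  have h1 := hE d
  rw [heq, hE c] at h1
  rw [Int.cast_mul, Int.cast_sub, Int.cast_sub, Int.cast_zero, Int.cast_ofNat]
  linear_combination -h1

lemma finite_sum_sq_lt (q : ℤ) : {d : Fin N → ℤ | ∑ i, d i ^ 2 < q}.Finite := by
  refine (Set.finite_Icc (fun _ => -q : Fin N → ℤ) (fun _ => q)).subset fun d hd => ?_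
  have h : ∀ i, -q ≤ d i ∧ d i ≤ q := by
    intro i
    have h1 := Finset.single_le_sum (f := fun i => d i ^ 2) (fun i _ => sq_nonneg (d i))
      (Finset.mem_univ i)
    have h2 : d i ^ 2 < q := lt_of_le_of_lt h1 hd
    constructor <;> nlinarith
  exact ⟨fun i => (h i).1, fun i => (h i).2⟩

/-- Uniqueness of the Jack polynomials, in a form comparing sums of squares of the exponents
instead of the dominance order. -/
lemma existsUnique_lap_eigenvector {k p0 : ℂ} (hg : Generic k p0) (c : Fin N → ℤ) :
    ∃! P, P - laurentMonomial c ∈ sqLowerSpan c ∧ ∃ e : ℂ, lap N k P = e • P :=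
  existsUnique_eigenvector laurentMonomial (lap N k)
    (fun d c => ∑ i, d i ^ 2 < ∑ i, c i ^ 2) (fun d => (∑ i, d i ^ 2).toNat) (finEigenvalue k) c
    (fun _ _ h h' => lt_trans h' h)
    (fun y z h => by
      have : 0 ≤ ∑ i, z i ^ 2 := Finset.sum_nonneg fun _ _ => sq_nonneg _
      omega)
    (lap_laurentMonomial_sub_mem k) (fun _ h => finEigenvalue_ne hg h.ne) (finite_sum_sq_lt _)
    (laurentMonomial_notMem_sqLowerSpan c)

lemma isSymm_laurentMonomial (c : Fin N → ℤ) : IsSymm (laurentMonomial c) := by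
  intro σ
  refine map_laurentMonomial (permAct σ).toLinearMap (fun v => v ∘ σ)
    σ.surjective.injective_comp_right (fun v => permAct_zPow σ v) c c ?_
  ext v
  simp only [Finset.mem_image, Finset.mem_univ, true_and, exists_exists_eq_and]
  constructor
  · rintro ⟨s, rfl⟩
    exact ⟨σ.trans s, rfl⟩
  · rintro ⟨s, rfl⟩
    exact ⟨σ.symm.trans s, by ext i; simp⟩

lemma isSymm_of_mem_span {f : Laurent N} (hf : f ∈ Submodule.span ℂ (Set.range laurentMonomial)) :
    IsSymm f := by
  intro σ
  have : Submodule.span ℂ (Set.range laurentMonomial) ≤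
      LinearMap.eqLocus (permAct σ).toLinearMap (LinearMap.id : Laurent N →ₗ[ℂ] Laurent N) := by
    rw [Submodule.span_le]
    rintro _ ⟨c, rfl⟩
    exact isSymm_laurentMonomial c σ
  exact this hf

lemma zPow_const_mul_laurentMonomial (b : ℤ) (c : Fin N → ℤ) :
    zPow (fun _ => b) * laurentMonomial c = laurentMonomial (fun i => c i + b) := by
  refine map_laurentMonomial (LinearMap.mulLeft ℂ (zPow fun _ => b)) (fun v => (fun _ => b) + v)
    (add_right_injective _) (fun v => zPow_mul _ _) c _ ?_
  rw [Finset.image_image]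
  congr 1
  ext s i
  simp [add_comm]

lemma sum_theta_laurentMonomial (c : Fin N → ℤ) :
    ∑ i, theta i (laurentMonomial c) = ((∑ i, c i : ℤ) : ℂ) • laurentMonomial c := by
  simp only [laurentMonomial, map_sum]
  rw [Finset.sum_comm, Finset.smul_sum]
  refine Finset.sum_congr rfl fun v hv => ?_
  simp only [theta_zPow]
  rw [← Finset.sum_smul, ← sum_comp_perm_of_mem hv (fun x => x), Int.cast_sum]

end FiniteTriangular

/-! ### The CMS operator on polynomials -/

section Polynomials

variable {N : ℕ}

/-- The inclusion of polynomials into rational functions. -/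
abbrev ratMap (N : ℕ) : MvPolynomial (Fin N) ℂ →+* FractionRing (MvPolynomial (Fin N) ℂ) :=
  algebraMap _ _

lemma ratMap_X_ne_zero (i : Fin N) : ratMap N (MvPolynomial.X i) ≠ 0 := by
  rw [Ne, map_eq_zero_iff _ (IsFractionRing.injective _ _)]
  exact MvPolynomial.X_ne_zero i

/-- The embedding of Laurent polynomials into rational functions. -/
def toRational (N : ℕ) : Laurent N →ₐ[ℂ] FractionRing (MvPolynomial (Fin N) ℂ) :=
  AddMonoidAlgebra.lift ℂ _ (Fin N → ℤ)
    { toFun := fun v => ∏ i, ratMap N (MvPolynomial.X i) ^ (v.toAdd i)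
      map_one' := by simp
      map_mul' := fun v w => by
        simp [zpow_add₀ (ratMap_X_ne_zero _), Finset.prod_mul_distrib] }

lemma toRational_zVar (i : Fin N) : toRational N (zVar i) = ratMap N (MvPolynomial.X i) := by
  rw [toRational, AddMonoidAlgebra.lift_single, one_smul]
  change ∏ j, _ ^ ((Pi.single i 1 : Fin N → ℤ) j) = _
  rw [Finset.prod_eq_single i]
  · simp
  · intro j _ hj
    simp [hj]
  · simp

lemma toLaurent_X (i : Fin N) : toLaurent N (MvPolynomial.X i) = zVar i :=
  MvPolynomial.aeval_X _ _

lemma toRational_toLaurent (f : MvPolynomial (Fin N) ℂ) :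
    toRational N (toLaurent N f) = ratMap N f := by
  have : (toRational N).comp (toLaurent N) = Algebra.algHom ℂ _ _ := by
    refine MvPolynomial.algHom_ext fun i => ?_
    rw [AlgHom.comp_apply, toLaurent_X, toRational_zVar]
    rfl
  exact congr($this f)

lemma toLaurent_injective : Function.Injective (toLaurent N) := by
  intro f g h
  apply IsFractionRing.injective (MvPolynomial (Fin N) ℂ)
    (FractionRing (MvPolynomial (Fin N) ℂ))
  rw [← toRational_toLaurent, h, toRational_toLaurent]

lemma toLaurent_monomial (v : Fin N → ℕ) :
    toLaurent N (MvPolynomial.monomial (Finsupp.equivFunOnFinite.symm v) 1) =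
      zPow fun i => (v i : ℤ) := by
  rw [toLaurent, MvPolynomial.aeval_monomial, map_one, one_mul, Finsupp.prod_fintype _ _ (by simp)]
  have h : ∀ s : Finset (Fin N), ∏ i ∈ s, (zPow (Pi.single i (v i : ℤ)) : Laurent N) =
      zPow (∑ i ∈ s, Pi.single i (v i : ℤ)) := by
    intro s
    induction s using Finset.induction_on with
    | empty => simp [AddMonoidAlgebra.one_def]
    | insert i s hi ih => rw [Finset.prod_insert hi, ih, zPow_mul, Finset.sum_insert hi]
  rw [← Finset.univ_sum_single (fun i => (v i : ℤ)), ← h]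
  refine Finset.prod_congr rfl fun i _ => ?_
  rw [AddMonoidAlgebra.single_pow, one_pow]
  simp [← Pi.single_smul]

lemma toLaurent_monomialPoly (v : Fin N → ℕ) :
    toLaurent N (monomialPoly v) = laurentMonomial fun i => (v i : ℤ) := by
  have hi : Function.Injective fun (v : Fin N → ℕ) (i : Fin N) => (v i : ℤ) := fun v w h => by
    ext i
    exact Int.ofNat_inj.mp (congr_fun h i)
  have : (Finset.univ.image fun s : Equiv.Perm (Fin N) => (fun i => (v i : ℤ)) ∘ s) =
      (Finset.univ.image fun s : Equiv.Perm (Fin N) => v ∘ s).image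
        fun v i => (v i : ℤ) := by
    rw [Finset.image_image]
    rfl
  rw [laurentMonomial, this, Finset.sum_image fun _ _ _ _ h => hi h, monomialPoly, map_sum]
  exact Finset.sum_congr rfl fun v _ => toLaurent_monomial v

/-- A Laurent polynomial becomes a polynomial after multiplication by a monomial. -/
lemma exists_zPow_mul_eq_toLaurent (f : Laurent N) :
    ∃ (c : ℕ) (g : MvPolynomial (Fin N) ℂ), zPow (fun _ => (c : ℤ)) * f = toLaurent N g := by
  have hc : ∀ c : ℕ, (zPow (fun _ : Fin N => (c : ℤ)) : Laurent N) =
      toLaurent N (MvPolynomial.monomial (Finsupp.equivFunOnFinite.symm fun _ => c) 1) :=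
    fun c => (toLaurent_monomial _).symm
  induction f using AddMonoidAlgebra.induction_linear with
  | zero => exact ⟨0, 0, by simp⟩
  | add f g hf hg =>
    obtain ⟨c, f', hf⟩ := hf
    obtain ⟨d, g', hg⟩ := hg
    refine ⟨c + d, MvPolynomial.monomial (Finsupp.equivFunOnFinite.symm fun _ => d) 1 * f' +
      MvPolynomial.monomial (Finsupp.equivFunOnFinite.symm fun _ => c) 1 * g', ?_⟩
    have : (zPow (fun _ : Fin N => ((c + d : ℕ) : ℤ)) : Laurent N) =
        zPow (fun _ => (c : ℤ)) * zPow fun _ => (d : ℤ) := by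
      rw [zPow_mul, Nat.cast_add]
      rfl
    rw [map_add, map_mul, map_mul, ← hc, ← hc, ← hf, ← hg, this]
    ring
  | single v x =>
    set c := ∑ i, (v i).natAbs with hcdef
    have hle : ∀ i, 0 ≤ (c : ℤ) + v i := by
      intro i
      have := Finset.single_le_sum (f := fun i => (v i).natAbs) (fun i _ => Nat.zero_le _)
        (Finset.mem_univ i)
      omega
    refine ⟨c, x • MvPolynomial.monomial
      (Finsupp.equivFunOnFinite.symm fun i => ((c : ℤ) + v i).toNat) 1, ?_⟩
    rw [map_smul, toLaurent_monomial, AddMonoidAlgebra.smul_single', mul_one,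
      AddMonoidAlgebra.single_mul_single, one_mul]
    congr 1
    ext i
    simp [hle i]

lemma toRational_injective : Function.Injective (toRational N) := by
  rw [injective_iff_map_eq_zero]
  intro f hf
  obtain ⟨c, g, hg⟩ := exists_zPow_mul_eq_toLaurent f
  have h1 : ratMap N g = 0 := by
    rw [← toRational_toLaurent, ← hg, map_mul, hf, mul_zero]
  rw [map_eq_zero_iff _ (IsFractionRing.injective _ _)] at h1
  rw [h1, map_zero] at hg
  have h2 := congr_arg (zPow (fun _ => -(c : ℤ)) * ·) hg
  have h3 : (fun _ => -(c : ℤ) : Fin N → ℤ) + (fun _ => (c : ℤ)) = 0 := by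
    ext i
    simp
  simpa only [← mul_assoc, zPow_mul, h3, ← AddMonoidAlgebra.one_def, one_mul, mul_zero] using h2

lemma theta_toLaurent (i : Fin N) (f : MvPolynomial (Fin N) ℂ) :
    theta i (toLaurent N f) = toLaurent N (euler i f) := by
  induction f using MvPolynomial.induction_on with
  | C c =>
    rw [← MvPolynomial.algebraMap_eq, AlgHom.commutes, Algebra.algebraMap_eq_smul_one, map_smul,
      theta_one]
    simp [euler, MvPolynomial.algebraMap_eq]
  | add f g hf hg => rw [map_add, map_add, hf, hg, euler, euler, euler, map_add, mul_add, map_add]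
  | mul_X f j hf =>
    have : theta i (zVar j) = toLaurent N (euler i (MvPolynomial.X j)) := by
      rcases eq_or_ne i j with rfl | h
      · simp [euler, toLaurent_X, -AddMonoidAlgebra.smul_single]
      · simp [euler, h, MvPolynomial.pderiv_X_of_ne h.symm]
    rw [map_mul, theta_mul, hf, toLaurent_X, this, ← toLaurent_X, ← map_mul, ← map_mul, ← map_add]
    congr 1
    simp only [euler, Derivation.leibniz, smul_eq_mul]
    ring

/-- On symmetric polynomials the CMS operator with rational coefficients is the operator
`lap`. -/
lemma cmsFinite_eq (k : ℂ) {f : MvPolynomial (Fin N) ℂ} (hf : IsSymm (toLaurent N f)) :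
    cmsFinite N k f = toRational N (lap N k (toLaurent N f)) := by
  have hpair : ∀ p q : Fin N, p ≠ q → toRational N (pairOp p q (toLaurent N f)) =
      ratMap N (MvPolynomial.X p + MvPolynomial.X q) /
        ratMap N (MvPolynomial.X p - MvPolynomial.X q) *
        ratMap N (euler p f - euler q f) := by
    intro p q h
    have h1 := congr_arg (toRational N) (zVar_sub_mul_pairOp hf h)
    have h2 : ratMap N (MvPolynomial.X p - MvPolynomial.X q) ≠ 0 := by
      rw [Ne, map_eq_zero_iff _ (IsFractionRing.injective _ _), sub_eq_zero]
      exact fun h' => h (MvPolynomial.X_injective h')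
    rw [theta_toLaurent, theta_toLaurent, ← map_sub (toLaurent N), map_mul, map_mul,
      toRational_toLaurent, map_sub, map_add, toRational_zVar, toRational_zVar, ← map_sub,
      ← map_add] at h1
    rw [div_mul_eq_mul_div, eq_div_iff h2, mul_comm, h1]
  have hsum : ∑ p, ∑ q, toRational N (pairOp p q (toLaurent N f)) =
      2 * ∑ p : Fin N, ∑ q ∈ Finset.Ioi p,
        ratMap N (MvPolynomial.X p + MvPolynomial.X q) /
          ratMap N (MvPolynomial.X p - MvPolynomial.X q) * ratMap N (euler p f - euler q f) := by
    have h1 := Finset.sum_sum_Ioi_add_eq_sum_sum_off_diag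
      (fun p q : Fin N => toRational N (pairOp p q (toLaurent N f)))
    have h2 : ∀ p : Fin N, ∑ q, toRational N (pairOp p q (toLaurent N f)) =
        ∑ q ∈ {p}ᶜ, toRational N (pairOp q p (toLaurent N f)) := by
      intro p
      rw [← Finset.sum_compl_add_sum {p}]
      simp [pairOp_self, pairOp_comm p]
    rw [Finset.sum_congr rfl fun p _ => h2 p, ← h1, Finset.mul_sum]
    refine Finset.sum_congr rfl fun p _ => ?_
    rw [Finset.mul_sum]
    refine Finset.sum_congr rfl fun q hq => ?_
    rw [pairOp_comm q p, two_mul, hpair p q (Finset.mem_Ioi.mp hq).ne]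
  have hk : ∀ x : FractionRing (MvPolynomial (Fin N) ℂ), ratMap N (MvPolynomial.C k) * x =
      k • x := by
    intro x
    rw [← MvPolynomial.algebraMap_eq, ← IsScalarTower.algebraMap_apply, Algebra.smul_def]
  simp only [cmsFinite, lap, LinearMap.sub_apply, LinearMap.smul_apply, LinearMap.sum_apply,
    LinearMap.comp_apply, theta_toLaurent, map_sub, map_smul, map_sum, hsum, hk,
    toRational_toLaurent]
  rw [two_mul, ← two_smul ℂ, smul_smul, div_mul_cancel₀ k (two_ne_zero)]

end Polynomials

/-! ### Uniqueness of the Jack polynomials -/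

section Uniqueness

variable {N : ℕ}

/-- The sequence `v_0, …, v_{N-1}, 0, 0, …`. -/
def padZero (v : Fin N → ℕ) (i : ℕ) : ℕ := if h : i < N then v ⟨i, h⟩ else 0

lemma sum_range_padZero {A : Type*} [AddCommMonoid A] (v : Fin N → ℕ) (F : ℕ → A) :
    ∑ i ∈ Finset.range N, F (padZero v i) = ∑ i, F (v i) := by
  rw [Finset.sum_range]
  exact Finset.sum_congr rfl fun i _ => by rw [padZero, dif_pos i.2]

lemma sum_Iic_eq_sum_range {A : Type*} [AddCommMonoid A] (j : Fin N) (f : ℕ → A) :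
    ∑ i ∈ Finset.Iic j, f i = ∑ i ∈ Finset.range (j + 1), f i := by
  have h : Finset.range (j + 1) = Finset.Iic (j : ℕ) := by
    ext i
    simp
  rw [h, ← Fin.map_valEmbedding_Iic, Finset.sum_map]
  rfl

lemma sum_Iic_padZero (v : Fin N → ℕ) (j : Fin N) :
    ∑ i ∈ Finset.Iic j, v i = ∑ i ∈ Finset.range (j + 1), padZero v i := by
  rw [← sum_Iic_eq_sum_range]
  exact Finset.sum_congr rfl fun i _ => by rw [padZero, dif_pos i.2]

/-- The dominance order is compatible with the sum of squares. -/
lemma sum_sq_lt_of_dominated {kap nu : Fin N → ℕ} (hk : Antitone kap)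
    (h : ∀ j : Fin N, ∑ i ∈ Finset.Iic j, kap i ≤ ∑ i ∈ Finset.Iic j, nu i) (hne : kap ≠ nu) :
    ∑ i, (kap i : ℤ) ^ 2 < ∑ i, (nu i : ℤ) ^ 2 := by
  have hle : ∀ n ≤ N, ∑ i ∈ Finset.range n, padZero kap i ≤ ∑ i ∈ Finset.range n, padZero nu i := by
    rintro (_ | n) hn
    · simp
    · have := h ⟨n, hn⟩
      rwa [sum_Iic_padZero, sum_Iic_padZero] at this
  have key := sum_sq_sub_le (x := fun i => (padZero nu i : ℤ)) (y := fun i => (padZero kap i : ℤ))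
    (fun i j hij => by
      simp only [padZero]
      split_ifs with hi hj
      · exact_mod_cast hk (show (⟨i, hj⟩ : Fin N) ≤ ⟨j, hi⟩ from hij)
      · omega
      · simp
      · simp)
    (fun i => by positivity)
    (fun n => by
      rcases le_total n N with hn | hn
      · exact_mod_cast hle n hn
      · have h0 : ∀ v : Fin N → ℕ, ∑ i ∈ Finset.range n, padZero v i =
            ∑ i ∈ Finset.range N, padZero v i := fun v =>
          sum_range_eq_of_zero (fun i hi => dif_neg (by omega)) (fun i hi => dif_neg (by omega))
        have := hle N le_rfl
        rw [← h0, ← h0] at this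
        exact_mod_cast this) N
  rw [sum_range_padZero nu (fun x => (x : ℤ) ^ 2), sum_range_padZero kap (fun x => (x : ℤ) ^ 2)]
    at key
  have hnn : ∀ i ∈ Finset.range N, 0 ≤ ((padZero nu i : ℤ) - padZero kap i) ^ 2 := fun i _ =>
    sq_nonneg _
  by_contra! hge
  have hz := (Finset.sum_eq_zero_iff_of_nonneg hnn).mp
    (le_antisymm (by linarith) (Finset.sum_nonneg hnn))
  refine hne (funext fun i => ?_)
  have := hz i (Finset.mem_range.mpr i.2)
  rw [sq_eq_zero_iff, padZero, padZero, dif_pos i.2, dif_pos i.2] at this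
  simp only [Fin.eta] at this
  omega

lemma IsJack.toLaurent_eigenvector {k : ℂ} {nu : Fin N → ℕ} {J : MvPolynomial (Fin N) ℂ}
    (h : IsJack k nu J) :
    toLaurent N J - laurentMonomial (fun i => (nu i : ℤ)) ∈ sqLowerSpan (fun i => (nu i : ℤ)) ∧
      ∃ e : ℂ, lap N k (toLaurent N J) = e • toLaurent N J := by
  have h1 : toLaurent N J - laurentMonomial (fun i => (nu i : ℤ)) ∈
      sqLowerSpan (fun i => (nu i : ℤ)) := by
    rw [← toLaurent_monomialPoly, ← map_sub]
    have := Submodule.mem_map_of_mem (f := (toLaurent N).toLinearMap) h.1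
    rw [Submodule.map_span] at this
    refine Submodule.span_mono ?_ this
    rintro _ ⟨_, ⟨kap, hk, -, hle, hne, rfl⟩, rfl⟩
    exact ⟨_, sum_sq_lt_of_dominated hk hle hne, (toLaurent_monomialPoly kap).symm⟩
  refine ⟨h1, ?_⟩
  obtain ⟨e, he⟩ := h.2
  have hs : IsSymm (toLaurent N J) := by
    refine isSymm_of_mem_span ?_
    have h2 := Submodule.add_mem _ (Submodule.span_mono (Set.image_subset_range _ _) h1)
      (Submodule.subset_span (Set.mem_range_self fun i => (nu i : ℤ)))
    rwa [sub_add_cancel] at h2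
  refine ⟨e, toRational_injective ?_⟩
  rw [← cmsFinite_eq k hs, he, ← map_smul, toRational_toLaurent]

lemma IsJack.unique {k p0 : ℂ} (hg : Generic k p0) {nu : Fin N → ℕ}
    {J J' : MvPolynomial (Fin N) ℂ} (h : IsJack k nu J) (h' : IsJack k nu J') : J = J' :=
  toLaurent_injective ((existsUnique_lap_eigenvector hg _).unique h.toLaurent_eigenvector
    h'.toLaurent_eigenvector)

end Uniqueness

/-! ### The image of a Jack--Laurent function in `N` variables -/

lemma sum_rowLen_le_card (lam : YoungDiagram) (n : ℕ) :
    ∑ i ∈ Finset.range n, lam.rowLen i ≤ lam.card := by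
  rw [card_eq_sum_rowLen, sum_range_eq_of_zero (n := lam.colLen 0) (m := max n (lam.colLen 0))
    (fun i hi => rowLen_eq_zero hi)
    (fun i hi => rowLen_eq_zero (le_trans (le_max_right _ _) hi))]
  exact Finset.sum_le_sum_of_subset (Finset.range_mono (le_max_left _ _))

lemma sum_rowLen_eq_card {lam : YoungDiagram} {n : ℕ} (h : lam.colLen 0 ≤ n) :
    ∑ i ∈ Finset.range n, lam.rowLen i = lam.card := by
  rw [card_eq_sum_rowLen]
  exact sum_range_eq_of_zero (fun i hi => rowLen_eq_zero (h.trans hi))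
    (fun i hi => rowLen_eq_zero hi)

lemma sum_chi {A : Type*} [AddCommMonoid A] {N : ℕ} {lam mu : YoungDiagram}
    (h : lam.colLen 0 + mu.colLen 0 ≤ N) (F : ℤ → A) (F0 : F 0 = 0) :
    ∑ i, F (chi N lam mu i) = ∑ i, F (parts lam mu i) := by
  classical
  have h0 : ∀ q : {q // q ∉ Set.range (chiEmb h)},
      F (Function.extend (chiEmb h) (parts lam mu) 0 q.1) = 0 := fun q => by
    rw [Function.extend_apply' _ _ _ q.2, Pi.zero_apply, F0]
  rw [← extend_chiEmb h, sum_eq_sum_range_add (chiEmb h), Finset.sum_eq_zero fun q _ => h0 q,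
    add_zero]
  exact Finset.sum_congr rfl fun i _ => by rw [(chiEmb h).injective.extend_apply]

lemma sum_chi_eq {N : ℕ} {lam mu : YoungDiagram} (h : lam.colLen 0 + mu.colLen 0 ≤ N) :
    ∑ i, chi N lam mu i = (lam.card : ℤ) - mu.card := by
  rw [sum_chi h (fun x => x) rfl, sum_parts lam mu (fun x => x), card_eq_sum_rowLen lam,
    card_eq_sum_rowLen mu]
  push_cast
  rw [Finset.sum_neg_distrib, sub_eq_add_neg]

lemma sum_range_reverse_add (N : ℕ) (f : ℕ → ℤ) : ∀ n ≤ N,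
    ∑ i ∈ Finset.range n, f (N - (i + 1)) + ∑ i ∈ Finset.range (N - n), f i =
      ∑ i ∈ Finset.range N, f i
  | 0, _ => by simp
  | n + 1, h => by
    have := sum_range_reverse_add N f n (by omega)
    rw [show N - n = N - (n + 1) + 1 by omega, Finset.sum_range_succ] at this
    rw [Finset.sum_range_succ]
    linarith

lemma sum_Iic_chi {N : ℕ} (lam : YoungDiagram) {mu : YoungDiagram} (h : mu.colLen 0 ≤ N)
    (j : Fin N) : ∑ i ∈ Finset.Iic j, chi N lam mu i =
      (∑ i ∈ Finset.range (j + 1), lam.rowLen i : ℕ) +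
        (∑ i ∈ Finset.range (N - (j + 1)), mu.rowLen i : ℕ) - (mu.card : ℤ) := by
  have h1 := sum_range_reverse_add N (fun i => (mu.rowLen i : ℤ)) (j + 1) j.2
  have h2 := sum_rowLen_eq_card h
  rw [← h2]
  have h3 : ∑ i ∈ Finset.Iic j, chi N lam mu i = ∑ i ∈ Finset.range (j + 1),
      ((lam.rowLen i : ℤ) - mu.rowLen (N - (i + 1))) := by
    rw [← sum_Iic_eq_sum_range]
    exact Finset.sum_congr rfl fun i _ => by rw [chi, Fin.val_rev]
  rw [h3, Finset.sum_sub_distrib]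
  push_cast
  linarith

/-- The order on pairs of partitions is carried to the dominance order on the sequences `χ`. -/
lemma sum_Iic_chi_le {N : ℕ} {l m lam mu : YoungDiagram} (hle : PairLE l m lam mu)
    (h : lam.colLen 0 + mu.colLen 0 ≤ N) (h' : l.colLen 0 + m.colLen 0 ≤ N) (j : Fin N) :
    ∑ i ∈ Finset.Iic j, chi N l m i ≤ ∑ i ∈ Finset.Iic j, chi N lam mu i := by
  rw [sum_Iic_chi l (by omega), sum_Iic_chi lam (by omega)]
  have h1 := hle.1
  have h2 := hle.2.1 (j + 1)
  have h3 := hle.2.2 (N - (j + 1))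
  have h4 := sum_rowLen_le_card m (N - (j + 1))
  have h5 := sum_rowLen_le_card l (j + 1)
  -- either `λ` has no part after position `j`, or `μ` none at or before it
  rcases le_total (mu.colLen 0) (N - (j + 1)) with hj | hj
  · have h6 := sum_rowLen_eq_card hj
    omega
  · have h6 := sum_rowLen_eq_card (lam := lam) (n := j + 1) (by omega)
    omega

lemma cast_shifted {N : ℕ} (lam : YoungDiagram) {mu : YoungDiagram} {a : ℕ}
    (h : mu.rowLen 0 ≤ a) (i : Fin N) : (shifted N lam mu a i : ℤ) = chi N lam mu i + a := by
  have := (mu.rowLen_anti 0 i.rev (Nat.zero_le _)).trans h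
  simp only [shifted, chi]
  omega

lemma antitone_shifted (N : ℕ) (lam mu : YoungDiagram) (a : ℕ) :
    Antitone (shifted N lam mu a) := by
  intro i j hij
  have h1 := lam.rowLen_anti i j hij
  have h2 := mu.rowLen_anti j.rev i.rev (Fin.rev_le_rev.mpr hij)
  simp only [shifted]
  omega

lemma zPow_mul_laurentMonomial_chi {N : ℕ} (lam : YoungDiagram) {mu : YoungDiagram} {a : ℕ}
    (h : mu.rowLen 0 ≤ a) : zPow (fun _ => (a : ℤ)) * laurentMonomial (chi N lam mu) =
      toLaurent N (monomialPoly (shifted N lam mu a)) := by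
  rw [zPow_const_mul_laurentMonomial, toLaurent_monomialPoly]
  simp only [cast_shifted lam h]

lemma phiAt_specialize_mFun {N : ℕ} (lam mu : YoungDiagram) :
    phiAt N (specialize N (mFun lam mu)) =
      if lam.colLen 0 + mu.colLen 0 ≤ N then laurentMonomial (chi N lam mu) else 0 := by
  rw [phiAt_specialize]
  split_ifs with h
  · exact phi_mFun lam mu h
  · exact phi_mFun_eq_zero lam mu (by omega)

/-- In `N` variables all members of a family triangular with respect to `m_{λ,μ}` are homogeneous
of degree `|λ| - |μ|`. -/
lemma sum_theta_phiAt {N : ℕ} {lam mu : YoungDiagram} {P : LambdaAt}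
    (hP : P - specialize N (mFun lam mu) ∈ lowerSpan N lam mu) :
    ∑ i, theta i (phiAt N P) = (((lam.card : ℤ) - mu.card : ℤ) : ℂ) • phiAt N P := by
  set T : LambdaAt →ₗ[ℂ] Laurent N :=
    (∑ i, theta i - (((lam.card : ℤ) - mu.card : ℤ) : ℂ) • LinearMap.id) ∘ₗ
      (phiAt N).toLinearMap with hT
  have hTa : ∀ f, T f = ∑ i, theta i (phiAt N f) -
      (((lam.card : ℤ) - mu.card : ℤ) : ℂ) • phiAt N f := by
    intro f
    simp [hT]
  have hm : ∀ l m : YoungDiagram, (l.card : ℤ) - m.card = (lam.card : ℤ) - mu.card →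
      T (specialize N (mFun l m)) = 0 := by
    intro l m h
    rw [hTa, phiAt_specialize_mFun]
    split_ifs with hN
    · rw [sum_theta_laurentMonomial, sum_chi_eq hN, h, sub_self]
    · simp
  have hle : lowerSpan N lam mu ≤ LinearMap.ker T := by
    rw [Submodule.span_le]
    rintro _ ⟨l, m, hle, -, rfl⟩
    exact hm l m hle.1
  have h0 : T (P - specialize N (mFun lam mu)) = 0 := hle hP
  rw [map_sub, hm lam mu rfl, sub_zero, hTa, sub_eq_zero] at h0
  exact h0

/-- Multiplication by a power of `z_1 ⋯ z_N` turns the image of a Jack--Laurent function into a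
Jack polynomial. -/
lemma IsJackLaurent.exists_isJack {k : ℂ} {N : ℕ} {lam mu : YoungDiagram} {P : LambdaAt}
    (hP : IsJackLaurent k N lam mu P) (hN : lam.colLen 0 + mu.colLen 0 ≤ N) {a : ℕ}
    (ha : mu.rowLen 0 ≤ a) : ∃ J : MvPolynomial (Fin N) ℂ,
      IsJack k (shifted N lam mu a) J ∧ toLaurent N J = zPow (fun _ => (a : ℤ)) * phiAt N P := by
  set V := Submodule.span ℂ {m : MvPolynomial (Fin N) ℂ | ∃ kap : Fin N → ℕ, Antitone kap ∧
        ∑ i, kap i = ∑ i, shifted N lam mu a i ∧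
        (∀ j : Fin N, ∑ i ∈ Finset.Iic j, kap i ≤ ∑ i ∈ Finset.Iic j, shifted N lam mu a i) ∧
        kap ≠ shifted N lam mu a ∧ m = monomialPoly kap} with hV
  set T : LambdaAt →ₗ[ℂ] Laurent N :=
    LinearMap.mulLeft ℂ (zPow fun _ => (a : ℤ)) ∘ₗ (phiAt N).toLinearMap with hT
  have hTa : ∀ f, T f = zPow (fun _ => (a : ℤ)) * phiAt N f := fun f => rfl
  have hsum : ∀ {l m : YoungDiagram}, m.rowLen 0 ≤ a → ∀ s : Finset (Fin N),
      ((∑ i ∈ s, shifted N l m a i : ℕ) : ℤ) = ∑ i ∈ s, chi N l m i + s.card * a := by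
    intro l m hm s
    push_cast
    simp only [cast_shifted l hm, Finset.sum_add_distrib, Finset.sum_const, nsmul_eq_mul]
  have hle : lowerSpan N lam mu ≤ (V.map (toLaurent N).toLinearMap).comap T := by
    rw [Submodule.span_le]
    rintro _ ⟨l, m, hle, hne, rfl⟩
    rw [SetLike.mem_coe, Submodule.mem_comap, hTa, phiAt_specialize_mFun]
    split_ifs with hlm
    swap
    · rw [mul_zero]
      exact Submodule.zero_mem _
    have hma : m.rowLen 0 ≤ a := by
      have := hle.2.2 1
      simp only [Finset.sum_range_one] at this
      omega
    rw [zPow_mul_laurentMonomial_chi l hma]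
    refine Submodule.mem_map_of_mem (Submodule.subset_span
      ⟨_, antitone_shifted N l m a, ?_, fun j => ?_, fun heq => ?_, rfl⟩)
    · have h1 := hsum (l := l) hma Finset.univ
      have h2 := hsum (l := lam) ha Finset.univ
      rw [sum_chi_eq hlm, hle.1, ← sum_chi_eq hN, ← h2] at h1
      exact_mod_cast h1
    · have h1 := hsum (l := l) hma (Finset.Iic j)
      have h2 := hsum (l := lam) ha (Finset.Iic j)
      have h3 := sum_Iic_chi_le hle hN hlm j
      omega
    · have h1 : chi N l m = chi N lam mu := by
        ext i
        have h2 := congr_fun heq i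
        have h3 := cast_shifted l hma i
        have h4 := cast_shifted lam ha i
        omega
      have h2 := sqSum_lt hle hne
      rw [sqSum, sqSum, ← sum_chi hlm (fun x => x ^ 2) (by simp), h1,
        sum_chi hN (fun x => x ^ 2) (by simp)] at h2
      exact lt_irrefl _ h2
  obtain ⟨J, hJV, hJ⟩ := hle hP.1
  rw [map_sub, hTa, hTa, phiAt_specialize_mFun, if_pos hN, zPow_mul_laurentMonomial_chi lam ha]
    at hJ
  have hJ' : toLaurent N (monomialPoly (shifted N lam mu a) + J) =
      zPow (fun _ => (a : ℤ)) * phiAt N P := by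
    rw [map_add]
    exact (add_comm _ _).trans (eq_sub_iff_add_eq.mp hJ)
  refine ⟨monomialPoly (shifted N lam mu a) + J, ⟨by rwa [add_sub_cancel_left], ?_⟩, hJ'⟩
  obtain ⟨E, hE⟩ := hP.2
  refine ⟨E + 2 * a * ((lam.card : ℤ) - mu.card : ℤ) + N * a ^ 2, ?_⟩
  have hs : IsSymm (toLaurent N (monomialPoly (shifted N lam mu a) + J)) := by
    obtain ⟨f, rfl⟩ := specialize_surjective (N : ℂ) P
    rw [hJ', phiAt_specialize]
    exact IsSymm.mul (fun σ => permAct_zPow σ _) (isSymm_phi f)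
  rw [cmsFinite_eq k hs, ← toRational_toLaurent, map_smul, hJ', lap_shift, sum_theta_phiAt hP.1,
    ← phiAt_cmsInfinite, hE, map_smul, smul_smul, ← add_smul, ← add_smul, mul_smul_comm]
  push_cast
  rfl

lemma isJack_jack {N : ℕ} {k : ℂ} {nu : Fin N → ℕ} {J : MvPolynomial (Fin N) ℂ}
    (h : IsJack k nu J) : IsJack k nu (jack k nu) := Classical.epsilon_spec ⟨J, h⟩

theorem phiAt_jackLaurent {k : ℂ} {N : ℕ} (hg : Generic k N) {lam mu : YoungDiagram}
    (hN : lam.colLen 0 + mu.colLen 0 ≤ N) {a : ℕ} (ha : mu.rowLen 0 ≤ a) :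
    phiAt N (jackLaurent k N lam mu) =
      zPow (fun _ => -(a : ℤ)) * toLaurent N (jack k (shifted N lam mu a)) := by
  obtain ⟨J, hJ, hJP⟩ := (isJackLaurent_jackLaurent hg lam mu).exists_isJack hN ha
  have h0 : (fun _ => -(a : ℤ) : Fin N → ℤ) + (fun _ => (a : ℤ)) = 0 := by
    ext i
    simp
  rw [(isJack_jack hJ).unique hg hJ, hJP, ← mul_assoc, zPow_mul, h0]
  exact (one_mul _).symm

end JackLaurent

end

/-- Existence and uniqueness of the Jack--Laurent symmetric functions for generic parameters; their
images in `N` variables in terms of the usual Jack polynomials; and `*`-duality. -/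
theorem theorem4p1 :
    (∀ k p0 : ℂ, JackLaurent.Generic k p0 → ∀ lam mu : YoungDiagram,
      ∃! P : JackLaurent.LambdaAt, JackLaurent.IsJackLaurent k p0 lam mu P) ∧
    (∀ (k : ℂ) (N : ℕ), JackLaurent.Generic k (N : ℂ) → ∀ lam mu : YoungDiagram,
      lam.colLen 0 + mu.colLen 0 < N → ∀ a : ℕ, mu.rowLen 0 ≤ a →
      JackLaurent.phiAt N (JackLaurent.jackLaurent k (N : ℂ) lam mu) =
        AddMonoidAlgebra.single (fun _ : Fin N => -(a : ℤ)) (1 : ℂ) *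
          JackLaurent.toLaurent N
            (JackLaurent.jack k (JackLaurent.shifted N lam mu a))) ∧
    (∀ k p0 : ℂ, JackLaurent.Generic k p0 → ∀ lam mu : YoungDiagram,
      JackLaurent.star (JackLaurent.jackLaurent k p0 lam mu) =
        JackLaurent.jackLaurent k p0 mu lam) := by
  exact ⟨fun _ _ hg => JackLaurent.existsUnique_isJackLaurent hg,
    fun _ _ hg _ _ hN _ ha => JackLaurent.phiAt_jackLaurent hg hN.le ha,
    fun _ _ hg => JackLaurent.star_jackLaurent hg⟩
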